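/- **Theorem (Kagome lattice, continuum limit at the bottom of the spectrum).** *Lattice operator.* The Kagome lattice has vertex set $\mathbf Z^2\times\{1,2,3\}$, the vertex $(n,j)$ being placed at $p_j+n_1\mathbf v_1+n_2\mathbf v_2$, where $\mathbf v_1,\mathbf v_2$ have equal length and enclose an angle of $60^\circ$ and $p_1=\mathbf v_1/2$, $p_2=\mathbf v_2/2$, $p_3=0$; two vertices are adjacent if their distance is $|\mathbf v_1|/2$ (so every vertex has degree $4$). Functions on the vertices are written as $u:\mathbf Z^2\to\mathbf C^3$, and $\Delta_\Gamma$ is the mean over the adjacent vertices. For $h>0$ put $-\Delta_{disc,h}=h^{-2}(-\Delta_\Gamma+1)$; its symbol is $$-\frac1{4h^2}\begin{pmatrix}-4&1+e^{ih\eta_1}e^{-ih\eta_2}&1+e^{ih\eta_1}\\1+e^{-ih\eta_1}e^{ih\eta_2}&-4&1+e^{ih\eta_2}\\1+e^{-ih\eta_1}&1+e^{-ih\eta_2}&-4\end{pmatrix}.$$ *Data.* Let $\langle x\rangle=(1+|x|^2)^{1/2}$ and $f\in H^{m,s}(\mathbf R^2;\mathbf C^3)$, i.e. $\langle x\rangle^s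 f\in H^m$, with $m>2$ and $s>3$. Let $V\in H^{r}(\mathbf R^2)$ be real-valued with $r>1$, and let $z\in\mathbf C\setminus\mathbf R$. Both $f$ and $V$ are taken as their continuous representatives. Put $f_h(n)=f(hn)$ and $(V_{disc,h}u)(n)=V(hn)u(n)$. For $u_h\in\ell^2(\mathbf Z^2;\mathbf C^3)$ let $\widehat u_h(\xi)=\frac h{2\pi}\sum_n e^{-ihn\cdot\xi}u_h(n)$ (convergent in $L^2([-\pi/h,\pi/h]^2)$) and $$\widetilde u_h(x)=\frac h{2\pi}\int_{[-\pi/h,\pi/h]^2}e^{ix\cdot\xi}\,\widehat u_h(\xi)\,d\xi,\qquad x\in\mathbf R^2 .$$ Let $\Pi_0$ be the orthogonal projection of $\mathbf C^3$ onto the span of $(1,1,1)$, and $g=\Pi_0f$. *Claim.* For every $h>0$ the equation $$(-\Delta_{disc,h}+V_{disc,h}-z)u_h=f_h\quad\text{on }\mathbf Z^2$$ has a unique solution $u_h\in\ell^2(\mathbf Z^2;\mathbf C^3)$. The equation $$\Big(-\frac1{12}\big(\partial_1^2-\partial_1\partial_2+\partial_2^2\big)+V(x)-z\Big)v=g\quad\text{on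 }\mathbf R^2$$ (in the sense of distributions) has a unique solution $v\in L^2(\mathbf R^2;\mathbf C^3)$; it is continuous (after modification on a null set) and satisfies $\Pi_0v=v$. As $h\to0$, $\widetilde u_h\to v$ in $L^{2,-\sigma}(\mathbf R^2)$ for every $0<\sigma<1/2$, that is $\|\langle x\rangle^{-\sigma}(\widetilde u_h-v)\|_{L^2}\to0$, and $\widetilde u_h\to v$ locally uniformly on $\mathbf R^2$. -/

import Mathlib

open MeasureTheory Set Filter Topology TemperedDistribution
open scoped ENNReal SchwartzMap

namespace Kagome

noncomputable section

/-- The Euclidean plane. -/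
abbrev Plane : Type := EuclideanSpace ℝ (Fin 2)

/-- The values of a lattice function on one period cell, which holds three vertices. -/
abbrev Cell : Type := EuclideanSpace ℂ (Fin 3)

/-! ### Function spaces on the plane -/

/-- `u ∈ H^m`, for a function `u` in `L²` (in particular for every `m ≥ 0`). -/
def MemH {F : Type*} [NormedAddCommGroup F] [NormedSpace ℂ F] [CompleteSpace F]
    (m : ℝ) (u : Plane → F) : Prop :=
  ∃ hu : MemLp u 2 (volume : Measure Plane), MemSobolev m 2 ((hu.toLp u : Lp F 2 volume) : 𝓢'(Plane, F))

/-- The weight `⟨x⟩ ^ s = (1 + |x|²) ^ (s / 2)`. -/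
def weight (s : ℝ) (x : Plane) : ℝ := (1 + ‖x‖ ^ 2) ^ (s / 2)

/-- `u ∈ H^{m,s}`, that is `⟨x⟩ ^ s u ∈ H^m`. -/
def MemHW {F : Type*} [NormedAddCommGroup F] [NormedSpace ℂ F] [CompleteSpace F]
    (m s : ℝ) (u : Plane → F) : Prop :=
  MemH m (fun x => (weight s x : ℂ) • u x)

/-- The norm of `u` in `L^{2,s}`. -/
def weightedNorm {F : Type*} [NormedAddCommGroup F] [NormedSpace ℂ F]
    (s : ℝ) (u : Plane → F) : ℝ≥0∞ :=
  eLpNorm (fun x => (weight s x : ℂ) • u x) 2 (volume : Measure Plane)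

/-! ### The Kagome lattice and its Laplacian -/

/-- A vertex is given by its period cell `n ∈ ℤ²` and its type `j`. -/
abbrev Vertex : Type := (Fin 2 → ℤ) × Fin 3

/-- Twice the coordinates, in the basis `v₁, v₂` of the period lattice (two vectors of equal length
at an angle of 60 degrees), of the vertex `p_j + n₁ v₁ + n₂ v₂`, where
`p₀ = v₁ / 2`, `p₁ = v₂ / 2`, `p₂ = 0`. -/
def doubledPos (a : Vertex) : ℤ × ℤ :=
  (2 * a.1 0 + ![1, 0, 0] a.2, 2 * a.1 1 + ![0, 1, 0] a.2)

/-- The six vectors `± v₁ / 2`, `± v₂ / 2`, `± (v₁ - v₂) / 2` (doubled). -/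
def bondVectors : Finset (ℤ × ℤ) := {(1, 0), (-1, 0), (0, 1), (0, -1), (1, -1), (-1, 1)}

/-- The Kagome lattice: vertices are joined when they are at distance `|v₁| / 2`. -/
def graph : SimpleGraph Vertex where
  Adj a b := doubledPos b - doubledPos a ∈ bondVectors
  symm := ⟨by
    intro a b hab
    have h : ∀ w ∈ bondVectors, -w ∈ bondVectors := by decide
    simpa using h _ hab⟩
  loopless := ⟨by
    intro a ha
    have h : (0 : ℤ × ℤ) ∉ bondVectors := by decide
    exact h (by simpa using ha)⟩

/-- The Laplacian: the mean over the adjacent vertices. -/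
def laplacian (u : (Fin 2 → ℤ) → Cell) (n : Fin 2 → ℤ) : Cell :=
  WithLp.toLp 2 fun j =>
    ((graph.neighborSet (n, j)).ncard : ℂ)⁻¹ * ∑ᶠ b ∈ graph.neighborSet (n, j), u b.1 b.2

/-- The four neighbours of a vertex. -/
def neighbours (n : Fin 2 → ℤ) : Fin 3 → Finset Vertex :=
  ![{(n, 1), (n + ![1, -1], 1), (n, 2), (n + ![1, 0], 2)},
    {(n, 0), (n + ![-1, 1], 0), (n, 2), (n + ![0, 1], 2)},
    {(n, 0), (n + ![-1, 0], 0), (n, 1), (n + ![0, -1], 1)}]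

theorem neighborSet_eq (n : Fin 2 → ℤ) (j : Fin 3) :
    graph.neighborSet (n, j) = (neighbours n j : Set Vertex) := by
  ext ⟨k, i⟩
  simp only [SimpleGraph.mem_neighborSet, graph, bondVectors, doubledPos, Finset.mem_insert,
    Finset.mem_singleton, Prod.fst_sub, Prod.snd_sub, Prod.ext_iff, Finset.mem_coe]
  fin_cases j <;> fin_cases i <;>
    simp [neighbours, funext_iff, Fin.forall_fin_two, Matrix.vecHead, Matrix.vecTail] <;> omega

/-- The Laplacian in coordinates. -/
theorem laplacian_apply (u : (Fin 2 → ℤ) → Cell) (n : Fin 2 → ℤ) :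
    laplacian u n = (1 / 4 : ℂ) • !₂[
      u n 1 + u (n + ![1, -1]) 1 + (u n 2 + u (n + ![1, 0]) 2),
      u n 0 + u (n + ![-1, 1]) 0 + (u n 2 + u (n + ![0, 1]) 2),
      u n 0 + u (n + ![-1, 0]) 0 + (u n 1 + u (n + ![0, -1]) 1)] := by
  ext j
  have hne : ∀ w : Fin 2 → ℤ, w ≠ 0 → n ≠ n + w := fun w hw he => hw (by simpa using he.symm)
  have h1 := hne ![1, -1] (by decide)
  have h2 := hne ![1, 0] (by decide)
  have h3 := hne ![-1, 1] (by decide)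
  have h4 := hne ![0, 1] (by decide)
  have h5 := hne ![-1, 0] (by decide)
  have h6 := hne ![0, -1] (by decide)
  simp only [laplacian, neighborSet_eq, finsum_mem_coe_finset, Set.ncard_coe_finset,
    neighbours]
  generalize n + ![1, -1] = a1 at *
  generalize n + ![1, 0] = a2 at *
  generalize n + ![-1, 1] = a3 at *
  generalize n + ![0, 1] = a4 at *
  generalize n + ![-1, 0] = a5 at *
  generalize n + ![0, -1] = a6 at *
  fin_cases j <;> simp [h1, h2, h3, h4, h5, h6] <;> ring

/-- `-Δ_{disc,h} = h⁻² (-Δ + 1)`: the Laplacian shifted by the bottom `-1` of its spectrum and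
scaled by `h⁻²`. -/
def hamiltonian (h : ℝ) (u : (Fin 2 → ℤ) → Cell) (n : Fin 2 → ℤ) : Cell :=
  ((h ^ 2 : ℝ) : ℂ)⁻¹ • (-laplacian u n + u n)

/-- The point `h n` of the plane. -/
def meshPoint (h : ℝ) (n : Fin 2 → ℤ) : Plane := WithLp.toLp 2 fun j => h * (n j : ℝ)

/-- `u` is a square summable solution of `(-Δ_{disc,h} + V_{disc,h} - z) u = f_h`, where
`(V_{disc,h} u)(n) = V (h n) u(n)` and `f_h(n) = f (h n)`. -/
def IsLatticeSolution (h : ℝ) (V : Plane → ℝ) (z : ℂ) (f : Plane → Cell)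
    (u : (Fin 2 → ℤ) → Cell) : Prop :=
  Memℓp u 2 ∧
    ∀ n, hamiltonian h u n + (V (meshPoint h n) : ℂ) • u n - z • u n = f (meshPoint h n)

/-! ### Interpolation of lattice functions -/

/-- The torus `[-π / h, π / h]²`. -/
def torus (h : ℝ) : Set Plane := {ξ | ∀ j, ξ j ∈ Icc (-(Real.pi / h)) (Real.pi / h)}

theorem volume_torus_lt_top (h : ℝ) : (volume : Measure Plane) (torus h) < ∞ := by
  refine (Metric.isBounded_iff_subset_closedBall (0 : Plane)).2
    ⟨Real.sqrt (2 * (Real.pi / h) ^ 2), ?_⟩ |>.measure_lt_top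
  intro ξ hξ
  rw [mem_closedBall_zero_iff, EuclideanSpace.norm_eq]
  refine Real.sqrt_le_sqrt ?_
  have hj : ∀ j, ξ j ^ 2 ≤ (Real.pi / h) ^ 2 := fun j => sq_le_sq' (hξ j).1 (hξ j).2
  simp only [Fin.sum_univ_two, Real.norm_eq_abs, sq_abs]
  linarith [hj 0, hj 1]

/-- The function `e^{-i h n · ξ} a` of `ξ`. -/
def mode (h : ℝ) (n : Fin 2 → ℤ) (a : Cell) (ξ : Plane) : Cell :=
  Complex.exp (-(Complex.I * (inner ℝ (meshPoint h n) ξ : ℝ))) • a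

theorem memLp_mode (h : ℝ) (n : Fin 2 → ℤ) (a : Cell) :
    MemLp (mode h n a) 2 (volume.restrict (torus h)) := by
  have : IsFiniteMeasure ((volume : Measure Plane).restrict (torus h)) :=
    isFiniteMeasure_restrict.2 (volume_torus_lt_top h).ne
  have hc : Continuous (mode h n a) := by
    unfold mode
    fun_prop
  refine MemLp.of_bound hc.aestronglyMeasurable ‖a‖ (Eventually.of_forall fun ξ => ?_)
  rw [mode, norm_smul, Complex.norm_exp]
  simp

/-- The discrete Fourier transform
`û(ξ) = (h / 2π) ∑ₙ e^{-i h n · ξ} u(n)`, a series in `L²` of the torus. -/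
def discreteFourier (h : ℝ) (u : (Fin 2 → ℤ) → Cell) :
    Lp Cell 2 ((volume : Measure Plane).restrict (torus h)) :=
  ((h / (2 * Real.pi) : ℝ) : ℂ) • ∑' n, (memLp_mode h n (u n)).toLp (mode h n (u n))

/-- The interpolation `ũ(x) = (h / 2π) ∫ e^{i x · ξ} û(ξ) dξ` over the torus. -/
def interpolation (h : ℝ) (u : (Fin 2 → ℤ) → Cell) (x : Plane) : Cell :=
  ((h / (2 * Real.pi) : ℝ) : ℂ) •
    ∫ ξ in torus h, Complex.exp (Complex.I * (inner ℝ x ξ : ℝ)) • discreteFourier h u ξ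

/-! ### The limit equation -/

/-- The orthogonal projection of `ℂ³` onto the constant vectors, the kernel of the symbol of
`-Δ_{disc,h}` at frequency `0` (the eigenspace for the lowest characteristic root). -/
def bottomProj (a : Cell) : Cell := WithLp.toLp 2 fun _ => (a 0 + a 1 + a 2) / 3

/-- The partial derivative `∂_j φ`. -/
def partialD (j : Fin 2) (φ : Plane → ℂ) (x : Plane) : ℂ :=
  fderiv ℝ φ x (EuclideanSpace.single j 1)

/-- `-(1/12) (∂₁² - ∂₁∂₂ + ∂₂²) φ`. -/
def limitOp (φ : Plane → ℂ) (x : Plane) : ℂ :=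
  -(1 / 12 : ℂ) * (partialD 0 (partialD 0 φ) x - partialD 0 (partialD 1 φ) x
    + partialD 1 (partialD 1 φ) x)

/-- `v ∈ L²` solves `(-(1/12) (∂₁² - ∂₁∂₂ + ∂₂²) + V - z) v = g` in the sense of distributions. -/
def IsContinuumSolution (V : Plane → ℝ) (z : ℂ) (g v : Plane → Cell) : Prop :=
  MemLp v 2 (volume : Measure Plane) ∧
    ∀ φ : Plane → ℂ, ContDiff ℝ (⊤ : ℕ∞) φ → HasCompactSupport φ →
      ∫ x, (limitOp φ x + ((V x : ℂ) - z) * φ x) • v x = ∫ x, φ x • g x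

end

end Kagome

namespace Kagome
noncomputable section

/-! ### The torus as a quotient -/

-- On the Fourier side the lattice operator is multiplication by a Hermitian 3×3 symbol divided by
-- `h ^ 2`. At frequency `0` the symbol has the simple eigenvalue `0` on the constant vectors, and
-- its other eigenvalues are positive. After division by `h ^ 2` the latter blow up, so only the
-- component along `(1,1,1)` survives, and the lowest eigenvalue tends to the quadratic form `P =
-- limitSymbol`. Hence the free lattice resolvents converge at each frequency to `(P - z)⁻¹ Π₀`
-- (`tendsto_symbolRes`). A lower bound for the bond energy on the torus (`energy_coercive`) bounds
-- them by a multiple of `(1 + |ζ|²)⁻¹`, uniformly in `h`. Dominated convergence then gives strong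
-- convergence with a gain of two powers of frequency (`tendsto_resMult`).
--
-- The transform `spec h u` is scaled so that the interpolation of `u` is its inverse Fourier
-- transform (`interpolation_eq_fourierInv`). Data enter the lattice equation by sampling. For
-- functions in a Sobolev space of order above `1` sampling is bounded uniformly in the mesh
-- (`sum_sample_le`) and exact on band limited functions once the mesh is fine, hence consistent by
-- density. The same holds for products with continuous functions vanishing at infinity
-- (`tendsto_spec_sample_smul`), which covers both `f = ⟨x⟩ ^ (-s) (⟨x⟩ ^ s f)` and `V v`.
--
-- Both equations are solved by coercivity: the operators have real quadratic forms and `z` is not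
-- real. On the plane the unbounded operator is first conjugated by `(1 + P)^(-1/2)` (`formOp`).
-- Uniqueness also forces `Π₀ v = v`.
--
-- The potential is treated as a perturbation. Let `w` solve the free lattice equation with source
-- the samples of `f - V v`. Its spectrum converges to that of `v`, because `Π₀ (f - V v) = g - V
-- v`. The full operator maps `u - w` to `V (v - w)`, which tends to zero, so `u` has the same limit
-- in `L²`. Then `u` solves a free equation with convergent source, which upgrades the convergence
-- to the norm of `⟨ζ⟩ ^ (-2) L²`. That norm controls both the `L²` norm and the supremum of the
-- inverse transform.

local instance unitCircleMeasureSpace : MeasureSpace UnitAddCircle := ⟨AddCircle.haarAddCircle⟩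

local instance unitCircleIsAddHaar : Measure.IsAddHaarMeasure (volume : Measure UnitAddCircle) :=
  inferInstanceAs (Measure.IsAddHaarMeasure AddCircle.haarAddCircle)

/-- The class of `h ξ / 2π` modulo `1`. -/
def toUnitTorus (h : ℝ) (ξ : Plane) : UnitAddTorus (Fin 2) :=
  fun j => ((h / (2 * Real.pi) * ξ j : ℝ) : UnitAddCircle)

/-- The half open box of side `1` centred at the origin. -/
def unitBox : Set (Fin 2 → ℝ) := {x | ∀ j, x j ∈ Ioc (-(1 / 2) : ℝ) (-(1 / 2) + 1)}

theorem measurableSet_unitBox : MeasurableSet unitBox :=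
  MeasurableSet.univ_pi' fun _ => measurableSet_Ioc

theorem measurable_toUnitTorus (h : ℝ) : Measurable (toUnitTorus h) := by
  refine measurable_pi_lambda _ fun j => AddCircle.measurable_mk'.comp ?_
  fun_prop

theorem measurableSet_torus (h : ℝ) : MeasurableSet (torus h) := by
  have : torus h = ⋂ j, (fun ξ : Plane => ξ j) ⁻¹' Icc (-(Real.pi / h)) (Real.pi / h) := by
    ext; simp [torus]
  rw [this]
  refine MeasurableSet.iInter fun j => ?_
  exact (by fun_prop : Measurable fun ξ : Plane => ξ j) measurableSet_Icc

instance isFiniteMeasure_restrict_torus (h : ℝ) :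
    IsFiniteMeasure ((volume : Measure Plane).restrict (torus h)) :=
  isFiniteMeasure_restrict.2 (volume_torus_lt_top h).ne

theorem map_ofLp_smul {c : ℝ} (hc : 0 < c) :
    Measure.map (fun ξ : Plane => fun j => c * ξ j) volume
      = ENNReal.ofReal ((c ^ 2)⁻¹) • (volume : Measure (Fin 2 → ℝ)) := by
  have h1 : (fun ξ : Plane => fun j => c * ξ j)
      = (fun x : Fin 2 → ℝ => c • x) ∘ (WithLp.ofLp : Plane → (Fin 2 → ℝ)) := by
    ext; simp
  rw [h1, ← Measure.map_map (by fun_prop) (by fun_prop),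
    (PiLp.volume_preserving_ofLp (Fin 2)).map_eq, Measure.map_addHaar_smul _ hc.ne']
  simp [abs_of_pos (pow_pos hc 2)]

/-- The closed box and the half open fundamental domain differ only by a null part of the boundary.
-/
theorem torus_ae_eq {h : ℝ} (hh : 0 < h) :
    torus h =ᵐ[volume] (fun ξ : Plane => fun j => h / (2 * Real.pi) * ξ j) ⁻¹' unitBox := by
  have hc : 0 < h / (2 * Real.pi) := by positivity
  have key := (PiLp.volume_preserving_ofLp (Fin 2)).quasiMeasurePreserving.preimage_ae_eq
    (Measure.univ_pi_Ioc_ae_eq_Icc (μ := fun _ : Fin 2 => (volume : Measure ℝ))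
      (f := fun _ => -(Real.pi / h)) (g := fun _ => Real.pi / h))
  have e1 : torus h = (WithLp.ofLp : Plane → (Fin 2 → ℝ)) ⁻¹'
      Icc (fun _ => -(Real.pi / h)) (fun _ => Real.pi / h) := by
    ext ξ
    simp [torus, Pi.le_def, forall_and]
  have e2 : (fun ξ : Plane => fun j => h / (2 * Real.pi) * ξ j) ⁻¹' unitBox
      = (WithLp.ofLp : Plane → (Fin 2 → ℝ)) ⁻¹'
        (univ.pi fun _ => Ioc (-(Real.pi / h)) (Real.pi / h)) := by
    have e3 : ∀ t : ℝ, h / (2 * Real.pi) * t ∈ Ioc (-(1 / 2) : ℝ) (-(1 / 2) + 1) ↔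
        t ∈ Ioc (-(Real.pi / h)) (Real.pi / h) := by
      intro t
      have e4 : -(1 / 2) = h / (2 * Real.pi) * (-(Real.pi / h)) := by
        field_simp
      have e5 : -(1 / 2) + 1 = h / (2 * Real.pi) * (Real.pi / h) := by
        field_simp; norm_num
      rw [mem_Ioc, mem_Ioc, e5, e4, mul_lt_mul_iff_right₀ hc, mul_le_mul_iff_right₀ hc]
    ext ξ
    simp only [unitBox, mem_preimage, Set.mem_ofPred_eq, Set.mem_pi, mem_univ, true_imp_iff, e3]
  rw [e1, e2]
  exact key.symm

theorem measurePreserving_mk_unitBox :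
    MeasurePreserving (fun x : Fin 2 → ℝ => (fun j => (x j : UnitAddCircle) : UnitAddTorus (Fin 2)))
      (volume.restrict unitBox) volume := by
  have h1 : MeasurePreserving ((↑) : ℝ → UnitAddCircle)
      (volume.restrict (Ioc (-(1 / 2) : ℝ) (-(1 / 2) + 1))) volume := by
    have h2 := AddCircle.measurePreserving_mk 1 (-(1 / 2))
    refine ⟨h2.measurable, h2.map_eq.trans ?_⟩
    rw [AddCircle.volume_eq_smul_haarAddCircle, ENNReal.ofReal_one, one_smul]
    rfl
  have := measurePreserving_pi (fun _ : Fin 2 => (volume : Measure ℝ).restrict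
    (Ioc (-(1 / 2) : ℝ) (-(1 / 2) + 1))) (fun _ => (volume : Measure UnitAddCircle))
    (fun _ => h1)
  rw [← Measure.restrict_pi_pi] at this
  convert! this using 2
  ext x; simp [unitBox]

/-- The torus of side `2π / h` covers the unit torus with constant density. -/
theorem map_toUnitTorus {h : ℝ} (hh : 0 < h) :
    Measure.map (toUnitTorus h) (volume.restrict (torus h))
      = ENNReal.ofReal ((2 * Real.pi / h) ^ 2) • (volume : Measure (UnitAddTorus (Fin 2))) := by
  have hc : 0 < h / (2 * Real.pi) := by positivity
  have hS : Measurable (fun ξ : Plane => fun j => h / (2 * Real.pi) * ξ j) := by fun_prop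
  have e1 : toUnitTorus h = (fun x : Fin 2 → ℝ =>
      (fun j => (x j : UnitAddCircle) : UnitAddTorus (Fin 2))) ∘
      (fun ξ : Plane => fun j => h / (2 * Real.pi) * ξ j) := rfl
  rw [Measure.restrict_congr_set (torus_ae_eq hh), e1,
    ← Measure.map_map measurePreserving_mk_unitBox.measurable hS,
    ← Measure.restrict_map hS measurableSet_unitBox, map_ofLp_smul hc, Measure.restrict_smul,
    Measure.map_smul, measurePreserving_mk_unitBox.map_eq]
  congr 2
  field_simp

theorem mFourier_toUnitTorus (h : ℝ) (n : Fin 2 → ℤ) (ξ : Plane) :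
    UnitAddTorus.mFourier n (toUnitTorus h ξ)
      = Complex.exp (Complex.I * (inner ℝ (meshPoint h n) ξ : ℝ)) := by
  simp only [UnitAddTorus.mFourier, toUnitTorus, ContinuousMap.coe_mk, fourier_coe_apply,
    Fin.prod_univ_two, ← Complex.exp_add]
  congr 1
  simp only [meshPoint, PiLp.inner_apply, Fin.sum_univ_two, RCLike.inner_apply, conj_trivial]
  push_cast
  have : (Real.pi : ℂ) ≠ 0 := by exact_mod_cast Real.pi_ne_zero
  field_simp
  
theorem integral_torus_comp {E : Type*} [NormedAddCommGroup E] [NormedSpace ℝ E] {h : ℝ}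
    (hh : 0 < h) {g : UnitAddTorus (Fin 2) → E} (hg : AEStronglyMeasurable g volume) :
    ∫ ξ in torus h, g (toUnitTorus h ξ) = ((2 * Real.pi / h) ^ 2) • ∫ t, g t := by
  have hm : AEStronglyMeasurable g (Measure.map (toUnitTorus h) (volume.restrict (torus h))) := by
    rw [map_toUnitTorus hh]
    exact hg.smul_measure _
  rw [← integral_map (measurable_toUnitTorus h).aemeasurable hm, map_toUnitTorus hh,
    integral_smul_measure, ENNReal.toReal_ofReal (by positivity)]

/-- Orthogonality of the exponentials. -/
theorem integral_torus_exp {h : ℝ} (hh : 0 < h) (n : Fin 2 → ℤ) :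
    ∫ ξ in torus h, Complex.exp (Complex.I * (inner ℝ (meshPoint h n) ξ : ℝ))
      = if n = 0 then (((2 * Real.pi / h) ^ 2 : ℝ) : ℂ) else 0 := by
  simp_rw [← mFourier_toUnitTorus]
  rw [integral_torus_comp hh (UnitAddTorus.mFourier n).continuous.aestronglyMeasurable]
  have h1 := orthonormal_iff_ite.1 (UnitAddTorus.orthonormal_mFourier (d := Fin 2)) 0 n
  rw [ContinuousMap.inner_toLp] at h1
  simp only [UnitAddTorus.mFourier_zero, ContinuousMap.one_apply, map_one, mul_one] at h1
  rw [h1]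
  by_cases hn : n = 0
  · simp [hn]
  · simp [hn, Ne.symm hn]

/-- The representative in the torus of side `2π / h` of a point of the unit torus. -/
def ofUnitTorus (h : ℝ) (t : UnitAddTorus (Fin 2)) : Plane :=
  WithLp.toLp 2 fun j => 2 * Real.pi / h * (AddCircle.equivIoc 1 (-(1 / 2) : ℝ) (t j) : ℝ)

theorem measurable_ofUnitTorus (h : ℝ) : Measurable (ofUnitTorus h) := by
  refine (PiLp.volume_preserving_toLp (Fin 2)).measurable.comp
    (measurable_pi_lambda _ fun j => Measurable.const_mul ?_ _)
  exact measurable_subtype_coe.comp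
    ((AddCircle.measurableEquivIoc 1 (-(1 / 2) : ℝ)).measurable.comp (measurable_pi_apply j))

theorem ofUnitTorus_toUnitTorus {h : ℝ} (hh : 0 < h) :
    ∀ᵐ ξ ∂(volume : Measure Plane).restrict (torus h), ofUnitTorus h (toUnitTorus h ξ) = ξ := by
  rw [Measure.restrict_congr_set (torus_ae_eq hh)]
  have hS : Measurable (fun ξ : Plane => fun j => h / (2 * Real.pi) * ξ j) := by fun_prop
  filter_upwards [ae_restrict_mem (hS measurableSet_unitBox)] with ξ hξ
  ext j
  have h1 := AddCircle.equivIoc_coe_of_mem (p := (1 : ℝ)) (hξ j)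
  simp only [ofUnitTorus, toUnitTorus]
  rw [h1]
  have := Real.pi_ne_zero
  field_simp

/-- Completeness of the exponentials on the torus. -/
theorem ae_eq_zero_of_integral_torus_exp {h : ℝ} (hh : 0 < h) {G : Plane → ℂ}
    (hG : MemLp G 2 (volume.restrict (torus h)))
    (h0 : ∀ n, ∫ ξ in torus h, Complex.exp (Complex.I * (inner ℝ (meshPoint h n) ξ : ℝ)) * G ξ = 0) :
    G =ᵐ[volume.restrict (torus h)] 0 := by
  -- A strongly measurable representative is needed, since it is composed with `ofUnitTorus`, whose
  -- behaviour on null sets is not known yet.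
  set G' := hG.1.mk G with hG'
  have hGG' : G =ᵐ[volume.restrict (torus h)] G' := hG.1.ae_eq_mk
  set g : UnitAddTorus (Fin 2) → ℂ := fun t => G' (ofUnitTorus h t) with hg
  have hgm : StronglyMeasurable g :=
    hG.1.stronglyMeasurable_mk.comp_measurable (measurable_ofUnitTorus h)
  have hgq : ∀ᵐ ξ ∂(volume : Measure Plane).restrict (torus h), g (toUnitTorus h ξ) = G ξ := by
    filter_upwards [ofUnitTorus_toUnitTorus hh, hGG'] with ξ h1 h2
    rw [hg, h2]
    simp only [h1]
  have hc : ENNReal.ofReal ((2 * Real.pi / h) ^ 2) ≠ 0 := by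
    simp only [ne_eq, ENNReal.ofReal_eq_zero, not_le]
    positivity
  have hvol : (volume : Measure (UnitAddTorus (Fin 2))) =
      (ENNReal.ofReal ((2 * Real.pi / h) ^ 2))⁻¹ •
        Measure.map (toUnitTorus h) (volume.restrict (torus h)) := by
    rw [map_toUnitTorus hh, smul_smul, ENNReal.inv_mul_cancel hc ENNReal.ofReal_ne_top, one_smul]
  have hgL : MemLp g 2 volume := by
    rw [hvol]
    refine MemLp.smul_measure ?_ (ENNReal.inv_ne_top.2 hc)
    rw [memLp_map_measure_iff hgm.aestronglyMeasurable (measurable_toUnitTorus h).aemeasurable]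
    exact hG.ae_eq (hgq.mono fun _ hx => hx.symm)
  have hcoef : ∀ n, UnitAddTorus.mFourierCoeff g n = 0 := by
    intro n
    have h1 := h0 (-n)
    have h2 := integral_torus_comp hh (g := fun t => UnitAddTorus.mFourier (-n) t • g t)
      ((UnitAddTorus.mFourier (-n)).continuous.aestronglyMeasurable.smul hgm.aestronglyMeasurable)
    have h3 : ∫ ξ in torus h, UnitAddTorus.mFourier (-n) (toUnitTorus h ξ) • g (toUnitTorus h ξ)
        = 0 := by
      rw [← h1]
      refine integral_congr_ae (hgq.mono fun ξ hξ => ?_)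
      simp only [hξ, mFourier_toUnitTorus, smul_eq_mul]
    rw [h3] at h2
    rcases smul_eq_zero.1 h2.symm with h4 | h4
    · exact absurd h4 (by positivity)
    · exact h4
  have hz : hgL.toLp g = 0 := by
    apply UnitAddTorus.mFourierBasis.repr.injective
    ext n
    rw [UnitAddTorus.mFourierBasis_repr, map_zero]
    have : UnitAddTorus.mFourierCoeff (hgL.toLp g) n = UnitAddTorus.mFourierCoeff g n :=
      integral_congr_ae (hgL.coeFn_toLp.mono fun t ht => by simp only [ht])
    rw [this, hcoef]
    rfl
  have hg0 : ∀ᵐ t ∂(volume : Measure (UnitAddTorus (Fin 2))), g t = 0 := by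
    have := (Lp.eq_zero_iff_ae_eq_zero).1 hz
    filter_upwards [this, hgL.coeFn_toLp] with t h1 h2
    rw [← h2, h1]; rfl
  have h5 : ∀ᵐ t ∂Measure.map (toUnitTorus h) (volume.restrict (torus h)), g t = 0 := by
    rw [map_toUnitTorus hh]
    exact Measure.ae_smul_measure hg0 _
  filter_upwards [ae_of_ae_map (measurable_toUnitTorus h).aemeasurable h5, hgq] with ξ h6 h7
  rw [← h7, h6]; rfl

/-! ### Periodic functions against decaying weights -/

/-- The weight `(1 + |ξ|²) ^ (-t)` summed over the torus translates. -/
def latticeSum (t : ℝ) : ℝ≥0∞ :=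
  ∑' k : Fin 2 → ℤ, ENNReal.ofReal ((1 + ‖k‖ ^ 2) ^ (-t))

theorem toUnitTorus_add (h : ℝ) (hh : 0 < h) (k : Fin 2 → ℤ) (ξ : Plane) :
    toUnitTorus h (ξ + meshPoint (2 * Real.pi / h) k) = toUnitTorus h ξ := by
  funext j
  simp only [toUnitTorus, meshPoint, PiLp.add_apply]
  have : h / (2 * Real.pi) * (ξ j + 2 * Real.pi / h * (k j : ℝ))
      = h / (2 * Real.pi) * ξ j + (k j : ℝ) := by
    have := Real.pi_ne_zero
    field_simp
  rw [this]
  simp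

/-- Translation by `2L k` with `L = π / h ≥ 1` moves a coordinate of size at most `L` to one of size
at least `2L|k_j| - L ≥ L|k_j|` when `k_j ≠ 0`. The norm of `k` is the supremum norm. -/
theorem norm_le_of_mem_torus {h : ℝ} (hh : 0 < h) (hh' : h ≤ Real.pi) (k : Fin 2 → ℤ) {ξ : Plane}
    (hξ : ξ ∈ torus h) : ‖k‖ ≤ ‖ξ + meshPoint (2 * Real.pi / h) k‖ := by
  refine (pi_norm_le_iff_of_nonneg (norm_nonneg _)).2 fun j => ?_
  refine le_trans ?_ (PiLp.norm_apply_le _ j)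
  simp only [meshPoint, PiLp.add_apply, Int.norm_eq_abs, Real.norm_eq_abs]
  have h1 := hξ j
  have hL : 1 ≤ Real.pi / h := by rwa [le_div_iff₀ hh, one_mul]
  have h2 : |ξ j| ≤ Real.pi / h := abs_le.2 h1
  have h3 : 2 * Real.pi / h * (k j : ℝ) = 2 * (Real.pi / h) * k j := by ring
  rw [h3]
  set L := Real.pi / h
  rcases eq_or_ne (k j) 0 with hk | hk
  · simp [hk]
  have h4 : (1 : ℝ) ≤ |(k j : ℝ)| := by exact_mod_cast Int.one_le_abs hk
  have h5 : |2 * L * (k j : ℝ)| ≤ |ξ j + 2 * L * k j| + |ξ j| := by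
    calc |2 * L * (k j : ℝ)| = |(ξ j + 2 * L * k j) - ξ j| := by congr 1; ring
      _ ≤ _ := abs_sub _ _
  rw [abs_mul, abs_of_pos (by linarith : 0 < 2 * L)] at h5
  nlinarith

theorem iUnion_torus {h : ℝ} (hh : 0 < h) (ξ : Plane) :
    ∃ k : Fin 2 → ℤ, ξ - meshPoint (2 * Real.pi / h) k ∈ torus h := by
  refine ⟨fun j => round (h / (2 * Real.pi) * ξ j), fun j => ?_⟩
  have h1 := abs_sub_round (h / (2 * Real.pi) * ξ j)
  set r := (round (h / (2 * Real.pi) * ξ j) : ℝ) with hr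
  have hp := Real.pi_pos
  have h2 : (ξ - meshPoint (2 * Real.pi / h) fun j => round (h / (2 * Real.pi) * ξ j)) j
      = 2 * Real.pi / h * (h / (2 * Real.pi) * ξ j - r) := by
    simp only [meshPoint, PiLp.sub_apply]
    rw [mul_sub, ← hr]
    field_simp
  rw [h2, mem_Icc, ← abs_le, abs_mul, abs_of_pos (by positivity : 0 < 2 * Real.pi / h)]
  calc _ ≤ 2 * Real.pi / h * (1 / 2) := by gcongr
    _ = _ := by ring

/-- A periodic function integrated against the weight `(1 + |ξ|²) ^ (-t)`. -/
theorem lintegral_weight_periodic_le {h : ℝ} (hh : 0 < h) (hh' : h ≤ Real.pi) {t : ℝ} (ht : 0 ≤ t)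
    (P : Plane → ℝ≥0∞)
    (hper : ∀ k ξ, P (ξ + meshPoint (2 * Real.pi / h) k) = P ξ) :
    ∫⁻ ξ : Plane, ENNReal.ofReal ((1 + ‖ξ‖ ^ 2) ^ (-t)) * P ξ
      ≤ latticeSum t * ∫⁻ ξ in torus h, P ξ := by
  set τ : (Fin 2 → ℤ) → Plane → Plane := fun k ξ => ξ + meshPoint (2 * Real.pi / h) k with hτ
  set s : (Fin 2 → ℤ) → Set Plane :=
    fun k => (fun ξ => ξ + -meshPoint (2 * Real.pi / h) k) ⁻¹' torus h with hs
  have hcover : (⋃ k, s k) = univ := by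
    refine eq_univ_of_forall fun ξ => ?_
    obtain ⟨k, hk⟩ := iUnion_torus hh ξ
    exact mem_iUnion.2 ⟨k, by simpa [hs, sub_eq_add_neg] using hk⟩
  rw [← setLIntegral_univ, ← hcover]
  -- The translates overlap along their boundaries; only an upper bound is needed, so countable
  -- subadditivity is enough.
  refine (lintegral_iUnion_le s _).trans ?_
  rw [latticeSum, ← ENNReal.tsum_mul_right]
  refine ENNReal.tsum_le_tsum fun k => ?_
  have e1 : ∫⁻ ξ in s k, ENNReal.ofReal ((1 + ‖ξ‖ ^ 2) ^ (-t)) * P ξ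
      = ∫⁻ ξ in torus h, ENNReal.ofReal ((1 + ‖τ k ξ‖ ^ 2) ^ (-t)) * P (τ k ξ) := by
    have hmp := measurePreserving_add_right (volume : Measure Plane)
      (-meshPoint (2 * Real.pi / h) k)
    have := hmp.setLIntegral_comp_preimage_emb
      (MeasurableEquiv.addRight (-meshPoint (2 * Real.pi / h) k)).measurableEmbedding
      (fun ξ => ENNReal.ofReal ((1 + ‖τ k ξ‖ ^ 2) ^ (-t)) * P (τ k ξ)) (torus h)
    rw [← this]
    simp [hτ, hs]
  rw [e1, ← lintegral_const_mul' _ _ ENNReal.ofReal_ne_top]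
  refine setLIntegral_mono' (measurableSet_torus h) fun ξ hξ => ?_
  rw [hτ]
  simp only [hper]
  gcongr ENNReal.ofReal ?_ * _
  have := norm_le_of_mem_torus hh hh' k hξ
  refine Real.rpow_le_rpow_of_nonpos (by positivity) ?_ (by linarith)
  gcongr

/-- In rank two `∑ ‖k‖ ^ (-p)` converges for `p > 2`, here with `p = 2t`; the term `k = 0` is the
finite exception. -/
theorem latticeSum_lt_top {t : ℝ} (ht : 1 < t) : latticeSum t < ∞ := by
  have h1 := EisensteinSeries.summable_one_div_norm_rpow (k := 2 * t) (by linarith)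
  have h2 : Summable fun k : Fin 2 → ℤ => ((1 + ‖k‖ ^ 2) ^ (-t) : ℝ) := by
    refine Summable.of_norm_bounded_eventually h1 ?_
    filter_upwards [(finite_singleton (0 : Fin 2 → ℤ)).compl_mem_cofinite] with k hk
    have hk' : 0 < ‖k‖ := norm_pos_iff.2 hk
    rw [Real.norm_of_nonneg (by positivity), show (-(2 * t)) = 2 * (-t) by ring,
      Real.rpow_mul hk'.le]
    refine Real.rpow_le_rpow_of_nonpos (by positivity) ?_ (by linarith)
    rw [Real.rpow_two]
    linarith
  rw [latticeSum, ← ENNReal.ofReal_tsum_of_nonneg (fun k => by positivity) h2]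
  exact ENNReal.ofReal_lt_top

end
end Kagome

namespace Kagome
noncomputable section
open scoped FourierTransform

/-! ### Fourier synthesis of lattice functions -/

/-- Square integrable functions on the plane. -/
abbrev L2Plane : Type := Lp Cell 2 (volume : Measure Plane)

/-- Square summable functions on the lattice. -/
abbrev L2Lattice : Type := lp (fun _ : Fin 2 → ℤ => Cell) 2

/-- The exponential `(h / 2π) e^{-i h n · ξ}`, restricted to the torus. -/
def expMode (h : ℝ) (n : Fin 2 → ℤ) : Plane → ℂ :=
  (torus h).indicator fun ξ =>
    ((h / (2 * Real.pi) : ℝ) : ℂ) * Complex.exp (-(Complex.I * (inner ℝ (meshPoint h n) ξ : ℝ)))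

theorem norm_exp_I_mul (x : ℝ) : ‖Complex.exp (Complex.I * x)‖ = 1 := by
  rw [Complex.norm_exp]; simp

theorem norm_exp_neg_I_mul (x : ℝ) : ‖Complex.exp (-(Complex.I * x))‖ = 1 := by
  rw [Complex.norm_exp]; simp

theorem memLp_expMode (h : ℝ) (n : Fin 2 → ℤ) (p : ℝ≥0∞) :
    MemLp (expMode h n) p (volume : Measure Plane) := by
  rw [expMode, memLp_indicator_iff_restrict (measurableSet_torus h)]
  refine MemLp.of_bound (by fun_prop) |h / (2 * Real.pi)| (Eventually.of_forall fun ξ => ?_)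
  rw [norm_mul, norm_exp_neg_I_mul, mul_one, Complex.norm_real, Real.norm_eq_abs]

theorem memLp_expMode_smul (h : ℝ) (n : Fin 2 → ℤ) (a : Cell) :
    MemLp (fun ξ => expMode h n ξ • a) 2 (volume : Measure Plane) := by
  have h1 := (ContinuousLinearMap.toSpanSingleton ℂ a).comp_memLp' (memLp_expMode h n 2)
  simpa [Function.comp_def] using h1

/-- `(h / 2π) e^{-i h n · ξ} a` as a square integrable function supported in the torus. -/
def modeLp (h : ℝ) (n : Fin 2 → ℤ) : Cell →ₗ[ℂ] L2Plane where
  toFun a := (memLp_expMode_smul h n a).toLp _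
  map_add' a b := by
    rw [← MemLp.toLp_add]
    congr 1
    ext1 ξ
    simp
  map_smul' c a := by
    rw [RingHom.id_apply, ← MemLp.toLp_const_smul]
    congr 1
    ext1 ξ
    simp [smul_comm c]

theorem coeFn_modeLp (h : ℝ) (n : Fin 2 → ℤ) (a : Cell) :
    modeLp h n a =ᵐ[volume] fun ξ => expMode h n ξ • a :=
  (memLp_expMode_smul h n a).coeFn_toLp

theorem meshPoint_sub (h : ℝ) (n k : Fin 2 → ℤ) :
    meshPoint h (n - k) = meshPoint h n - meshPoint h k := by
  ext j; simp [meshPoint, mul_sub]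

theorem meshPoint_add (h : ℝ) (n k : Fin 2 → ℤ) :
    meshPoint h (n + k) = meshPoint h n + meshPoint h k := by
  ext j; simp [meshPoint, mul_add]

theorem integral_exp_mul_expMode {h : ℝ} (hh : 0 < h) (n k : Fin 2 → ℤ) :
    ∫ ξ, Complex.exp (Complex.I * (inner ℝ (meshPoint h n) ξ : ℝ)) * expMode h k ξ
      = if n = k then ((2 * Real.pi / h : ℝ) : ℂ) else 0 := by
  have e1 : ∀ ξ, Complex.exp (Complex.I * (inner ℝ (meshPoint h n) ξ : ℝ)) * expMode h k ξ
      = (torus h).indicator (fun ξ => ((h / (2 * Real.pi) : ℝ) : ℂ) *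
        Complex.exp (Complex.I * (inner ℝ (meshPoint h (n - k)) ξ : ℝ))) ξ := by
    intro ξ
    by_cases hξ : ξ ∈ torus h
    · rw [expMode, indicator_of_mem hξ, indicator_of_mem hξ, mul_left_comm, ← Complex.exp_add,
        meshPoint_sub, inner_sub_left]
      congr 3
      push_cast
      ring
    · rw [expMode, indicator_of_notMem hξ, indicator_of_notMem hξ, mul_zero]
  simp_rw [e1]
  rw [integral_indicator (measurableSet_torus h), integral_const_mul, integral_torus_exp hh]
  by_cases hnk : n = k
  · rw [if_pos (sub_eq_zero.2 hnk), if_pos hnk, ← Complex.ofReal_mul]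
    congr 1
    have := Real.pi_ne_zero
    field_simp
  · rw [if_neg (sub_ne_zero.2 hnk), if_neg hnk, mul_zero]

theorem conj_expMode (h : ℝ) (n : Fin 2 → ℤ) (ξ : Plane) :
    (starRingEnd ℂ) (expMode h n ξ) = (torus h).indicator (fun ξ =>
      ((h / (2 * Real.pi) : ℝ) : ℂ) *
        Complex.exp (Complex.I * (inner ℝ (meshPoint h n) ξ : ℝ))) ξ := by
  by_cases hξ : ξ ∈ torus h
  · rw [expMode, indicator_of_mem hξ, indicator_of_mem hξ, map_mul, Complex.conj_ofReal,
      ← Complex.exp_conj]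
    simp
  · rw [expMode, indicator_of_notMem hξ, indicator_of_notMem hξ, map_zero]

theorem inner_modeLp {h : ℝ} (hh : 0 < h) (n k : Fin 2 → ℤ) (a b : Cell) :
    inner ℂ (modeLp h n a) (modeLp h k b) = if n = k then inner ℂ a b else 0 := by
  rw [L2.inner_def]
  have e1 : ∀ᵐ ξ ∂(volume : Measure Plane), inner ℂ (modeLp h n a ξ) (modeLp h k b ξ)
      = ((h / (2 * Real.pi) : ℝ) : ℂ) * (Complex.exp (Complex.I * (inner ℝ (meshPoint h n) ξ : ℝ))
        * expMode h k ξ) * inner ℂ a b := by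
    filter_upwards [coeFn_modeLp h n a, coeFn_modeLp h k b] with ξ h1 h2
    rw [h1, h2, inner_smul_left, inner_smul_right, conj_expMode]
    by_cases hξ : ξ ∈ torus h
    · rw [indicator_of_mem hξ]; ring
    · rw [indicator_of_notMem hξ, expMode, indicator_of_notMem hξ]; ring
  rw [integral_congr_ae e1, integral_mul_const, integral_const_mul, integral_exp_mul_expMode hh]
  split_ifs
  · rw [← Complex.ofReal_mul]
    have : h / (2 * Real.pi) * (2 * Real.pi / h) = 1 := by
      have := Real.pi_ne_zero
      field_simp
    rw [this]; simp
  · simp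

/-- The normalized exponentials as isometric embeddings. -/
def modeIsometry {h : ℝ} (hh : 0 < h) (n : Fin 2 → ℤ) : Cell →ₗᵢ[ℂ] L2Plane :=
  (modeLp h n).isometryOfInner fun a b => by rw [inner_modeLp hh, if_pos rfl]

theorem orthogonalFamily_mode {h : ℝ} (hh : 0 < h) :
    OrthogonalFamily ℂ (fun _ : Fin 2 → ℤ => Cell) (modeIsometry hh) := by
  intro n k hnk a b
  exact (inner_modeLp hh n k a b).trans (if_neg hnk)

/-- The Fourier transform of a lattice function, extended by zero outside the torus. -/
def synth {h : ℝ} (hh : 0 < h) : L2Lattice →ₗᵢ[ℂ] L2Plane :=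
  (orthogonalFamily_mode hh).linearIsometry

theorem hasSum_synth {h : ℝ} (hh : 0 < h) (u : L2Lattice) :
    HasSum (fun n => modeLp h n (u n)) (synth hh u) :=
  (orthogonalFamily_mode hh).hasSum_linearIsometry u

/-! ### Pairings and multiplication operators -/

/-- The functional `G ↦ ∫ w G`. -/
def pairing {w : Plane → ℂ} (hw : MemLp w 2 (volume : Measure Plane)) : L2Plane →L[ℂ] Cell :=
  (ContinuousLinearMap.lsmul ℂ ℂ : ℂ →L[ℂ] Cell →L[ℂ] Cell).lpPairing volume 2 2 (hw.toLp w)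

theorem pairing_apply {w : Plane → ℂ} (hw : MemLp w 2 (volume : Measure Plane)) (G : L2Plane) :
    pairing hw G = ∫ ξ, w ξ • G ξ := by
  rw [pairing, ContinuousLinearMap.lpPairing_eq_integral]
  refine integral_congr_ae (hw.coeFn_toLp.mono fun ξ hξ => ?_)
  simp [hξ]

theorem pairing_modeLp {w : Plane → ℂ} (hw : MemLp w 2 (volume : Measure Plane)) (h : ℝ)
    (n : Fin 2 → ℤ) (a : Cell) :
    pairing hw (modeLp h n a) = (∫ ξ, w ξ * expMode h n ξ) • a := by
  rw [pairing_apply, ← integral_smul_const]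
  refine integral_congr_ae ((coeFn_modeLp h n a).mono fun ξ hξ => ?_)
  simp only [hξ, smul_smul]

theorem memLp_clm_apply {K : Plane → Cell →L[ℂ] Cell} (hK : AEStronglyMeasurable K volume) {C : ℝ}
    (hC : ∀ ξ, ‖K ξ‖ ≤ C) {G : Plane → Cell} (hG : MemLp G 2 (volume : Measure Plane)) :
    MemLp (fun ξ => K ξ (G ξ)) 2 volume := by
  refine MemLp.of_le_mul hG (c := C) ?_ (Eventually.of_forall fun ξ => ?_)
  · exact isBoundedBilinearMap_apply.continuous.comp_aestronglyMeasurable (hK.prodMk hG.1)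
  · exact (K ξ).le_of_opNorm_le (hC ξ) _

/-- Multiplication by a bounded operator valued function. -/
def multOp {K : Plane → Cell →L[ℂ] Cell} (hK : AEStronglyMeasurable K volume) {C : ℝ}
    (hC : ∀ ξ, ‖K ξ‖ ≤ C) : L2Plane →L[ℂ] L2Plane :=
  LinearMap.mkContinuous
    { toFun := fun G => (memLp_clm_apply hK hC (Lp.memLp G)).toLp _
      map_add' := fun G G' => by
        rw [← MemLp.toLp_add]
        refine MemLp.toLp_congr _ _ ((Lp.coeFn_add G G').mono fun ξ hξ => ?_)
        simp only [hξ, Pi.add_apply, map_add]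
      map_smul' := fun c G => by
        rw [RingHom.id_apply, ← MemLp.toLp_const_smul]
        refine MemLp.toLp_congr _ _ ((Lp.coeFn_smul c G).mono fun ξ hξ => ?_)
        simp only [hξ, Pi.smul_apply, map_smul] } C fun G => by
    refine Lp.norm_le_mul_norm_of_ae_le_mul ?_
    filter_upwards [(memLp_clm_apply hK hC (Lp.memLp G)).coeFn_toLp] with ξ hξ
    have := (K ξ).le_of_opNorm_le (hC ξ) (G ξ)
    rw [← hξ] at this
    exact this

theorem coeFn_multOp {K : Plane → Cell →L[ℂ] Cell} (hK : AEStronglyMeasurable K volume) {C : ℝ}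
    (hC : ∀ ξ, ‖K ξ‖ ≤ C) (G : L2Plane) :
    multOp hK hC G =ᵐ[volume] fun ξ => K ξ (G ξ) :=
  (memLp_clm_apply hK hC (Lp.memLp G)).coeFn_toLp

/-- Restriction to the complement of the torus is continuous on `L²` and kills every term of the
series. -/
theorem coeFn_synth_support {h : ℝ} (hh : 0 < h) (u : L2Lattice) :
    ∀ᵐ ξ ∂(volume : Measure Plane), ξ ∉ torus h → synth hh u ξ = 0 := by
  have hs := (hasSum_synth hh u).mapL (LpToLpRestrictCLM Plane Cell ℂ volume 2 (torus h)ᶜ)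
  have h0 : ∀ n, LpToLpRestrictCLM Plane Cell ℂ volume 2 (torus h)ᶜ (modeLp h n (u n)) = 0 := by
    intro n
    rw [Lp.eq_zero_iff_ae_eq_zero]
    filter_upwards [LpToLpRestrictCLM_coeFn ℂ (torus h)ᶜ (modeLp h n (u n)),
      ae_restrict_of_ae (coeFn_modeLp h n (u n)),
      ae_restrict_mem (measurableSet_torus h).compl] with ξ h1 h2 h3
    rw [h1, h2, expMode, indicator_of_notMem h3, zero_smul]; rfl
  simp_rw [h0] at hs
  have h1 := hs.unique hasSum_zero
  rw [Lp.eq_zero_iff_ae_eq_zero] at h1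
  have h2 : ∀ᵐ ξ ∂(volume : Measure Plane).restrict (torus h)ᶜ, synth hh u ξ = 0 := by
    filter_upwards [h1, LpToLpRestrictCLM_coeFn ℂ (torus h)ᶜ (synth hh u)] with ξ h3 h4
    rw [← h4, h3]; rfl
  exact (ae_restrict_iff' (measurableSet_torus h).compl).1 h2

/-- The Fourier transform of a lattice function in the normalization of Mathlib, scaled so that it
approximates the Fourier transform of the sampled function. -/
def spec (h : ℝ) (u : (Fin 2 → ℤ) → Cell) : L2Plane :=
  (h : ℂ) • ∑' n, modeLp (2 * Real.pi * h) n (u n)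

theorem two_pi_mul_pos {h : ℝ} (hh : 0 < h) : 0 < 2 * Real.pi * h := by positivity

theorem spec_eq {h : ℝ} (hh : 0 < h) (u : L2Lattice) :
    spec h u = (h : ℂ) • synth (two_pi_mul_pos hh) u := by
  rw [spec, (hasSum_synth (two_pi_mul_pos hh) u).tsum_eq]

theorem hasSum_spec {h : ℝ} (hh : 0 < h) {u : (Fin 2 → ℤ) → Cell} (hu : Memℓp u 2) :
    HasSum (fun n => (h : ℂ) • modeLp (2 * Real.pi * h) n (u n)) (spec h u) := by
  have := (hasSum_synth (two_pi_mul_pos hh) ⟨u, hu⟩).const_smul (h : ℂ)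
  rw [← spec_eq hh] at this
  exact this

theorem norm_spec {h : ℝ} (hh : 0 < h) {u : (Fin 2 → ℤ) → Cell} (hu : Memℓp u 2) :
    ‖spec h u‖ = h * ‖(⟨u, hu⟩ : L2Lattice)‖ := by
  have := spec_eq hh ⟨u, hu⟩
  rw [this, norm_smul, LinearIsometry.norm_map, Complex.norm_real, Real.norm_of_nonneg hh.le]

theorem spec_sub {h : ℝ} (hh : 0 < h) {u w : (Fin 2 → ℤ) → Cell} (hu : Memℓp u 2)
    (hw : Memℓp w 2) : spec h (u - w) = spec h u - spec h w := by
  have := spec_eq hh (⟨u, hu⟩ - ⟨w, hw⟩)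
  rw [map_sub, smul_sub, ← spec_eq hh, ← spec_eq hh] at this
  exact this

theorem spec_add {h : ℝ} (hh : 0 < h) {u w : (Fin 2 → ℤ) → Cell} (hu : Memℓp u 2)
    (hw : Memℓp w 2) : spec h (u + w) = spec h u + spec h w := by
  have := spec_eq hh (⟨u, hu⟩ + ⟨w, hw⟩)
  rw [map_add, smul_add, ← spec_eq hh, ← spec_eq hh] at this
  exact this

theorem norm_spec_le_of_le {h : ℝ} (hh : 0 < h) {u w : (Fin 2 → ℤ) → Cell} (hu : Memℓp u 2)
    (hw : Memℓp w 2) {c : ℝ} (hc : 0 ≤ c) (huw : ∀ n, ‖u n‖ ≤ c * ‖w n‖) :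
    ‖spec h u‖ ≤ c * ‖spec h w‖ := by
  rw [norm_spec hh hu, norm_spec hh hw, mul_left_comm]
  gcongr
  have h1 := lp.norm_rpow_eq_tsum (p := 2) (by norm_num) (⟨u, hu⟩ : L2Lattice)
  have h2 := lp.norm_rpow_eq_tsum (p := 2) (by norm_num) (⟨w, hw⟩ : L2Lattice)
  have s1 := (memℓp_gen_iff (p := 2) (by norm_num)).1 hu
  have s2 := (memℓp_gen_iff (p := 2) (by norm_num)).1 hw
  simp only [ENNReal.toReal_ofNat, Real.rpow_two] at h1 h2 s1 s2
  refine abs_le_of_sq_le_sq' ?_ (by positivity) |>.2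
  rw [h1, mul_pow, h2, ← tsum_mul_left]
  refine s1.tsum_le_tsum (fun n => ?_) (s2.mul_left _)
  rw [← mul_pow]
  gcongr
  exact huw n

theorem memℓp_of_le {u w : (Fin 2 → ℤ) → Cell} (hw : Memℓp w 2) {c : ℝ}
    (huw : ∀ n, ‖u n‖ ≤ c * ‖w n‖) : Memℓp u 2 := by
  have s2 := (memℓp_gen_iff (p := 2) (by norm_num)).1 hw
  refine (memℓp_gen_iff (p := 2) (by norm_num)).2 ?_
  simp only [ENNReal.toReal_ofNat, Real.rpow_two] at s2 ⊢
  refine Summable.of_nonneg_of_le (fun n => by positivity) (fun n => ?_) (s2.mul_left (c ^ 2))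
  rw [← mul_pow]
  gcongr
  exact huw n

theorem coeFn_spec_support {h : ℝ} (hh : 0 < h) {u : (Fin 2 → ℤ) → Cell} (hu : Memℓp u 2) :
    ∀ᵐ ξ ∂(volume : Measure Plane), ξ ∉ torus (2 * Real.pi * h) → spec h u ξ = 0 := by
  have h1 := spec_eq hh ⟨u, hu⟩
  rw [h1]
  filter_upwards [coeFn_synth_support (two_pi_mul_pos hh) ⟨u, hu⟩,
    Lp.coeFn_smul (h : ℂ) (synth (two_pi_mul_pos hh) ⟨u, hu⟩)] with ξ h2 h3 h4
  rw [h3, Pi.smul_apply, h2 h4, smul_zero]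

/-! ### The interpolation as an inverse Fourier transform -/

/-- The exponential `e^{i x · ξ}` restricted to the torus. -/
def torusExp (h : ℝ) (x : Plane) : Plane → ℂ :=
  (torus h).indicator fun ξ => Complex.exp (Complex.I * (inner ℝ x ξ : ℝ))

theorem memLp_torusExp (h : ℝ) (x : Plane) (p : ℝ≥0∞) :
    MemLp (torusExp h x) p (volume : Measure Plane) := by
  rw [torusExp, memLp_indicator_iff_restrict (measurableSet_torus h)]
  refine MemLp.of_bound (by fun_prop) 1 (Eventually.of_forall fun ξ => ?_)
  rw [norm_exp_I_mul]

/-- The series defining `discreteFourier` lives in `L²` of the torus. Its summability is inherited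
from the orthogonal series on the plane through the continuous restriction map, so the `tsum` is a
genuine sum. -/
theorem discreteFourier_eq {h : ℝ} (hh : 0 < h) (u : L2Lattice) :
    discreteFourier h u = LpToLpRestrictCLM Plane Cell ℂ volume 2 (torus h) (synth hh u) := by
  have hs := (hasSum_synth hh u).mapL (LpToLpRestrictCLM Plane Cell ℂ volume 2 (torus h))
  set c : ℂ := ((h / (2 * Real.pi) : ℝ) : ℂ) with hc
  have hc0 : c ≠ 0 := by
    rw [hc, Complex.ofReal_ne_zero]; positivity
  have h0 : ∀ n, LpToLpRestrictCLM Plane Cell ℂ volume 2 (torus h) (modeLp h n (u n))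
      = c • (memLp_mode h n (u n)).toLp (mode h n (u n)) := by
    intro n
    apply Lp.ext
    filter_upwards [LpToLpRestrictCLM_coeFn ℂ (torus h) (modeLp h n (u n)),
      ae_restrict_of_ae (coeFn_modeLp h n (u n)), ae_restrict_mem (measurableSet_torus h),
      Lp.coeFn_smul c ((memLp_mode h n (u n)).toLp (mode h n (u n))),
      (memLp_mode h n (u n)).coeFn_toLp] with ξ h1 h2 h3 h4 h5
    rw [h1, h2, h4, Pi.smul_apply, h5, expMode, indicator_of_mem h3, mode, smul_smul]
  simp_rw [h0] at hs
  have h1 := hs.const_smul c⁻¹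
  simp_rw [inv_smul_smul₀ hc0] at h1
  rw [discreteFourier, h1.tsum_eq, ← hc, smul_inv_smul₀ hc0]

theorem interpolation_eq_pairing {h : ℝ} (hh : 0 < h) (u : L2Lattice) (x : Plane) :
    interpolation h u x
      = ((h / (2 * Real.pi) : ℝ) : ℂ) • pairing (memLp_torusExp h x 2) (synth hh u) := by
  rw [interpolation, pairing_apply, discreteFourier_eq hh]
  congr 1
  rw [← integral_indicator (measurableSet_torus h)]
  have h1 := (ae_restrict_iff' (measurableSet_torus h)).1
    (LpToLpRestrictCLM_coeFn ℂ (torus h) (synth hh u))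
  refine integral_congr_ae (h1.mono fun ξ hξ => ?_)
  by_cases hm : ξ ∈ torus h
  · simp only [torusExp, indicator_of_mem hm, hξ hm]
  · simp only [torusExp, indicator_of_notMem hm, zero_smul]

theorem fourierInv_spec_eq_pairing {h : ℝ} (hh : 0 < h) {u : (Fin 2 → ℤ) → Cell} (hu : Memℓp u 2)
    (x : Plane) :
    𝓕⁻ (spec h u : Plane → Cell) x
      = pairing (memLp_torusExp (2 * Real.pi * h) ((2 * Real.pi) • x) 2) (spec h u) := by
  rw [pairing_apply, Real.fourierInv_eq']
  refine integral_congr_ae ((coeFn_spec_support hh hu).mono fun ξ hξ => ?_)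
  by_cases hm : ξ ∈ torus (2 * Real.pi * h)
  · simp only [torusExp, indicator_of_mem hm]
    rw [inner_smul_left, real_inner_comm, mul_comm Complex.I]
    simp
  · simp only [hξ hm, smul_zero]

theorem smul_mem_torus_iff {h : ℝ} (hh : 0 < h) (ξ : Plane) :
    (2 * Real.pi) • ξ ∈ torus h ↔ ξ ∈ torus (2 * Real.pi * h) := by
  have hp := Real.pi_pos
  refine forall_congr' fun j => ?_
  have e1 : Real.pi / h = (2 * Real.pi) * (Real.pi / (2 * Real.pi * h)) := by field_simp
  rw [PiLp.smul_apply, smul_eq_mul, mem_Icc, mem_Icc, e1, ← mul_neg,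
    mul_le_mul_iff_right₀ (by positivity), mul_le_mul_iff_right₀ (by positivity)]

/-- The interpolation is the inverse Fourier transform of the scaled discrete transform. -/
theorem interpolation_eq_fourierInv {h : ℝ} (hh : 0 < h) {u : (Fin 2 → ℤ) → Cell}
    (hu : Memℓp u 2) (x : Plane) :
    interpolation h u x = 𝓕⁻ (spec h u : Plane → Cell) x := by
  rw [fourierInv_spec_eq_pairing hh hu]
  have h1 := interpolation_eq_pairing hh ⟨u, hu⟩ x
  refine h1.trans ?_
  -- Both sides are continuous functionals of convergent series, so it suffices to compare them on
  -- one mode. There they differ by the dilation `ξ ↦ 2π ξ`, which passes from angular frequencies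
  -- to the convention `e^{2π i x · ζ}`.
  have s1 := ((hasSum_synth hh ⟨u, hu⟩).mapL (pairing (memLp_torusExp h x 2))).const_smul
    ((h / (2 * Real.pi) : ℝ) : ℂ)
  have s2 := (hasSum_spec hh hu).mapL
    (pairing (memLp_torusExp (2 * Real.pi * h) ((2 * Real.pi) • x) 2))
  refine s1.unique (s2.congr_fun fun n => ?_)
  simp only [map_smul, pairing_modeLp, smul_smul]
  congr 1
  have e1 : ∀ ξ : Plane, torusExp (2 * Real.pi * h) ((2 * Real.pi) • x) ξ
      * expMode (2 * Real.pi * h) n ξ = (fun ξ' => ((2 * Real.pi : ℝ) : ℂ) *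
        (torusExp h x ξ' * expMode h n ξ')) ((2 * Real.pi) • ξ) := by
    intro ξ
    have hm := smul_mem_torus_iff hh ξ
    by_cases hξ : ξ ∈ torus (2 * Real.pi * h)
    · simp only [torusExp, expMode, indicator_of_mem hξ, indicator_of_mem (hm.2 hξ)]
      rw [mul_left_comm, mul_left_comm (Complex.exp _), ← mul_assoc (_ : ℂ) (_ : ℂ) (_ * _),
        ← Complex.ofReal_mul, inner_smul_left, inner_smul_right, inner_smul_right]
      congr 1
      · congr 1
        have := Real.pi_ne_zero
        field_simp
      · congr 4
        simp only [meshPoint, PiLp.inner_apply, Fin.sum_univ_two, RCLike.inner_apply, conj_trivial]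
        push_cast
        ring
    · have hξ' : (2 * Real.pi) • ξ ∉ torus h := fun hc => hξ (hm.1 hc)
      simp only [torusExp, expMode, indicator_of_notMem hξ, indicator_of_notMem hξ', mul_zero]
  simp_rw [e1]
  rw [Measure.integral_comp_smul volume (fun ξ' => ((2 * Real.pi : ℝ) : ℂ) *
        (torusExp h x ξ' * expMode h n ξ')) (2 * Real.pi), integral_const_mul]
  have hp := Real.pi_pos
  rw [show Module.finrank ℝ Plane = 2 by simp, abs_of_pos (by positivity), Complex.real_smul]
  rw [← mul_assoc, ← mul_assoc, ← Complex.ofReal_mul, ← Complex.ofReal_mul]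
  congr 2
  field_simp

end
end Kagome

namespace Kagome
noncomputable section
open scoped FourierTransform

/-! ### Weights -/

theorem weight_pos (t : ℝ) (x : Plane) : 0 < weight t x := by
  unfold weight; positivity

theorem weight_add (s t : ℝ) (x : Plane) : weight (s + t) x = weight s x * weight t x := by
  unfold weight
  rw [← Real.rpow_add (by positivity)]
  congr 1; ring

theorem weight_zero (x : Plane) : weight 0 x = 1 := by simp [weight]

theorem weight_two (x : Plane) : weight 2 x = 1 + ‖x‖ ^ 2 := by simp [weight]

theorem weight_neg_mul (t : ℝ) (x : Plane) : weight (-t) x * weight t x = 1 := by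
  rw [← weight_add, neg_add_cancel, weight_zero]

theorem continuous_weight (t : ℝ) : Continuous (weight t) := by
  unfold weight
  exact Continuous.rpow_const (by fun_prop) fun x => Or.inl (by positivity)

theorem one_le_weight {t : ℝ} (ht : 0 ≤ t) (x : Plane) : 1 ≤ weight t x :=
  Real.one_le_rpow (by nlinarith [sq_nonneg ‖x‖]) (by linarith)

theorem weight_le_one {t : ℝ} (ht : t ≤ 0) (x : Plane) : weight t x ≤ 1 :=
  Real.rpow_le_one_of_one_le_of_nonpos (by nlinarith [sq_nonneg ‖x‖]) (by linarith)

/-- The threshold `1` is half the dimension of the plane. -/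
theorem memLp_weight_neg {t : ℝ} (ht : 1 < t) :
    MemLp (weight (-t)) 2 (volume : Measure Plane) := by
  rw [memLp_two_iff_integrable_sq (continuous_weight _).aestronglyMeasurable]
  have := integrable_rpow_neg_one_add_norm_sq (E := Plane) (μ := volume) (r := 2 * t)
    (by simp; linarith)
  refine this.congr (Eventually.of_forall fun x => ?_)
  simp only [weight]
  rw [← Real.rpow_mul_natCast (by positivity)]
  congr 1
  push_cast; ring

/-- Functions whose inverse Fourier transform is in the Sobolev space of order `t`. -/
def InX (t : ℝ) (G : Plane → Cell) : Prop :=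
  MemLp (fun ζ => (weight t ζ : ℂ) • G ζ) 2 (volume : Measure Plane)

theorem weight_smul_cancel (t : ℝ) (G : Plane → Cell) (ζ : Plane) :
    (weight (-t) ζ : ℂ) • (weight t ζ : ℂ) • G ζ = G ζ := by
  rw [smul_smul, ← Complex.ofReal_mul, weight_neg_mul, Complex.ofReal_one, one_smul]

theorem InX.memLp {t : ℝ} (ht : 0 ≤ t) {G : Plane → Cell} (hG : InX t G) :
    MemLp G 2 (volume : Measure Plane) := by
  have h1 : AEStronglyMeasurable G volume := by
    have := (Complex.continuous_ofReal.comp (continuous_weight (-t))).aestronglyMeasurable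
      (μ := (volume : Measure Plane)) |>.smul hG.1
    exact this.congr (Eventually.of_forall fun ζ => weight_smul_cancel t G ζ)
  refine hG.of_le h1 (Eventually.of_forall fun ζ => ?_)
  rw [norm_smul, Complex.norm_real, Real.norm_of_nonneg (weight_pos t ζ).le]
  exact le_mul_of_one_le_left (norm_nonneg _) (one_le_weight ht ζ)

/-- The Sobolev embedding into continuous functions, seen on the Fourier side: Cauchy–Schwarz
against `⟨ζ⟩ ^ (-t)`. -/
theorem InX.integrable {t : ℝ} (ht : 1 < t) {G : Plane → Cell} (hG : InX t G) :
    Integrable G (volume : Measure Plane) := by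
  have h1 : MemLp (fun x => (weight (-t) x : ℂ)) 2 (volume : Measure Plane) :=
    (memLp_weight_neg ht).ofReal
  have := memLp_one_iff_integrable.1 (MemLp.smul (r := 1) hG h1)
  exact this.congr (Eventually.of_forall fun ζ => weight_smul_cancel t G ζ)

theorem InX.sub {t : ℝ} {G G' : Plane → Cell} (hG : InX t G) (hG' : InX t G') :
    InX t (fun ζ => G ζ - G' ζ) := by
  have := MemLp.sub hG hG'
  unfold InX
  convert! this using 2
  simp [smul_sub]

/-! ### Fourier inversion on `L¹ ∩ L²` -/

/-- The inverse transform is the Fourier integral of the bilinear form `-⟨x, ζ⟩`. This form equals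
its own flip, so Fubini moves the transform from one factor to the other. -/
theorem integral_fourierInv_smul {F : Type*} [NormedAddCommGroup F] [InnerProductSpace ℂ F]
    [CompleteSpace F] {φ : Plane → ℂ} (hφ : Integrable φ) {G : Plane → F}
    (hG : Integrable G) : ∫ ζ, 𝓕⁻ φ ζ • G ζ = ∫ x, φ x • 𝓕⁻ G x := by
  have := VectorFourier.integral_fourierIntegral_smul_eq_flip (e := Real.fourierChar)
    (μ := (volume : Measure Plane)) (ν := (volume : Measure Plane)) (L := -innerₗ Plane)
    (f := φ) (g := G) Real.continuous_fourierChar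
    (by simp only [LinearMap.neg_apply, innerₗ_apply_apply]; fun_prop) hφ hG
  have e : (-innerₗ Plane).flip = -innerₗ Plane := by
    ext x y
    simp [real_inner_comm]
  rw [e] at this
  exact this

theorem integral_smul_fourierInv_L2 {F : Type*} [NormedAddCommGroup F] [InnerProductSpace ℂ F]
    [CompleteSpace F] (φ : 𝓢(Plane, ℂ))
    (G : Lp F 2 (volume : Measure Plane)) :
    ∫ x, φ x • (𝓕⁻ G : Lp F 2 (volume : Measure Plane)) x = ∫ ζ, (𝓕⁻ φ : 𝓢(Plane, ℂ)) ζ • G ζ := by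
  have h1 := Lp.fourierInv_toTemperedDistribution_eq G
  have h2 := congrArg (fun T : 𝓢'(Plane, F) => T φ) h1
  simp only [TemperedDistribution.fourierInv_apply, Lp.toTemperedDistribution_apply] at h2
  exact h2.symm

theorem continuous_fourierInv {F : Type*} [NormedAddCommGroup F] [NormedSpace ℂ F] {G : Plane → F} (hG : Integrable G) : Continuous (𝓕⁻ G) :=
  VectorFourier.fourierIntegral_continuous Real.continuous_fourierChar
    (by simp only [LinearMap.neg_apply, innerₗ_apply_apply]; fun_prop) hG

/-- The abstract transform on `L²` and the Fourier integral have the same pairing with every test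
function. This is what lets point values, and hence samples, be read off from elements of `L²`. -/
theorem fourierInv_L2_ae_eq {F : Type*} [NormedAddCommGroup F] [InnerProductSpace ℂ F]
    [CompleteSpace F] 
    (G : Lp F 2 (volume : Measure Plane)) (hG : Integrable G (volume : Measure Plane)) :
    (𝓕⁻ G : Lp F 2 (volume : Measure Plane)) =ᵐ[volume] 𝓕⁻ (G : Plane → F) := by
  refine ae_eq_of_integral_contDiff_smul_eq ?_ (continuous_fourierInv hG).locallyIntegrable ?_
  · exact (Lp.memLp _).locallyIntegrable (by norm_num)
  · intro g hg hgc
    have hg' : ContDiff ℝ (⊤ : ℕ∞) (fun x => (g x : ℂ)) := Complex.ofRealCLM.contDiff.comp hg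
    have hgc' : HasCompactSupport (fun x => (g x : ℂ)) := hgc.comp_left Complex.ofReal_zero
    set φ : 𝓢(Plane, ℂ) := hgc'.toSchwartzMap hg' with hφ
    have e1 : ∀ x, φ x = (g x : ℂ) := fun x => rfl
    have h1 := integral_smul_fourierInv_L2 φ G
    have h2 := integral_fourierInv_smul φ.integrable hG
    rw [← SchwartzMap.fourierInv_coe, ← h1] at h2
    simpa only [e1, Complex.coe_smul] using h2

theorem fourier_toLp_fourierInv {G : Plane → Cell} (hG : Integrable G) (hG2 : MemLp G 2 volume) :
    ∃ hg : MemLp (𝓕⁻ G) 2 (volume : Measure Plane), (𝓕 (hg.toLp _) : L2Plane) = hG2.toLp G := by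
  have hi : Integrable (hG2.toLp G) (volume : Measure Plane) := hG.congr hG2.coeFn_toLp.symm
  have h1 := fourierInv_L2_ae_eq (hG2.toLp G) hi
  have h2 : 𝓕⁻ (hG2.toLp G : Plane → Cell) = 𝓕⁻ G := by
    funext x
    rw [Real.fourierInv_eq, Real.fourierInv_eq]
    exact integral_congr_ae (hG2.coeFn_toLp.mono fun ζ hζ => by simp only [hζ])
  rw [h2] at h1
  have hg : MemLp (𝓕⁻ G) 2 (volume : Measure Plane) := (Lp.memLp _).ae_eq h1
  refine ⟨hg, ?_⟩
  have h3 : hg.toLp _ = (𝓕⁻ (hG2.toLp G) : L2Plane) :=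
    Lp.ext (hg.coeFn_toLp.trans h1.symm)
  rw [h3]
  exact FourierTransform.fourier_fourierInv_eq _

end
end Kagome

namespace Kagome
noncomputable section
open scoped FourierTransform

/-! ### Sampling -/

/-- The values of `g` on the lattice of mesh `h`. -/
def sample (h : ℝ) (g : Plane → Cell) (n : Fin 2 → ℤ) : Cell := g (meshPoint h n)

/-- The norm of `G` in the weighted space `⟨ζ⟩ ^ (-t) L²`. -/
def normX (t : ℝ) (G : Plane → Cell) : ℝ := (weightedNorm t G).toReal

/-- The norm of the sampling operator. -/
def sampleConst (t : ℝ) : ℝ := Real.sqrt (latticeSum t).toReal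

/-- Parseval for trigonometric polynomials. The orthonormal family is `h` times the exponentials,
which accounts for the factor `h⁻²`. -/
theorem integral_torus_norm_sq {h : ℝ} (hh : 0 < h) (s : Finset (Fin 2 → ℤ))
    (a : (Fin 2 → ℤ) → Cell) :
    ∫⁻ ζ in torus (2 * Real.pi * h), ‖∑ n ∈ s, Complex.exp (-(Complex.I *
      (inner ℝ (meshPoint (2 * Real.pi * h) n) ζ : ℝ))) • a n‖ₑ ^ 2
      = ENNReal.ofReal ((h ^ 2)⁻¹ * ∑ n ∈ s, ‖a n‖ ^ 2) := by
  have hk := two_pi_mul_pos hh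
  set F : Plane → Cell := fun ζ => ∑ n ∈ s, Complex.exp (-(Complex.I *
      (inner ℝ (meshPoint (2 * Real.pi * h) n) ζ : ℝ))) • a n with hF
  set S : L2Plane := ∑ n ∈ s, modeLp (2 * Real.pi * h) n (a n) with hS
  have e0 : 2 * Real.pi * h / (2 * Real.pi) = h := by
    have := Real.pi_ne_zero
    field_simp
  have e1 : ‖S‖ ^ 2 = ∑ n ∈ s, ‖a n‖ ^ 2 := by
    have := (orthogonalFamily_mode hk).norm_sum a s
    exact this
  have e2 : S =ᵐ[volume] (torus (2 * Real.pi * h)).indicator fun ζ => (h : ℂ) • F ζ := by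
    have h1 : S =ᵐ[volume] fun ζ => ∑ n ∈ s, modeLp (2 * Real.pi * h) n (a n) ζ := by
      exact (Lp.coeFn_finsetSum s _).trans (Eventually.of_forall fun ζ => by simp)
    have h2 : ∀ᵐ ζ ∂(volume : Measure Plane), ∀ n, modeLp (2 * Real.pi * h) n (a n) ζ
        = expMode (2 * Real.pi * h) n ζ • a n := ae_all_iff.2 fun n => coeFn_modeLp _ n (a n)
    filter_upwards [h1, h2] with ζ h3 h4
    rw [h3]
    simp only [h4]
    by_cases hζ : ζ ∈ torus (2 * Real.pi * h)
    · simp only [indicator_of_mem hζ, expMode, hF, Finset.smul_sum, smul_smul, e0]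
    · simp only [indicator_of_notMem hζ, expMode, zero_smul, Finset.sum_const_zero]
  have e3 : ENNReal.ofReal (‖S‖ ^ 2) = ENNReal.ofReal (h ^ 2) *
      ∫⁻ ζ in torus (2 * Real.pi * h), ‖F ζ‖ₑ ^ 2 := by
    have h1 : ENNReal.ofReal (‖S‖ ^ 2) = eLpNorm S 2 volume ^ 2 := by
      rw [Lp.norm_def, ← ENNReal.toReal_pow, ENNReal.ofReal_toReal]
      exact ENNReal.pow_ne_top (Lp.memLp S).2.ne
    rw [h1, eLpNorm_congr_ae e2, eLpNorm_indicator_eq_eLpNorm_restrict (measurableSet_torus _),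
      ← lintegral_const_mul' _ _ ENNReal.ofReal_ne_top]
    rw [eLpNorm_eq_lintegral_rpow_enorm_toReal (by norm_num) (by norm_num)]
    simp only [ENNReal.toReal_ofNat, ← ENNReal.rpow_two]
    rw [← ENNReal.rpow_mul]
    norm_num
    refine lintegral_congr fun ζ => ?_
    rw [enorm_smul, mul_pow, ENNReal.ofReal_pow hh.le]
    congr 2
    rw [← ofReal_norm, Real.norm_of_nonneg hh.le]
  rw [← e1, ENNReal.ofReal_mul (by positivity), e3, ← mul_assoc, ← ENNReal.ofReal_mul (by positivity),
    inv_mul_cancel₀ (by positivity), ENNReal.ofReal_one, one_mul]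

theorem fourierInv_meshPoint (h : ℝ) (G : Plane → Cell) (n : Fin 2 → ℤ) :
    𝓕⁻ G (meshPoint h n)
      = ∫ ζ, Complex.exp (Complex.I * (inner ℝ (meshPoint (2 * Real.pi * h) n) ζ : ℝ)) • G ζ := by
  rw [Real.fourierInv_eq']
  congr 1
  ext1 ζ
  congr 2
  rw [mul_comm]
  congr 2
  simp only [meshPoint, PiLp.inner_apply, Fin.sum_univ_two, RCLike.inner_apply, conj_trivial]
  ring

/-- A duality argument. With `F` the trigonometric polynomial whose coefficients are the samples,
the sum `S` of their squared norms equals `∫ ⟨F, G⟩`. Cauchy–Schwarz with weights `⟨ζ⟩ ^ (∓t)`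
bounds `S²` by `∫ ⟨ζ⟩ ^ (-2t) |F|²` times the squared norm of `G`. As `F` is periodic, the former is
at most `latticeSum t` times its integral over one torus, which Parseval identifies as `h⁻² S`. One
factor `S` cancels. -/
theorem sum_sample_le {t : ℝ} (ht : 1 < t) {G : Plane → Cell} (hG : InX t G) {h : ℝ} (hh : 0 < h)
    (hh' : h ≤ 1 / 2) (s : Finset (Fin 2 → ℤ)) :
    h ^ 2 * ∑ n ∈ s, ‖sample h (𝓕⁻ G) n‖ ^ 2 ≤ (sampleConst t * normX t G) ^ 2 := by
  have hk := two_pi_mul_pos hh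
  -- The bound `h ≤ 1 / 2` is exactly the condition under which lattice translates of the frequency
  -- box are at least `‖k‖` away from the origin.
  have hk' : 2 * Real.pi * h ≤ Real.pi := by nlinarith [Real.pi_pos]
  set a := sample h (𝓕⁻ G) with ha
  set F : Plane → Cell := fun ζ => ∑ n ∈ s, Complex.exp (-(Complex.I *
      (inner ℝ (meshPoint (2 * Real.pi * h) n) ζ : ℝ))) • a n with hF
  set S := ∑ n ∈ s, ‖a n‖ ^ 2 with hS
  have hS0 : 0 ≤ S := by positivity
  have hFc : Continuous F := by
    rw [hF]
    fun_prop
  have hGi := hG.integrable ht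
  have hterm : ∀ n, Integrable (fun ζ => Complex.exp (Complex.I *
      (inner ℝ (meshPoint (2 * Real.pi * h) n) ζ : ℝ)) • G ζ) := by
    intro n
    refine hGi.mono ((by fun_prop : Continuous fun ζ : Plane => Complex.exp (Complex.I *
      (inner ℝ (meshPoint (2 * Real.pi * h) n) ζ : ℝ))).aestronglyMeasurable.smul hGi.1)
      (Eventually.of_forall fun ζ => ?_)
    rw [norm_smul, norm_exp_I_mul, one_mul]
  have e1 : (S : ℂ) = ∫ ζ, inner ℂ (F ζ) (G ζ) := by
    have h1 : ∀ n, ((‖a n‖ ^ 2 : ℝ) : ℂ) = ∫ ζ, inner ℂ (a n) (Complex.exp (Complex.I *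
        (inner ℝ (meshPoint (2 * Real.pi * h) n) ζ : ℝ)) • G ζ) := by
      intro n
      have h2 := (innerSL ℂ (a n)).integral_comp_comm (hterm n)
      simp only [innerSL_apply_apply] at h2
      rw [h2, ← fourierInv_meshPoint]
      have h3 := inner_self_eq_norm_sq_to_K (𝕜 := ℂ) (a n)
      rw [Complex.ofReal_pow]
      exact h3.symm
    rw [hS, Complex.ofReal_sum]
    simp_rw [h1]
    rw [← integral_finsetSum]
    · refine integral_congr_ae (Eventually.of_forall fun ζ => ?_)
      simp only [hF, sum_inner, inner_smul_left, inner_smul_right]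
      refine Finset.sum_congr rfl fun n _ => ?_
      congr 1
      rw [← Complex.exp_conj]
      simp
    · intro n _
      exact (innerSL ℂ (a n)).integrable_comp (hterm n)
  have e2 : ENNReal.ofReal S ≤ ∫⁻ ζ, ‖(weight (-t) ζ : ℂ) • F ζ‖ₑ * ‖(weight t ζ : ℂ) • G ζ‖ₑ := by
    have h1 : ENNReal.ofReal S = ‖(S : ℂ)‖ₑ := by
      rw [← ofReal_norm, Complex.norm_real, Real.norm_of_nonneg hS0]
    rw [h1, e1]
    refine (enorm_integral_le_lintegral_enorm _).trans (lintegral_mono fun ζ => ?_)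
    have h2 : ‖inner ℂ (F ζ) (G ζ)‖ₑ ≤ ‖F ζ‖ₑ * ‖G ζ‖ₑ := by
      rw [← ofReal_norm, ← ofReal_norm, ← ofReal_norm,
        ← ENNReal.ofReal_mul (norm_nonneg _)]
      exact ENNReal.ofReal_le_ofReal (norm_inner_le_norm _ _)
    refine h2.trans (le_of_eq ?_)
    rw [enorm_smul, enorm_smul, mul_mul_mul_comm, ← enorm_mul (weight (-t) ζ : ℂ), ← Complex.ofReal_mul,
      weight_neg_mul]
    simp
  have e3 : ∫⁻ ζ, ‖(weight (-t) ζ : ℂ) • F ζ‖ₑ ^ 2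
      ≤ latticeSum t * ENNReal.ofReal ((h ^ 2)⁻¹ * S) := by
    rw [hS, ← integral_torus_norm_sq hh s a]
    refine le_trans (le_of_eq ?_) (lintegral_weight_periodic_le hk hk' (by linarith)
      (fun ζ => ‖F ζ‖ₑ ^ 2) ?_)
    · refine lintegral_congr fun ζ => ?_
      rw [enorm_smul, mul_pow]
      congr 1
      rw [← ofReal_norm, Complex.norm_real, Real.norm_of_nonneg (weight_pos _ _).le,
        ← ENNReal.ofReal_pow (weight_pos _ _).le, weight, ← Real.rpow_mul_natCast (by positivity)]
      congr 2
      push_cast; ring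
    · intro k ζ
      simp only [hF]
      congr 2
      refine Finset.sum_congr rfl fun n _ => ?_
      congr 1
      have h3 : ∀ ξ : Plane, Complex.exp (-(Complex.I *
          (inner ℝ (meshPoint (2 * Real.pi * h) n) ξ : ℝ)))
          = UnitAddTorus.mFourier (-n) (toUnitTorus (2 * Real.pi * h) ξ) := by
        intro ξ
        rw [mFourier_toUnitTorus]
        congr 1
        have : meshPoint (2 * Real.pi * h) (-n) = -meshPoint (2 * Real.pi * h) n := by
          ext j; simp [meshPoint]
        rw [this, inner_neg_left]
        push_cast
        ring
      rw [h3, h3, toUnitTorus_add _ hk]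
  have e4 : ∫⁻ ζ, ‖(weight t ζ : ℂ) • G ζ‖ₑ ^ 2 = weightedNorm t G ^ 2 := by
    rw [weightedNorm, eLpNorm_eq_lintegral_rpow_enorm_toReal (by norm_num) (by norm_num)]
    simp only [ENNReal.toReal_ofNat, ← ENNReal.rpow_two]
    rw [← ENNReal.rpow_mul]
    norm_num
  have e5 := ENNReal.lintegral_mul_le_Lp_mul_Lq (volume : Measure Plane)
    (Real.HolderConjugate.two_two)
    (f := fun ζ => ‖(weight (-t) ζ : ℂ) • F ζ‖ₑ) (g := fun ζ => ‖(weight t ζ : ℂ) • G ζ‖ₑ)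
    (by
      refine AEStronglyMeasurable.enorm ?_
      exact ((Complex.continuous_ofReal.comp (continuous_weight (-t))).smul hFc).aestronglyMeasurable)
    hG.1.enorm
  have e6 : ENNReal.ofReal S ^ 2 ≤ latticeSum t * ENNReal.ofReal ((h ^ 2)⁻¹ * S)
      * weightedNorm t G ^ 2 := by
    have h1 := e2.trans e5
    simp only [ENNReal.rpow_two] at h1
    rw [e4] at h1
    calc ENNReal.ofReal S ^ 2 ≤ _ := pow_le_pow_left' h1 2
      _ = (∫⁻ ζ, ‖(weight (-t) ζ : ℂ) • F ζ‖ₑ ^ 2) * weightedNorm t G ^ 2 := by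
        rw [mul_pow, ← ENNReal.rpow_two, ← ENNReal.rpow_two, ← ENNReal.rpow_mul,
          ← ENNReal.rpow_mul]
        norm_num
      _ ≤ _ := by gcongr
  have hL := latticeSum_lt_top ht
  have hN : weightedNorm t G < ∞ := hG.2
  have e7 : S ^ 2 ≤ (latticeSum t).toReal * ((h ^ 2)⁻¹ * S) * normX t G ^ 2 := by
    have h1 := ENNReal.toReal_mono (by finiteness) e6
    rw [ENNReal.toReal_mul, ENNReal.toReal_mul, ENNReal.toReal_pow, ENNReal.toReal_pow,
      ENNReal.toReal_ofReal hS0, ENNReal.toReal_ofReal (by positivity)] at h1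
    exact h1
  rw [mul_pow, sampleConst, Real.sq_sqrt ENNReal.toReal_nonneg]
  rcases hS0.eq_or_lt with h0 | h0
  · rw [← h0, mul_zero]; positivity
  · have h1 : S * (h ^ 2 * S) ≤ S * ((latticeSum t).toReal * normX t G ^ 2) := by
      calc S * (h ^ 2 * S) = h ^ 2 * S ^ 2 := by ring
        _ ≤ h ^ 2 * ((latticeSum t).toReal * ((h ^ 2)⁻¹ * S) * normX t G ^ 2) := by gcongr
        _ = _ := by field_simp
    exact le_of_mul_le_mul_left h1 h0

theorem memℓp_sample {t : ℝ} (ht : 1 < t) {G : Plane → Cell} (hG : InX t G) {h : ℝ} (hh : 0 < h)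
    (hh' : h ≤ 1 / 2) : Memℓp (sample h (𝓕⁻ G)) 2 := by
  refine (memℓp_gen_iff (p := 2) (by norm_num)).2 ?_
  simp only [ENNReal.toReal_ofNat, Real.rpow_two]
  refine summable_of_sum_le (c := (sampleConst t * normX t G) ^ 2 / h ^ 2)
    (fun n => by positivity) fun s => ?_
  rw [le_div_iff₀ (by positivity), mul_comm]
  exact sum_sample_le ht hG hh hh' s

theorem norm_spec_sample_le {t : ℝ} (ht : 1 < t) {G : Plane → Cell} (hG : InX t G) {h : ℝ}
    (hh : 0 < h) (hh' : h ≤ 1 / 2) :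
    ‖spec h (sample h (𝓕⁻ G))‖ ≤ sampleConst t * normX t G := by
  have hm := memℓp_sample ht hG hh hh'
  rw [norm_spec hh hm]
  have h1 := lp.norm_rpow_eq_tsum (p := 2) (by norm_num) (⟨_, hm⟩ : L2Lattice)
  have s1 := (memℓp_gen_iff (p := 2) (by norm_num)).1 hm
  simp only [ENNReal.toReal_ofNat, Real.rpow_two] at h1 s1
  have hc : 0 ≤ sampleConst t * normX t G :=
    mul_nonneg (Real.sqrt_nonneg _) ENNReal.toReal_nonneg
  refine abs_le_of_sq_le_sq' ?_ hc |>.2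
  rw [mul_pow, h1, ← tsum_mul_left]
  refine (s1.mul_left _).tsum_le_of_sum_le fun s => ?_
  rw [← Finset.mul_sum]
  exact sum_sample_le ht hG hh hh' s

end
end Kagome

namespace Kagome
noncomputable section
open scoped FourierTransform

/-! ### Exact recovery of band limited functions -/

theorem fourierInv_sub {G G' : Plane → Cell} (hG : Integrable G) (hG' : Integrable G') :
    𝓕⁻ (fun ζ => G ζ - G' ζ) = fun x => 𝓕⁻ G x - 𝓕⁻ G' x := by
  funext x
  have h1 : ∀ {F : Plane → Cell}, Integrable F → Integrable
      (fun ζ => Complex.exp (((2 * Real.pi * inner ℝ ζ x : ℝ) : ℂ) * Complex.I) • F ζ) := by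
    intro F hF
    refine hF.mono ((by fun_prop : Continuous fun ζ : Plane =>
      Complex.exp (((2 * Real.pi * inner ℝ ζ x : ℝ) : ℂ) * Complex.I)).aestronglyMeasurable.smul
        hF.1) (Eventually.of_forall fun ζ => ?_)
    rw [norm_smul, Complex.norm_exp_ofReal_mul_I, one_mul]
  rw [Real.fourierInv_eq', Real.fourierInv_eq', Real.fourierInv_eq', ← integral_sub (h1 hG) (h1 hG')]
  simp only [smul_sub]

theorem sample_fourierInv_sub {G G' : Plane → Cell} (hG : Integrable G) (hG' : Integrable G')
    (h : ℝ) : sample h (𝓕⁻ (fun ζ => G ζ - G' ζ)) = sample h (𝓕⁻ G) - sample h (𝓕⁻ G') := by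
  funext n
  simp only [sample, fourierInv_sub hG hG', Pi.sub_apply]

/-- A function band limited to the torus is recovered from its samples. -/
theorem spec_sample_of_support {t : ℝ} (ht : 1 < t) {G : Plane → Cell} (hG : InX t G) {h : ℝ}
    (hh : 0 < h) (hh' : h ≤ 1 / 2)
    (hsupp : ∀ᵐ ζ ∂(volume : Measure Plane), ζ ∉ torus (2 * Real.pi * h) → G ζ = 0) :
    spec h (sample h (𝓕⁻ G)) = (hG.memLp (by linarith)).toLp G := by
  have hk := two_pi_mul_pos hh
  have hG2 := hG.memLp (by linarith)
  have hm := memℓp_sample ht hG hh hh'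
  set u := sample h (𝓕⁻ G) with hu
  set D : L2Plane := spec h u - hG2.toLp G with hD
  -- The difference has vanishing Fourier coefficients: both terms have `n`-th coefficient `u n`,
  -- one by orthogonality of the modes and the other because `u n` is by definition the inverse
  -- transform of `G` at the mesh point. Completeness of the exponentials then applies in each
  -- component.
  have hpair : ∀ n, pairing (memLp_torusExp (2 * Real.pi * h) (meshPoint (2 * Real.pi * h) n) 2) D
      = 0 := by
    intro n
    set L := pairing (memLp_torusExp (2 * Real.pi * h) (meshPoint (2 * Real.pi * h) n) 2) with hL
    have h1 : L (spec h u) = u n := by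
      refine ((hasSum_spec hh hm).mapL L).unique ?_
      have h2 : ∀ k, L ((h : ℂ) • modeLp (2 * Real.pi * h) k (u k)) = if k = n then u n else 0 := by
        intro k
        rw [map_smul, hL, pairing_modeLp]
        have h3 : ∫ ξ, torusExp (2 * Real.pi * h) (meshPoint (2 * Real.pi * h) n) ξ
            * expMode (2 * Real.pi * h) k ξ
            = if n = k then ((2 * Real.pi / (2 * Real.pi * h) : ℝ) : ℂ) else 0 := by
          rw [← integral_exp_mul_expMode hk]
          refine integral_congr_ae (Eventually.of_forall fun ξ => ?_)
          by_cases hξ : ξ ∈ torus (2 * Real.pi * h)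
          · simp only [torusExp, indicator_of_mem hξ]
          · simp only [torusExp, expMode, indicator_of_notMem hξ, mul_zero]
        rw [h3]
        by_cases hkn : k = n
        · subst hkn
          rw [if_pos rfl, if_pos rfl, smul_smul, ← Complex.ofReal_mul]
          have : h * (2 * Real.pi / (2 * Real.pi * h)) = 1 := by
            have := Real.pi_ne_zero
            field_simp
          rw [this, Complex.ofReal_one, one_smul]
        · rw [if_neg hkn, if_neg (Ne.symm hkn), zero_smul, smul_zero]
      simp_rw [h2]
      exact hasSum_ite_eq n (u n)
    have h4 : L (hG2.toLp G) = u n := by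
      rw [hL, pairing_apply, hu, sample, fourierInv_meshPoint]
      refine integral_congr_ae ?_
      filter_upwards [hG2.coeFn_toLp, hsupp] with ζ h5 h6
      rw [h5]
      by_cases hζ : ζ ∈ torus (2 * Real.pi * h)
      · simp only [torusExp, indicator_of_mem hζ]
      · rw [h6 hζ, smul_zero, smul_zero]
    rw [hD, map_sub, h1, h4, sub_self]
  have hcomp : ∀ j : Fin 3, (fun ζ => D ζ j) =ᵐ[volume.restrict (torus (2 * Real.pi * h))] 0 := by
    intro j
    refine ae_eq_zero_of_integral_torus_exp hk ?_ fun n => ?_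
    · exact ((EuclideanSpace.proj j : Cell →L[ℂ] ℂ).comp_memLp' (Lp.memLp D)).restrict _
    · have h1 := congrArg (EuclideanSpace.proj j : Cell →L[ℂ] ℂ) (hpair n)
      rw [pairing_apply, map_zero, ← ContinuousLinearMap.integral_comp_comm] at h1
      · rw [← integral_indicator (measurableSet_torus _), ← h1]
        refine integral_congr_ae (Eventually.of_forall fun ξ => ?_)
        by_cases hξ : ξ ∈ torus (2 * Real.pi * h)
        · simp [torusExp, indicator_of_mem hξ]
        · simp [torusExp, indicator_of_notMem hξ]
      · exact memLp_one_iff_integrable.1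
          (MemLp.smul (r := 1) (Lp.memLp D) (memLp_torusExp _ _ 2))
  have hz : D = 0 := by
    rw [Lp.eq_zero_iff_ae_eq_zero]
    have h1 : ∀ᵐ ζ ∂(volume : Measure Plane), ζ ∈ torus (2 * Real.pi * h) → ∀ j, D ζ j = 0 :=
      (ae_restrict_iff' (measurableSet_torus _)).1 (ae_all_iff.2 hcomp)
    filter_upwards [h1, coeFn_spec_support hh hm, hsupp, hG2.coeFn_toLp,
      Lp.coeFn_sub (spec h u) (hG2.toLp G)] with ζ h2 h3 h4 h5 h6
    by_cases hζ : ζ ∈ torus (2 * Real.pi * h)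
    · ext j
      exact h2 hζ j
    · rw [hD, h6, Pi.sub_apply, h3 hζ, h5, h4 hζ, sub_zero]; rfl
  exact sub_eq_zero.1 hz

/-! ### Density and consistency of sampling -/

theorem normX_nonneg (t : ℝ) (G : Plane → Cell) : 0 ≤ normX t G := ENNReal.toReal_nonneg

theorem norm_toLp_le_normX {t : ℝ} (ht : 0 ≤ t) {G : Plane → Cell} (hG : InX t G) :
    ‖(hG.memLp ht).toLp G‖ ≤ normX t G := by
  rw [Lp.norm_toLp, normX, weightedNorm]
  refine ENNReal.toReal_mono hG.2.ne (eLpNorm_mono fun ζ => ?_)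
  rw [norm_smul, Complex.norm_real, Real.norm_of_nonneg (weight_pos t ζ).le]
  exact le_mul_of_one_le_left (norm_nonneg _) (one_le_weight ht ζ)

theorem hasTemperateGrowth_weight (t : ℝ) : (fun x : Plane => (weight t x : ℂ)).HasTemperateGrowth := by
  unfold weight
  fun_prop

theorem contDiff_weight (t : ℝ) : ContDiff ℝ (⊤ : ℕ∞) (fun x : Plane => (weight t x : ℂ)) :=
  (hasTemperateGrowth_weight t).1

theorem inX_schwartz (t : ℝ) (φ : 𝓢(Plane, Cell)) : InX t φ := by
  have := (SchwartzMap.smulLeftCLM Cell (fun x : Plane => (weight t x : ℂ)) φ).memLp 2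
    (volume : Measure Plane)
  refine this.ae_eq (Eventually.of_forall fun x => ?_)
  rw [SchwartzMap.smulLeftCLM_apply_apply (hasTemperateGrowth_weight t)]

/-- Smooth functions with compact support are dense. -/
theorem exists_schwartz_normX_sub_le {t : ℝ} {G : Plane → Cell} (hG : InX t G) {ε : ℝ}
    (hε : 0 < ε) : ∃ φ : 𝓢(Plane, Cell), HasCompactSupport φ ∧ normX t (fun ζ => G ζ - φ ζ) ≤ ε := by
  obtain ⟨g, hg1, hg2, hg3⟩ := MemLp.exist_eLpNorm_sub_le (by norm_num) (by norm_num) hG hε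
  -- The approximation is made for the weighted function in plain `L²`. Dividing by the smooth
  -- positive weight keeps smoothness and compact support.
  set w : Plane → Cell := fun ζ => (weight (-t) ζ : ℂ) • g ζ with hw
  have h1 : HasCompactSupport w := by
    refine hg1.mono fun ζ hζ => ?_
    rw [Function.mem_support] at hζ ⊢
    intro h0
    exact hζ (by rw [hw]; simp only [h0, smul_zero])
  have h2 : ContDiff ℝ (⊤ : ℕ∞) w := (contDiff_weight (-t)).smul hg2
  have hφ : ∀ ζ, h1.toSchwartzMap h2 ζ = w ζ := fun ζ => by
    rw [HasCompactSupport.toSchwartzMap_toFun]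
  generalize h1.toSchwartzMap h2 = φ at hφ
  have hφw : (φ : Plane → Cell) = w := funext hφ
  refine ⟨φ, by rw [hφw]; exact h1, ?_⟩
  have h3 : weightedNorm t (fun ζ => G ζ - φ ζ)
      = eLpNorm ((fun ζ => (weight t ζ : ℂ) • G ζ) - g) 2 volume := by
    rw [weightedNorm]
    refine eLpNorm_congr_ae (Eventually.of_forall fun ζ => ?_)
    simp only [hφ, hw, smul_sub, Pi.sub_apply]
    rw [smul_smul, ← Complex.ofReal_mul, mul_comm, weight_neg_mul, Complex.ofReal_one, one_smul]
  rw [normX, h3]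
  exact ENNReal.toReal_le_of_le_ofReal hε.le hg3

theorem eventually_mesh : ∀ᶠ h : ℝ in 𝓝[>] 0, 0 < h ∧ h ≤ 1 / 2 := by
  filter_upwards [Ioc_mem_nhdsGT (show (0 : ℝ) < 1 / 2 by norm_num)] with h hh
  exact hh

theorem eventually_closedBall_subset_torus (R : ℝ) :
    ∀ᶠ h : ℝ in 𝓝[>] 0, Metric.closedBall (0 : Plane) R ⊆ torus (2 * Real.pi * h) := by
  -- The box `torus (2πh)` has half-width `1 / (2h)`, which this bound makes at least `|R| + 1`.
  filter_upwards [Ioc_mem_nhdsGT (show (0 : ℝ) < 1 / (2 * (|R| + 1)) by positivity)] with h hh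
  intro ζ hζ j
  have h1 : |ζ j| ≤ R := (PiLp.norm_apply_le ζ j).trans (by simpa using hζ)
  have h2 : Real.pi / (2 * Real.pi * h) = 1 / (2 * h) := by
    have := Real.pi_ne_zero
    field_simp
  rw [h2, mem_Icc, ← abs_le]
  refine h1.trans ((le_abs_self R).trans ?_)
  have hh0 : 0 < h := hh.1
  have h3 := hh.2
  rw [le_div_iff₀ (by positivity)] at h3 ⊢
  linarith

/-- Sampling is consistent as the mesh tends to zero. -/
theorem tendsto_spec_sample {t : ℝ} (ht : 1 < t) {G : Plane → Cell} (hG : InX t G) :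
    Tendsto (fun h => spec h (sample h (𝓕⁻ G))) (𝓝[>] 0)
      (𝓝 ((hG.memLp (by linarith)).toLp G)) := by
  have ht0 : 0 ≤ t := by linarith
  rw [Metric.tendsto_nhds]
  intro ε hε
  have hC : 0 ≤ sampleConst t := Real.sqrt_nonneg _
  obtain ⟨φ, hφ1, hφ2⟩ := exists_schwartz_normX_sub_le hG
    (show 0 < ε / (2 * (sampleConst t + 1)) by positivity)
  have hφX := inX_schwartz t φ
  obtain ⟨R, hR⟩ := hφ1.isBounded.subset_closedBall (0 : Plane)
  filter_upwards [eventually_mesh, eventually_closedBall_subset_torus R] with h hh hRh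
  -- For small `h` the torus contains the support of `φ`, so sampling `φ` makes no error at all;
  -- what remains is `G - φ`, controlled uniformly in `h`.
  have h1 := spec_sample_of_support ht hφX hh.1 hh.2 (Eventually.of_forall fun ζ hζ =>
    image_eq_zero_of_notMem_tsupport fun hm => hζ (hRh (hR hm)))
  have h2 := norm_spec_sample_le ht (hG.sub hφX) hh.1 hh.2
  rw [sample_fourierInv_sub (hG.integrable ht) (hφX.integrable ht),
    spec_sub hh.1 (memℓp_sample ht hG hh.1 hh.2) (memℓp_sample ht hφX hh.1 hh.2), h1] at h2
  have h3 := norm_toLp_le_normX ht0 (hG.sub hφX)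
  have h4 : ((hG.sub hφX).memLp ht0).toLp _ = (hG.memLp ht0).toLp G - (hφX.memLp ht0).toLp φ :=
    MemLp.toLp_sub _ _
  rw [h4] at h3
  rw [dist_eq_norm]
  calc ‖spec h (sample h (𝓕⁻ G)) - (hG.memLp ht0).toLp G‖
      = ‖(spec h (sample h (𝓕⁻ G)) - (hφX.memLp ht0).toLp φ)
        - ((hG.memLp ht0).toLp G - (hφX.memLp ht0).toLp φ)‖ := by congr 1; abel
    _ ≤ _ := norm_sub_le _ _
    _ ≤ sampleConst t * (ε / (2 * (sampleConst t + 1))) + ε / (2 * (sampleConst t + 1)) := by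
        gcongr
        · exact h2.trans (by gcongr)
        · exact h3.trans hφ2
    _ = ε / 2 := by field_simp
    _ < ε := by linarith

end
end Kagome

namespace Kagome
noncomputable section
open scoped FourierTransform

/-! ### Products with functions vanishing at infinity -/

/-- A continuous function vanishing at infinity is uniformly continuous, hence uniformly close to a
smooth one. The smooth one is cut off outside a ball beyond which `W` itself is small. -/
theorem exists_schwartz_norm_sub_le {W : Plane → ℂ} (hW : Continuous W)
    (hW0 : Tendsto W (cocompact Plane) (𝓝 0)) {ε : ℝ} (hε : 0 < ε) :
    ∃ φ : 𝓢(Plane, ℂ), ∀ x, ‖W x - φ x‖ ≤ ε := by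
  have huc : UniformContinuous W := hW.uniformContinuous_of_tendsto_cocompact hW0
  obtain ⟨g, hg, hgW⟩ := huc.exists_contDiff_dist_le (half_pos hε)
  have hev : ∀ᶠ x in cocompact Plane, ‖W x‖ < ε / 2 := by
    have := hW0.norm
    rw [norm_zero] at this
    exact this.eventually (gt_mem_nhds (half_pos hε))
  obtain ⟨K, hK, hKW⟩ := mem_cocompact.1 hev
  obtain ⟨R, hR⟩ := hK.isBounded.subset_closedBall (0 : Plane)
  set χ : ContDiffBump (0 : Plane) := ⟨|R| + 1, |R| + 2, by positivity, by linarith⟩ with hχ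
  set w : Plane → ℂ := fun x => ((χ x : ℝ) : ℂ) * g x with hw
  have h1 : HasCompactSupport w := by
    refine χ.hasCompactSupport.mono fun x hx => ?_
    rw [Function.mem_support] at hx ⊢
    intro h0
    exact hx (by rw [hw]; simp only [h0, Complex.ofReal_zero, zero_mul])
  have h2 : ContDiff ℝ (⊤ : ℕ∞) w := (Complex.ofRealCLM.contDiff.comp χ.contDiff).mul hg
  have hφ : ∀ ζ, h1.toSchwartzMap h2 ζ = w ζ := fun ζ => by
    rw [HasCompactSupport.toSchwartzMap_toFun]
  refine ⟨h1.toSchwartzMap h2, fun x => ?_⟩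
  rw [hφ]
  have h3 : ‖W x - g x‖ ≤ ε / 2 := by
    rw [← dist_eq_norm, dist_comm]; exact (hgW x).le
  have h4 : W x - w x = ((χ x : ℝ) : ℂ) * (W x - g x) + ((1 - χ x : ℝ) : ℂ) * W x := by
    rw [hw]; push_cast; ring
  have h5 : ‖((1 - χ x : ℝ) : ℂ) * W x‖ ≤ ε / 2 := by
    by_cases hx : x ∈ K
    · have : χ x = 1 := by
        refine χ.one_of_mem_closedBall ?_
        have := hR hx
        rw [mem_closedBall_zero_iff] at this ⊢
        exact this.trans ((le_abs_self R).trans (by simp [hχ]))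
      rw [this]; simp; positivity
    · have h6 : ‖W x‖ < ε / 2 := hKW hx
      rw [norm_mul, Complex.norm_real, Real.norm_of_nonneg (by linarith [χ.le_one (x := x)])]
      calc _ ≤ 1 * ‖W x‖ := by
            gcongr
            linarith [χ.nonneg (x := x)]
        _ ≤ _ := by linarith
  calc ‖W x - w x‖ ≤ ‖((χ x : ℝ) : ℂ) * (W x - g x)‖ + ‖((1 - χ x : ℝ) : ℂ) * W x‖ := by
        rw [h4]; exact norm_add_le _ _
    _ ≤ 1 * (ε / 2) + ε / 2 := by
        gcongr
        rw [norm_mul, Complex.norm_real, Real.norm_of_nonneg χ.nonneg]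
        gcongr
        exact χ.le_one
    _ = ε := by ring

theorem exists_norm_le_of_tendsto_cocompact {W : Plane → ℂ} (hW : Continuous W)
    (hW0 : Tendsto W (cocompact Plane) (𝓝 0)) : ∃ M, 0 ≤ M ∧ ∀ x, ‖W x‖ ≤ M := by
  obtain ⟨φ, hφ⟩ := exists_schwartz_norm_sub_le hW hW0 one_pos
  obtain ⟨C, hC⟩ := φ.decay 0 0
  refine ⟨1 + C, by linarith [hC.1], fun x => ?_⟩
  have h1 := hC.2 x
  simp only [pow_zero, one_mul, norm_iteratedFDeriv_zero] at h1
  calc ‖W x‖ = ‖(W x - φ x) + φ x‖ := by congr 1; abel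
    _ ≤ _ := norm_add_le _ _
    _ ≤ _ := add_le_add (hφ x) h1

theorem memLp_bounded_smul {W : Plane → ℂ} (hW : AEStronglyMeasurable W volume) {M : ℝ}
    (hM : ∀ x, ‖W x‖ ≤ M) {g : Plane → Cell} (hg : MemLp g 2 (volume : Measure Plane)) :
    MemLp (fun x => W x • g x) 2 volume := by
  refine hg.of_le_mul (c := M) (hW.smul hg.1) (Eventually.of_forall fun x => ?_)
  rw [norm_smul]
  gcongr
  exact hM x

theorem norm_toLp_bounded_smul_le {W : Plane → ℂ} {M : ℝ}
    (hM : ∀ x, ‖W x‖ ≤ M) {g : Plane → Cell} (hg : MemLp g 2 (volume : Measure Plane))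
    (hWg : MemLp (fun x => W x • g x) 2 volume) : ‖hWg.toLp _‖ ≤ M * ‖hg.toLp g‖ := by
  refine Lp.norm_le_mul_norm_of_ae_le_mul ?_
  filter_upwards [hg.coeFn_toLp, hWg.coeFn_toLp] with x h1 h2
  rw [h1, h2, norm_smul]
  gcongr
  exact hM x

theorem memℓp_sample_smul {W : Plane → ℂ} {M : ℝ} (hM : ∀ x, ‖W x‖ ≤ M) {h : ℝ}
    {g : Plane → Cell} (hg : Memℓp (sample h g) 2) : Memℓp (sample h fun x => W x • g x) 2 := by
  refine memℓp_of_le hg (c := M) fun n => ?_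
  simp only [sample, norm_smul]
  gcongr
  exact hM _

theorem norm_spec_sample_smul_le {W : Plane → ℂ} {M : ℝ} (hM : ∀ x, ‖W x‖ ≤ M) {h : ℝ}
    (hh : 0 < h) {g : Plane → Cell} (hg : Memℓp (sample h g) 2) :
    ‖spec h (sample h fun x => W x • g x)‖ ≤ M * ‖spec h (sample h g)‖ := by
  refine norm_spec_le_of_le hh (memℓp_sample_smul hM hg) hg ((norm_nonneg _).trans (hM 0))
    fun n => ?_
  simp only [sample, norm_smul]
  gcongr
  exact hM _

/-- The product of a function vanishing at infinity with a Sobolev function is sampled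
consistently. -/
theorem tendsto_spec_sample_smul {t : ℝ} (ht : 1 < t) {G : Plane → Cell} (hG : InX t G)
    {W : Plane → ℂ} (hW : Continuous W) (hW0 : Tendsto W (cocompact Plane) (𝓝 0))
    (hWg : MemLp (fun x => W x • 𝓕⁻ G x) 2 (volume : Measure Plane)) :
    Tendsto (fun h => spec h (sample h fun x => W x • 𝓕⁻ G x)) (𝓝[>] 0)
      (𝓝 (𝓕 (hWg.toLp _) : L2Plane)) := by
  have ht0 : 0 ≤ t := by linarith
  obtain ⟨M, hM0, hM⟩ := exists_norm_le_of_tendsto_cocompact hW hW0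
  rw [Metric.tendsto_nhds]
  intro ε hε
  have hC : 0 ≤ sampleConst t := Real.sqrt_nonneg _
  set C := sampleConst t + 1 with hCdef
  have hC1 : 0 < C := by positivity
  -- The order matters: `φ` is chosen first, with tolerance depending on the bound `M` for `W`. Then
  -- `ψ` approximates `W` with tolerance depending on the norm of `φ`.
  obtain ⟨φ, -, hφ2⟩ := exists_schwartz_normX_sub_le hG
    (show 0 < ε / (8 * (C * (M + 1))) by positivity)
  have hφX := inX_schwartz t φ
  have hN := normX_nonneg t φ
  obtain ⟨ψ, hψ⟩ := exists_schwartz_norm_sub_le hW hW0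
    (show 0 < ε / (8 * (C * (normX t φ + 1))) by positivity)
  set δ₁ := ε / (8 * (C * (M + 1))) with hδ₁
  set δ₂ := ε / (8 * (C * (normX t φ + 1))) with hδ₂
  have hδ₁0 : 0 < δ₁ := by positivity
  have hδ₂0 : 0 < δ₂ := by positivity
  have hb1 : M * (C * δ₁) ≤ ε / 8 := by
    rw [hδ₁]
    calc M * (C * (ε / (8 * (C * (M + 1))))) = ε / 8 * (M / (M + 1)) := by field_simp
      _ ≤ ε / 8 * 1 := by
        gcongr
        rw [div_le_one (by positivity)]; linarith
      _ = _ := mul_one _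
  have hb2 : δ₂ * (C * normX t φ) ≤ ε / 8 := by
    rw [hδ₂]
    calc ε / (8 * (C * (normX t φ + 1))) * (C * normX t φ)
        = ε / 8 * (normX t φ / (normX t φ + 1)) := by field_simp
      _ ≤ ε / 8 * 1 := by
        gcongr
        rw [div_le_one (by positivity)]; linarith
      _ = _ := mul_one _
  have hGi := hG.integrable ht
  have hφi := hφX.integrable ht
  have hdX := hG.sub hφX
  have hdi := hdX.integrable ht
  -- the Schwartz approximation of the product
  set q : 𝓢(Plane, Cell) := SchwartzMap.smulLeftCLM Cell ψ (𝓕⁻ φ) with hq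
  have hqx : ∀ x, q x = ψ x • 𝓕⁻ (φ : Plane → Cell) x := by
    intro x
    rw [hq, SchwartzMap.smulLeftCLM_apply_apply ψ.hasTemperateGrowth, SchwartzMap.fourierInv_coe]
  have hQX : InX t (𝓕 q : 𝓢(Plane, Cell)) := inX_schwartz t _
  have hQinv : 𝓕⁻ ((𝓕 q : 𝓢(Plane, Cell)) : Plane → Cell) = q := by
    rw [← SchwartzMap.fourierInv_coe, FourierTransform.fourierInv_fourier_eq]
  have hqL : MemLp q 2 (volume : Measure Plane) := q.memLp 2 volume
  -- This pointwise splitting serves twice: under the `L²` norm of the plane in `key3`, and under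
  -- the norm of the samples in `key1`. In both cases each summand is a bounded factor times a
  -- controlled function.
  have hsplit : ∀ x, W x • 𝓕⁻ G x - q x
      = W x • 𝓕⁻ (fun ζ => G ζ - φ ζ) x + (W x - ψ x) • 𝓕⁻ (φ : Plane → Cell) x := by
    intro x
    rw [hqx, fourierInv_sub hGi hφi]
    simp only [smul_sub, sub_smul]
    abel
  obtain ⟨hd2, hd3⟩ := fourier_toLp_fourierInv hdi (hdX.memLp ht0)
  obtain ⟨hp2, hp3⟩ := fourier_toLp_fourierInv hφi (hφX.memLp ht0)
  have hWm : AEStronglyMeasurable W (volume : Measure Plane) := hW.aestronglyMeasurable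
  have hWψm : AEStronglyMeasurable (fun x => W x - ψ x) (volume : Measure Plane) :=
    (hW.sub ψ.continuous).aestronglyMeasurable
  have hL1 := memLp_bounded_smul hWm hM hd2
  have hL2 := memLp_bounded_smul hWψm hψ hp2
  have key3 : ‖(𝓕 (hqL.toLp q) : L2Plane) - 𝓕 (hWg.toLp _)‖ ≤ ε / 4 := by
    have h0 : (𝓕 (hqL.toLp q) : L2Plane) - 𝓕 (hWg.toLp _) = 𝓕 (hqL.toLp q - hWg.toLp _) :=
      (map_sub (Lp.fourierTransformₗᵢ Plane Cell) _ _).symm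
    rw [h0, Lp.norm_fourier_eq, norm_sub_rev]
    have h1 : hWg.toLp _ - hqL.toLp q = hL1.toLp _ + hL2.toLp _ := by
      rw [← MemLp.toLp_sub, ← MemLp.toLp_add]
      exact MemLp.toLp_congr _ _ (Eventually.of_forall hsplit)
    have h2 : ‖hd2.toLp _‖ ≤ δ₁ := by
      rw [← Lp.norm_fourier_eq, hd3]
      exact (norm_toLp_le_normX ht0 hdX).trans hφ2
    have h3 : ‖hp2.toLp _‖ ≤ normX t φ := by
      rw [← Lp.norm_fourier_eq, hp3]
      exact norm_toLp_le_normX ht0 hφX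
    rw [h1]
    calc _ ≤ _ := norm_add_le _ _
      _ ≤ M * δ₁ + δ₂ * normX t φ := by
        gcongr
        · exact (norm_toLp_bounded_smul_le hM hd2 hL1).trans (by gcongr)
        · exact (norm_toLp_bounded_smul_le hψ hp2 hL2).trans (by gcongr)
      _ ≤ M * (C * δ₁) + δ₂ * (C * normX t φ) := by
        have : 1 ≤ C := by rw [hCdef]; linarith
        gcongr
        · exact le_mul_of_one_le_left hδ₁0.le this
        · exact le_mul_of_one_le_left hN this
      _ ≤ _ := by linarith
  have hq2 : (hQX.memLp ht0).toLp _ = (𝓕 (hqL.toLp q) : L2Plane) :=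
    (SchwartzMap.toLp_fourier_eq q).symm
  have hlim := tendsto_spec_sample ht hQX
  rw [hQinv, hq2, Metric.tendsto_nhds] at hlim
  filter_upwards [eventually_mesh, hlim (ε / 4) (by positivity)] with h hh hlimh
  have hmG := memℓp_sample ht hG hh.1 hh.2
  have hmφ := memℓp_sample ht hφX hh.1 hh.2
  have hmd := memℓp_sample ht hdX hh.1 hh.2
  have hmq := memℓp_sample ht hQX hh.1 hh.2
  rw [hQinv] at hmq
  have key1 : ‖spec h (sample h fun x => W x • 𝓕⁻ G x) - spec h (sample h q)‖ ≤ ε / 4 := by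
    have hm1 := memℓp_sample_smul hM hmd
    have hm2 := memℓp_sample_smul hψ hmφ
    rw [← spec_sub hh.1 (memℓp_sample_smul hM hmG) hmq]
    have h1 : (sample h fun x => W x • 𝓕⁻ G x) - sample h q
        = (sample h fun x => W x • 𝓕⁻ (fun ζ => G ζ - φ ζ) x)
          + sample h fun x => (W x - ψ x) • 𝓕⁻ (φ : Plane → Cell) x := by
      funext n
      exact hsplit _
    rw [h1, spec_add hh.1 hm1 hm2]
    calc _ ≤ _ := norm_add_le _ _
      _ ≤ M * (C * δ₁) + δ₂ * (C * normX t φ) := by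
        gcongr
        · refine (norm_spec_sample_smul_le hM hh.1 hmd).trans ?_
          gcongr
          refine (norm_spec_sample_le ht hdX hh.1 hh.2).trans ?_
          have : sampleConst t ≤ C := by rw [hCdef]; linarith
          have := normX_nonneg t (fun ζ => G ζ - φ ζ)
          gcongr
        · refine (norm_spec_sample_smul_le hψ hh.1 hmφ).trans ?_
          gcongr
          refine (norm_spec_sample_le ht hφX hh.1 hh.2).trans ?_
          gcongr
          rw [hCdef]; linarith
      _ ≤ _ := by linarith
  rw [dist_eq_norm] at hlimh ⊢
  set A := spec h (sample h fun x => W x • 𝓕⁻ G x)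
  set B := spec h (sample h q)
  calc ‖A - 𝓕 (hWg.toLp _)‖ = ‖(A - B) + (B - 𝓕 (hqL.toLp q))
        + (𝓕 (hqL.toLp q) - 𝓕 (hWg.toLp _))‖ := by congr 1; abel
    _ ≤ _ := norm_add₃_le
    _ < ε := by linarith

end
end Kagome

namespace Kagome
noncomputable section
open scoped FourierTransform ComplexConjugate

/-! ### Operators on square summable lattice functions -/

theorem lattice_norm_sq (u : L2Lattice) : ‖u‖ ^ 2 = ∑' n, ‖u n‖ ^ 2 := by
  have h1 := lp.norm_rpow_eq_tsum (p := 2) (by norm_num) u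
  simpa only [ENNReal.toReal_ofNat, Real.rpow_two] using h1

theorem lattice_summable_norm_sq (u : L2Lattice) : Summable fun n => ‖u n‖ ^ 2 := by
  have s1 := (memℓp_gen_iff (p := 2) (by norm_num)).1 (lp.memℓp u)
  simpa only [ENNReal.toReal_ofNat, Real.rpow_two] using s1

theorem memℓp_two_iff {u : (Fin 2 → ℤ) → Cell} : Memℓp u 2 ↔ Summable fun n => ‖u n‖ ^ 2 := by
  rw [memℓp_gen_iff (p := 2) (by norm_num)]
  simp only [ENNReal.toReal_ofNat, Real.rpow_two]

theorem summable_shift_norm_sq (k : Fin 2 → ℤ) {L : (Fin 2 → ℤ) → Cell →L[ℂ] Cell} {C : ℝ}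
    (hL : ∀ n, ‖L n‖ ≤ C) (u : L2Lattice) : Summable fun n => ‖L n (u (n + k))‖ ^ 2 := by
  have s1 := ((lattice_summable_norm_sq u).comp_injective (add_left_injective k)).mul_left (C ^ 2)
  refine Summable.of_nonneg_of_le (fun n => by positivity) (fun n => ?_) s1
  simp only [Function.comp_apply]
  rw [← mul_pow]
  gcongr
  exact (L n).le_of_opNorm_le (hL n) _

/-- The function `n ↦ L n (u (n + k))` for square summable `u`. -/
def shiftFun (k : Fin 2 → ℤ) {L : (Fin 2 → ℤ) → Cell →L[ℂ] Cell} {C : ℝ}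
    (hL : ∀ n, ‖L n‖ ≤ C) (u : L2Lattice) : L2Lattice :=
  ⟨fun n => L n (u (n + k)), memℓp_two_iff.2 (summable_shift_norm_sq k hL u)⟩

theorem shiftFun_apply (k : Fin 2 → ℤ) {L : (Fin 2 → ℤ) → Cell →L[ℂ] Cell} {C : ℝ}
    (hL : ∀ n, ‖L n‖ ≤ C) (u : L2Lattice) (n : Fin 2 → ℤ) :
    shiftFun k hL u n = L n (u (n + k)) := rfl

theorem norm_shiftFun_le (k : Fin 2 → ℤ) {L : (Fin 2 → ℤ) → Cell →L[ℂ] Cell} {C : ℝ}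
    (hL : ∀ n, ‖L n‖ ≤ C) (u : L2Lattice) : ‖shiftFun k hL u‖ ≤ C * ‖u‖ := by
  have hC : 0 ≤ C := (norm_nonneg _).trans (hL 0)
  refine le_of_sq_le_sq ?_ (by positivity)
  rw [lattice_norm_sq, mul_pow, lattice_norm_sq u, ← (Equiv.addRight k).tsum_eq (fun n => ‖u n‖ ^ 2),
    ← tsum_mul_left]
  refine (summable_shift_norm_sq k hL u).tsum_le_tsum (fun n => ?_)
    (((lattice_summable_norm_sq u).comp_injective (add_left_injective k)).mul_left (C ^ 2))
  rw [← mul_pow, shiftFun_apply]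
  gcongr
  exact (L n).le_of_opNorm_le (hL n) _

/-- The operator `u ↦ (n ↦ L n (u (n + k)))`. -/
def shiftOp (k : Fin 2 → ℤ) {L : (Fin 2 → ℤ) → Cell →L[ℂ] Cell} {C : ℝ}
    (hL : ∀ n, ‖L n‖ ≤ C) : L2Lattice →L[ℂ] L2Lattice :=
  LinearMap.mkContinuous
    { toFun := shiftFun k hL
      map_add' := fun _ _ => Subtype.ext (funext fun n => map_add (L n) _ _)
      map_smul' := fun _ _ => Subtype.ext (funext fun n => map_smul (L n) _ _) } C
    (norm_shiftFun_le k hL)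

theorem shiftOp_apply (k : Fin 2 → ℤ) {L : (Fin 2 → ℤ) → Cell →L[ℂ] Cell} {C : ℝ}
    (hL : ∀ n, ‖L n‖ ≤ C) (u : L2Lattice) (n : Fin 2 → ℤ) :
    shiftOp k hL u n = L n (u (n + k)) := rfl

/-- The exponential `e^{i h k · ξ}`. -/
def phase (h : ℝ) (k : Fin 2 → ℤ) (ξ : Plane) : ℂ :=
  Complex.exp (Complex.I * (inner ℝ (meshPoint h k) ξ : ℝ))

theorem norm_phase (h : ℝ) (k : Fin 2 → ℤ) (ξ : Plane) : ‖phase h k ξ‖ = 1 := norm_exp_I_mul _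

theorem continuous_phase (h : ℝ) (k : Fin 2 → ℤ) : Continuous (phase h k) := by
  unfold phase; fun_prop

theorem phase_mul_expMode (h : ℝ) (n k : Fin 2 → ℤ) (ξ : Plane) :
    phase h k ξ * expMode h (n + k) ξ = expMode h n ξ := by
  by_cases hξ : ξ ∈ torus h
  · rw [phase, expMode, expMode, indicator_of_mem hξ, indicator_of_mem hξ, mul_left_comm,
      ← Complex.exp_add, meshPoint_add, inner_add_left]
    congr 2
    push_cast
    ring
  · rw [expMode, expMode, indicator_of_notMem hξ, indicator_of_notMem hξ, mul_zero]

theorem norm_phase_smul_le (h : ℝ) (k : Fin 2 → ℤ) (E : Cell →L[ℂ] Cell) (ξ : Plane) :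
    ‖phase h k ξ • E‖ ≤ ‖E‖ := by
  rw [norm_smul, norm_phase, one_mul]

/-- Apply the bounded multiplication operator to the synthesis series and reindex by `n ↦ n + k`:
the phase turns the mode at `n + k` into the mode at `n`. -/
theorem synth_shiftOp {h : ℝ} (hh : 0 < h) (k : Fin 2 → ℤ) (E : Cell →L[ℂ] Cell) (u : L2Lattice) :
    synth hh (shiftOp k (L := fun _ => E) (fun _ => le_rfl) u)
      =ᵐ[volume] fun ξ => phase h k ξ • E (synth hh u ξ) := by
  have hm : AEStronglyMeasurable (fun ξ => phase h k ξ • E) (volume : Measure Plane) :=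
    ((continuous_phase h k).smul continuous_const).aestronglyMeasurable
  set M := multOp hm (norm_phase_smul_le h k E) with hM
  have h1 : synth hh (shiftOp k (L := fun _ => E) (fun _ => le_rfl) u) = M (synth hh u) := by
    refine (hasSum_synth hh _).unique ?_
    have h2 := (hasSum_synth hh u).mapL M
    rw [← (Equiv.addRight k).hasSum_iff] at h2
    refine h2.congr_fun fun n => ?_
    apply Lp.ext
    filter_upwards [coeFn_modeLp h n (shiftOp k (L := fun _ => E) (fun _ => le_rfl) u n),
      coeFn_multOp hm (norm_phase_smul_le h k E) (modeLp h (n + k) (u (n + k))),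
      coeFn_modeLp h (n + k) (u (n + k))] with ξ h3 h4 h5
    simp only [Function.comp_apply, Equiv.coe_addRight]
    rw [h3, h4, h5, shiftOp_apply, _root_.smul_apply, map_smul, smul_smul,
      phase_mul_expMode]
  rw [h1]
  exact coeFn_multOp hm (norm_phase_smul_le h k E) (synth hh u)

/-! ### The Kagome Laplacian and its symbol -/

/-- The matrix units. -/
def entry (i j : Fin 3) : Cell →L[ℂ] Cell :=
  (EuclideanSpace.proj j : Cell →L[ℂ] ℂ).smulRight (EuclideanSpace.single i (1 : ℂ))

/-- The directed bonds `(i, j, k)` of one period cell: the vertex `(n + k, j)` is a neighbour of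
the vertex `(n, i)`. -/
def bond : Fin 12 → Fin 3 × Fin 3 × (Fin 2 → ℤ) :=
  ![(0, 1, 0), (0, 1, ![1, -1]), (0, 2, 0), (0, 2, ![1, 0]),
    (1, 0, 0), (1, 0, ![-1, 1]), (1, 2, 0), (1, 2, ![0, 1]),
    (2, 0, 0), (2, 0, ![-1, 0]), (2, 1, 0), (2, 1, ![0, -1])]

/-- The matrix unit of a bond. -/
def bondEntry (b : Fin 12) : Cell →L[ℂ] Cell := entry (bond b).1 (bond b).2.1

theorem laplacian_eq_sum (u : (Fin 2 → ℤ) → Cell) (n : Fin 2 → ℤ) :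
    laplacian u n = (1 / 4 : ℂ) • ∑ b, bondEntry b (u (n + (bond b).2.2)) := by
  rw [laplacian_apply]
  congr 1
  ext j
  simp only [Fin.sum_univ_succ, bondEntry, bond, entry]
  fin_cases j <;> simp <;> ring

/-- The operator `-Δ_{disc,h}` on square summable functions. -/
def hamOp (h : ℝ) : L2Lattice →L[ℂ] L2Lattice :=
  ((h ^ 2 : ℝ) : ℂ)⁻¹ • (ContinuousLinearMap.id ℂ L2Lattice - (1 / 4 : ℂ) •
    ∑ b, shiftOp (bond b).2.2 (L := fun _ => bondEntry b) (fun _ => le_rfl))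

theorem hamOp_apply (h : ℝ) (u : L2Lattice) (n : Fin 2 → ℤ) :
    hamOp h u n = hamiltonian h u n := by
  rw [hamiltonian, laplacian_eq_sum]
  simp only [hamOp, _root_.smul_apply, _root_.sub_apply,
    ContinuousLinearMap.id_apply, _root_.sum_apply, lp.coeFn_smul, Pi.smul_apply,
    lp.coeFn_sub, Pi.sub_apply, lp.coeFn_sum, Finset.sum_apply, shiftOp_apply]
  congr 1
  rw [sub_eq_add_neg, add_comm]

/-- The symbol of `-Δ + 1` at the frequency `h ξ`. -/
def symbol (h : ℝ) (ξ : Plane) : Cell →L[ℂ] Cell :=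
  ContinuousLinearMap.id ℂ Cell - (1 / 4 : ℂ) • ∑ b, phase h (bond b).2.2 ξ • bondEntry b

theorem continuous_symbol (h : ℝ) : Continuous (symbol h) := by
  unfold symbol
  have := fun b : Fin 12 => continuous_phase h (bond b).2.2
  fun_prop

/-- The mesh `h` of the exponentials and the scaling `h'` of the operator are independent. The
convention of `spec` uses `2π h'` for the mesh, and for self-adjointness any fixed mesh will do. -/
theorem synth_hamOp {h : ℝ} (hh : 0 < h) (h' : ℝ) (u : L2Lattice) :
    synth hh (hamOp h' u)
      =ᵐ[volume] fun ξ => ((h' ^ 2 : ℝ) : ℂ)⁻¹ • symbol h ξ (synth hh u ξ) := by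
  set T : Fin 12 → L2Lattice := fun b =>
    shiftOp (bond b).2.2 (L := fun _ => bondEntry b) (fun _ => le_rfl) u with hT
  have h1 : synth hh (hamOp h' u) = ((h' ^ 2 : ℝ) : ℂ)⁻¹ •
      (synth hh u - (1 / 4 : ℂ) • ∑ b, synth hh (T b)) := by
    simp only [hamOp, _root_.smul_apply, _root_.sub_apply,
      ContinuousLinearMap.id_apply, _root_.sum_apply, map_smul, map_sub, map_sum, hT]
  have h2 : ∀ᵐ ξ ∂(volume : Measure Plane), ∀ b, synth hh (T b) ξ
      = phase h (bond b).2.2 ξ • bondEntry b (synth hh u ξ) :=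
    ae_all_iff.2 fun b => synth_shiftOp hh _ _ u
  rw [h1]
  filter_upwards [h2, Lp.coeFn_smul (((h' ^ 2 : ℝ) : ℂ)⁻¹)
      (synth hh u - (1 / 4 : ℂ) • ∑ b, synth hh (T b)),
    Lp.coeFn_sub (synth hh u) ((1 / 4 : ℂ) • ∑ b, synth hh (T b)),
    Lp.coeFn_smul (1 / 4 : ℂ) (∑ b, synth hh (T b)),
    Lp.coeFn_finsetSum Finset.univ fun b => synth hh (T b)] with ξ h3 h4 h5 h6 h7
  rw [h4, Pi.smul_apply, h5, Pi.sub_apply, h6, Pi.smul_apply, h7, Finset.sum_apply]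
  simp only [h3, symbol, _root_.sub_apply, ContinuousLinearMap.id_apply,
    _root_.smul_apply, _root_.sum_apply]

/-- `e^{i h ξ_j}`. -/
def coordPhase (h : ℝ) (j : Fin 2) (ξ : Plane) : ℂ := Complex.exp (Complex.I * (h * ξ j : ℝ))

theorem coordPhase_mul_conj (h : ℝ) (j : Fin 2) (ξ : Plane) :
    coordPhase h j ξ * conj (coordPhase h j ξ) = 1 := by
  rw [Complex.mul_conj, Complex.normSq_eq_norm_sq, coordPhase, norm_exp_I_mul]; simp

theorem phase_eq (h : ℝ) (k : Fin 2 → ℤ) (ξ : Plane) :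
    phase h k ξ = Complex.exp (Complex.I * (h * ξ 0 * k 0 + h * ξ 1 * k 1 : ℝ)) := by
  rw [phase]
  congr 3
  simp only [meshPoint, PiLp.inner_apply, Fin.sum_univ_two, RCLike.inner_apply, conj_trivial]
  ring

theorem symbol_apply (h : ℝ) (ξ : Plane) (a : Cell) :
    symbol h ξ a = !₂[
      a 0 - 1 / 4 * ((1 + coordPhase h 0 ξ * conj (coordPhase h 1 ξ)) * a 1
        + (1 + coordPhase h 0 ξ) * a 2),
      a 1 - 1 / 4 * ((1 + conj (coordPhase h 0 ξ) * coordPhase h 1 ξ) * a 0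
        + (1 + coordPhase h 1 ξ) * a 2),
      a 2 - 1 / 4 * ((1 + conj (coordPhase h 0 ξ)) * a 0
        + (1 + conj (coordPhase h 1 ξ)) * a 1)] := by
  have hc : ∀ j, conj (coordPhase h j ξ) = Complex.exp (-(Complex.I * (h * ξ j : ℝ))) := by
    intro j
    rw [coordPhase, ← Complex.exp_conj]
    simp
  have e0 : phase h 0 ξ = 1 := by simp [phase_eq]
  have e1 : phase h ![1, -1] ξ = coordPhase h 0 ξ * conj (coordPhase h 1 ξ) := by
    rw [hc, coordPhase, ← Complex.exp_add, phase_eq]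
    congr 1; simp; ring
  have e2 : phase h ![1, 0] ξ = coordPhase h 0 ξ := by
    rw [coordPhase, phase_eq]
    congr 1; simp
  have e3 : phase h ![-1, 1] ξ = conj (coordPhase h 0 ξ) * coordPhase h 1 ξ := by
    rw [hc, coordPhase, ← Complex.exp_add, phase_eq]
    congr 1; simp; ring
  have e4 : phase h ![0, 1] ξ = coordPhase h 1 ξ := by
    rw [coordPhase, phase_eq]
    congr 1; simp
  have e5 : phase h ![-1, 0] ξ = conj (coordPhase h 0 ξ) := by
    rw [hc, phase_eq]
    congr 1; simp
  have e6 : phase h ![0, -1] ξ = conj (coordPhase h 1 ξ) := by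
    rw [hc, phase_eq]
    congr 1; simp
  ext j
  simp only [symbol, Fin.sum_univ_succ, bondEntry, bond, entry, _root_.sub_apply,
    _root_.smul_apply, ContinuousLinearMap.id_apply]
  fin_cases j <;> simp [e0, e1, e2, e3, e4, e5, e6] <;> ring

/-- The energy of one frequency. -/
def energy (h : ℝ) (ξ : Plane) (a : Cell) : ℝ :=
  1 / 4 * (‖a 0 - a 1‖ ^ 2 + ‖a 0 - coordPhase h 0 ξ * conj (coordPhase h 1 ξ) * a 1‖ ^ 2
    + ‖a 0 - a 2‖ ^ 2 + ‖a 0 - coordPhase h 0 ξ * a 2‖ ^ 2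
    + ‖a 1 - a 2‖ ^ 2 + ‖a 1 - coordPhase h 1 ξ * a 2‖ ^ 2)

/-- Summation by parts on a graph of degree four: the form of `1 - Δ` is a quarter of the sum of
`|difference|²` over the undirected bonds, of which each cell has six. The coefficients below use
only that both coordinate phases are unimodular. -/
theorem inner_symbol (h : ℝ) (ξ : Plane) (a : Cell) :
    inner ℂ a (symbol h ξ a) = (energy h ξ a : ℂ) := by
  have hn : ∀ w : ℂ, ((‖w‖ ^ 2 : ℝ) : ℂ) = w * conj w := by
    intro w
    rw [Complex.mul_conj, Complex.normSq_eq_norm_sq]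
  have hα := coordPhase_mul_conj h 0 ξ
  have hβ := coordPhase_mul_conj h 1 ξ
  rw [symbol_apply, energy]
  simp only [PiLp.inner_apply, Fin.sum_univ_three, RCLike.inner_apply]
  rw [Complex.ofReal_mul]
  simp only [Complex.ofReal_add, hn, map_sub, map_mul, Complex.conj_conj]
  simp
  generalize coordPhase h 0 ξ = α at *
  generalize coordPhase h 1 ξ = β at *
  linear_combination (-(1 / 4) * (a 1 * conj (a 1)) * (β * conj β) - 1 / 4 * (a 2 * conj (a 2))) * hα
    + (-(1 / 4) * (a 1 * conj (a 1)) - 1 / 4 * (a 2 * conj (a 2))) * hβ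

end
end Kagome

namespace Kagome
noncomputable section
open scoped FourierTransform ComplexConjugate

/-! ### Solvability of the lattice equation -/

theorem norm_meshMul_le {W : Plane → ℝ} {C : ℝ} (hC : ∀ x, |W x| ≤ C) (h : ℝ) (n : Fin 2 → ℤ) :
    ‖(W (meshPoint h n) : ℂ) • ContinuousLinearMap.id ℂ Cell‖ ≤ C := by
  rw [norm_smul, Complex.norm_real, Real.norm_eq_abs]
  exact (mul_le_of_le_one_right (abs_nonneg _) ContinuousLinearMap.norm_id_le).trans (hC _)

/-- The operator `-Δ_{disc,h} + V_{disc,h} - z`. -/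
def latOp (h : ℝ) {W : Plane → ℝ} {C : ℝ} (hC : ∀ x, |W x| ≤ C) (z : ℂ) :
    L2Lattice →L[ℂ] L2Lattice :=
  hamOp h + shiftOp 0 (norm_meshMul_le hC h) - z • ContinuousLinearMap.id ℂ L2Lattice

theorem latOp_apply (h : ℝ) {W : Plane → ℝ} {C : ℝ} (hC : ∀ x, |W x| ≤ C) (z : ℂ)
    (u : L2Lattice) (n : Fin 2 → ℤ) :
    latOp h hC z u n = hamiltonian h u n + (W (meshPoint h n) : ℂ) • u n - z • u n := by
  rw [← hamOp_apply]
  simp only [latOp, _root_.sub_apply, _root_.add_apply, _root_.smul_apply,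
    ContinuousLinearMap.id_apply, lp.coeFn_sub, lp.coeFn_add, lp.coeFn_smul, Pi.sub_apply,
    Pi.add_apply, Pi.smul_apply, shiftOp_apply, add_zero]

/-- The operator is diagonalised with mesh `1`, an arbitrary choice since every `synth` is an
isometry and every symbol has a real form. -/
theorem inner_hamOp_im {h : ℝ} (u : L2Lattice) : (inner ℂ u (hamOp h u)).im = 0 := by
  have h1 := (synth one_pos).inner_map_map u (hamOp h u)
  rw [← h1, L2.inner_def]
  have h2 : ∀ᵐ ξ ∂(volume : Measure Plane), inner ℂ (synth one_pos u ξ) (synth one_pos (hamOp h u) ξ)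
      = (((h ^ 2)⁻¹ * energy 1 ξ (synth one_pos u ξ) : ℝ) : ℂ) := by
    filter_upwards [synth_hamOp one_pos h u] with ξ hξ
    rw [hξ, inner_smul_right, inner_symbol]
    push_cast
    ring
  rw [integral_congr_ae h2, integral_complex_ofReal, Complex.ofReal_im]

theorem inner_meshMul_im (h : ℝ) {W : Plane → ℝ} {C : ℝ} (hC : ∀ x, |W x| ≤ C) (u : L2Lattice) :
    (inner ℂ u (shiftOp 0 (norm_meshMul_le hC h) u)).im = 0 := by
  rw [lp.inner_eq_tsum]
  have h1 : ∀ n, inner ℂ (u n) (shiftOp 0 (norm_meshMul_le hC h) u n)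
      = ((W (meshPoint h n) * ‖u n‖ ^ 2 : ℝ) : ℂ) := by
    intro n
    rw [shiftOp_apply, add_zero, _root_.smul_apply, ContinuousLinearMap.id_apply,
      inner_smul_right, inner_self_eq_norm_sq_to_K]
    push_cast
    rfl
  simp_rw [h1]
  rw [← Complex.ofReal_tsum, Complex.ofReal_im]

/-- The Laplacian and the real potential have real quadratic forms, so the imaginary part of the
form is `-Im z ‖u‖²`. This gives invertibility and a stability constant `1 / |Im z|`, independent of
`h`. -/
theorem norm_sq_le_inner_latOp (h : ℝ) {W : Plane → ℝ} {C : ℝ} (hC : ∀ x, |W x| ≤ C) (z : ℂ)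
    (u : L2Lattice) : ‖u‖ ^ 2 * |z.im| ≤ ‖inner ℂ u (latOp h hC z u)‖ := by
  have h1 : (inner ℂ u (latOp h hC z u)).im = - (z.im * ‖u‖ ^ 2) := by
    have h0 := inner_meshMul_im h hC u
    rw [latOp, _root_.sub_apply, _root_.add_apply, inner_sub_right, inner_add_right,
      Complex.sub_im, Complex.add_im, inner_hamOp_im, h0, _root_.smul_apply,
      ContinuousLinearMap.id_apply, inner_smul_right, inner_self_eq_norm_sq_to_K]
    have : ((‖u‖ : ℂ) ^ 2) = ((‖u‖ ^ 2 : ℝ) : ℂ) := by push_cast; rfl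
    simp only [Complex.coe_algebraMap, this, Complex.im_mul_ofReal]
    ring
  have h2 := Complex.abs_im_le_norm (inner ℂ u (latOp h hC z u))
  rw [h1, abs_neg, abs_mul, abs_of_nonneg (sq_nonneg ‖u‖)] at h2
  linarith

theorem norm_le_latOp (h : ℝ) {W : Plane → ℝ} {C : ℝ} (hC : ∀ x, |W x| ≤ C) (z : ℂ)
    (u : L2Lattice) : |z.im| * ‖u‖ ≤ ‖latOp h hC z u‖ := by
  rcases eq_or_ne u 0 with rfl | hu
  · simp
  have hu' := norm_pos_iff.2 hu
  have h1 := (norm_sq_le_inner_latOp h hC z u).trans (norm_inner_le_norm _ _)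
  refine le_of_mul_le_mul_left ?_ hu'
  linarith

theorem isUnit_latOp (h : ℝ) {W : Plane → ℝ} {C : ℝ} (hC : ∀ x, |W x| ≤ C) {z : ℂ}
    (hz : z.im ≠ 0) : IsUnit (latOp h hC z) :=
  ContinuousLinearMap.isUnit_of_forall_le_norm_inner_map _ (c := ⟨|z.im|, abs_nonneg _⟩)
    (show (0 : ℝ) < |z.im| from abs_pos.2 hz) fun u => by
      rw [norm_inner_symm]
      exact norm_sq_le_inner_latOp h hC z u

theorem existsUnique_latticeSolution (h : ℝ) {W : Plane → ℝ} {C : ℝ} (hC : ∀ x, |W x| ≤ C) {z : ℂ}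
    (hz : z.im ≠ 0) {f : Plane → Cell} (hf : Memℓp (sample h f) 2) :
    ∃! u : (Fin 2 → ℤ) → Cell, IsLatticeSolution h W z f u := by
  obtain ⟨u, hu⟩ := ((ContinuousLinearMap.isUnit_iff_bijective).1 (isUnit_latOp h hC hz)).2 ⟨_, hf⟩
  refine ⟨u, ⟨lp.memℓp u, fun n => ?_⟩, ?_⟩
  · rw [← latOp_apply h hC, hu]; rfl
  · rintro w ⟨hw, hw'⟩
    have h1 : latOp h hC z ⟨w, hw⟩ = ⟨_, hf⟩ := by
      ext1
      funext n
      rw [latOp_apply h hC]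
      exact hw' n
    have h2 := ((ContinuousLinearMap.isUnit_iff_bijective).1 (isUnit_latOp h hC hz)).1
      (h1.trans hu.symm)
    exact congrArg (fun x : L2Lattice => (x : (Fin 2 → ℤ) → Cell)) h2

/-- The stability estimate for the lattice equation. -/
theorem norm_spec_le_of_solution {h : ℝ} (hh : 0 < h) {W : Plane → ℝ} {C : ℝ}
    (hC : ∀ x, |W x| ≤ C) {z : ℂ} {k u : (Fin 2 → ℤ) → Cell} (hu : Memℓp u 2)
    (hk : ∀ n, hamiltonian h u n + (W (meshPoint h n) : ℂ) • u n - z • u n = k n) :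
    |z.im| * ‖spec h u‖ ≤ ‖spec h k‖ := by
  have h1 : (latOp h hC z ⟨u, hu⟩ : (Fin 2 → ℤ) → Cell) = k := by
    funext n
    rw [latOp_apply h hC]
    exact hk n
  have h0 : Memℓp k 2 := by
    have := lp.memℓp (latOp h hC z ⟨u, hu⟩)
    rwa [h1] at this
  have h3 : latOp h hC z ⟨u, hu⟩ = ⟨k, h0⟩ := Subtype.ext h1
  have h2 := norm_le_latOp h hC z ⟨u, hu⟩
  rw [h3] at h2
  rw [norm_spec hh hu, norm_spec hh h0]
  nlinarith

/-- On the Fourier side `-Δ_{disc,h} - z` is a multiplication. -/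
theorem spec_hamiltonian {h : ℝ} (hh : 0 < h) (z : ℂ) {u : (Fin 2 → ℤ) → Cell}
    (hu : Memℓp u 2) :
    spec h (fun n => hamiltonian h u n - z • u n) =ᵐ[volume] fun ξ =>
      ((h ^ 2 : ℝ) : ℂ)⁻¹ • symbol (2 * Real.pi * h) ξ (spec h u ξ) - z • spec h u ξ := by
  have h1 : (fun n => hamiltonian h u n - z • u n)
      = (hamOp h ⟨u, hu⟩ - z • (⟨u, hu⟩ : L2Lattice) : L2Lattice) := by
    funext n
    rw [lp.coeFn_sub, Pi.sub_apply, hamOp_apply]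
    rfl
  have h2 := spec_eq hh ⟨u, hu⟩
  have h3 := spec_eq hh (hamOp h ⟨u, hu⟩ - z • (⟨u, hu⟩ : L2Lattice))
  rw [h1, h3, h2, map_sub, map_smul]
  filter_upwards [synth_hamOp (two_pi_mul_pos hh) h ⟨u, hu⟩,
    Lp.coeFn_smul (h : ℂ) (synth (two_pi_mul_pos hh) ⟨u, hu⟩),
    Lp.coeFn_smul (h : ℂ) (synth (two_pi_mul_pos hh) (hamOp h ⟨u, hu⟩)
      - z • synth (two_pi_mul_pos hh) ⟨u, hu⟩),
    Lp.coeFn_sub (synth (two_pi_mul_pos hh) (hamOp h ⟨u, hu⟩))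
      (z • synth (two_pi_mul_pos hh) ⟨u, hu⟩),
    Lp.coeFn_smul z (synth (two_pi_mul_pos hh) ⟨u, hu⟩)] with ξ h4 h5 h6 h7 h8
  rw [h5, h6, Pi.smul_apply, Pi.smul_apply, h7, Pi.sub_apply, h8, Pi.smul_apply, h4, map_smul,
    smul_sub]
  congr 1
  · rw [smul_comm]
  · rw [smul_comm]

end
end Kagome

namespace Kagome
noncomputable section
open scoped FourierTransform ComplexConjugate

/-! ### Resolvents of matrices with real quadratic form -/

theorem norm_sq_le_inner_sub_smul {T : Cell →L[ℂ] Cell} {e : Cell → ℝ}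
    (hT : ∀ a, inner ℂ a (T a) = (e a : ℂ)) {z : ℂ} (a : Cell) :
    ‖a‖ ^ 2 * |z.im| ≤ ‖inner ℂ a ((T - z • ContinuousLinearMap.id ℂ Cell) a)‖ := by
  have h1 : (inner ℂ a ((T - z • ContinuousLinearMap.id ℂ Cell) a)).im = - (z.im * ‖a‖ ^ 2) := by
    rw [_root_.sub_apply, inner_sub_right, hT, Complex.sub_im, Complex.ofReal_im,
      _root_.smul_apply, ContinuousLinearMap.id_apply, inner_smul_right,
      inner_self_eq_norm_sq_to_K]
    have : ((‖a‖ : ℂ) ^ 2) = ((‖a‖ ^ 2 : ℝ) : ℂ) := by push_cast; rfl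
    simp only [Complex.coe_algebraMap, this, Complex.im_mul_ofReal]
    ring
  have h2 := Complex.abs_im_le_norm (inner ℂ a ((T - z • ContinuousLinearMap.id ℂ Cell) a))
  rw [h1, abs_neg, abs_mul, abs_of_nonneg (sq_nonneg ‖a‖)] at h2
  linarith

theorem isUnit_sub_smul {T : Cell →L[ℂ] Cell} {e : Cell → ℝ}
    (hT : ∀ a, inner ℂ a (T a) = (e a : ℂ)) {z : ℂ} (hz : z.im ≠ 0) : IsUnit (T - z • ContinuousLinearMap.id ℂ Cell) :=
  ContinuousLinearMap.isUnit_of_forall_le_norm_inner_map _ (c := ⟨|z.im|, abs_nonneg _⟩)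
    (show (0 : ℝ) < |z.im| from abs_pos.2 hz) fun a => by
      rw [norm_inner_symm]
      exact norm_sq_le_inner_sub_smul hT a

theorem norm_le_sub_smul {T : Cell →L[ℂ] Cell} {e : Cell → ℝ}
    (hT : ∀ a, inner ℂ a (T a) = (e a : ℂ)) {z : ℂ} (a : Cell) :
    |z.im| * ‖a‖ ≤ ‖(T - z • ContinuousLinearMap.id ℂ Cell) a‖ := by
  rcases eq_or_ne a 0 with rfl | ha
  · simp
  have ha' := norm_pos_iff.2 ha
  have h1 := (norm_sq_le_inner_sub_smul hT (z := z) a).trans (norm_inner_le_norm _ _)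
  refine le_of_mul_le_mul_left ?_ ha'
  linarith

/-- Write `e a = ⟨a, (T - z) a⟩ + z ‖a‖²` and absorb the last term by the bound `|Im z| ‖a‖ ≤ ‖(T -
z) a‖`. A lower bound for the form thereby becomes decay of the resolvent. -/
theorem coercive_le_sub_smul {T : Cell →L[ℂ] Cell} {e : Cell → ℝ}
    (hT : ∀ a, inner ℂ a (T a) = (e a : ℂ)) {z : ℂ} (hz : z.im ≠ 0) {c : ℝ} {a : Cell} (hc : c * ‖a‖ ^ 2 ≤ e a) :
    c * ‖a‖ ≤ (1 + ‖z‖ / |z.im|) * ‖(T - z • ContinuousLinearMap.id ℂ Cell) a‖ := by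
  rcases eq_or_ne a 0 with rfl | ha
  · simp
  have ha' := norm_pos_iff.2 ha
  have hz' := abs_pos.2 hz
  have h0 := norm_le_sub_smul hT (z := z) a
  have h1 : (e a : ℂ) = inner ℂ a ((T - z • ContinuousLinearMap.id ℂ Cell) a)
      + z * inner ℂ a a := by
    rw [← hT, ← inner_smul_right, ← inner_add_right]
    congr 1
    simp
  have h2 : e a ≤ ‖a‖ * ‖(T - z • ContinuousLinearMap.id ℂ Cell) a‖ + ‖z‖ * (‖a‖ * ‖a‖) := by
    calc e a ≤ ‖(e a : ℂ)‖ := by rw [Complex.norm_real]; exact le_abs_self _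
      _ ≤ _ := by
        rw [h1]
        refine (norm_add_le _ _).trans (add_le_add (norm_inner_le_norm _ _) ?_)
        rw [norm_mul]
        gcongr
        exact norm_inner_le_norm _ _
  have h3 : c * ‖a‖ ≤ ‖(T - z • ContinuousLinearMap.id ℂ Cell) a‖ + ‖z‖ * ‖a‖ := by
    refine le_of_mul_le_mul_left ?_ ha'
    linarith
  have h4 : ‖z‖ * ‖a‖ ≤ ‖z‖ / |z.im| * ‖(T - z • ContinuousLinearMap.id ℂ Cell) a‖ := by
    rw [div_mul_eq_mul_div, le_div_iff₀ hz']
    nlinarith [norm_nonneg z]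
  linarith

/-! ### The resolvent of the symbol -/

/-- The symbol of `-Δ_{disc,h} - z`. -/
def symbolSub (h : ℝ) (z : ℂ) (ζ : Plane) : Cell →L[ℂ] Cell :=
  ((h ^ 2 : ℝ) : ℂ)⁻¹ • symbol (2 * Real.pi * h) ζ - z • ContinuousLinearMap.id ℂ Cell

/-- Its inverse. -/
def symbolRes (h : ℝ) (z : ℂ) (ζ : Plane) : Cell →L[ℂ] Cell := Ring.inverse (symbolSub h z ζ)

theorem inner_scaled_symbol (h : ℝ) (ζ : Plane) (a : Cell) :
    inner ℂ a ((((h ^ 2 : ℝ) : ℂ)⁻¹ • symbol (2 * Real.pi * h) ζ) a)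
      = (((h ^ 2)⁻¹ * energy (2 * Real.pi * h) ζ a : ℝ) : ℂ) := by
  rw [_root_.smul_apply, inner_smul_right, inner_symbol]
  push_cast
  ring

theorem isUnit_symbolSub (h : ℝ) {z : ℂ} (hz : z.im ≠ 0) (ζ : Plane) : IsUnit (symbolSub h z ζ) :=
  isUnit_sub_smul (inner_scaled_symbol h ζ) hz

theorem norm_le_symbolSub (h : ℝ) (z : ℂ) (ζ : Plane) (a : Cell) :
    |z.im| * ‖a‖ ≤ ‖symbolSub h z ζ a‖ :=
  norm_le_sub_smul (inner_scaled_symbol h ζ) a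

theorem symbolSub_symbolRes (h : ℝ) {z : ℂ} (hz : z.im ≠ 0) (ζ : Plane) (b : Cell) :
    symbolSub h z ζ (symbolRes h z ζ b) = b :=
  congrArg (fun S : Cell →L[ℂ] Cell => S b) (Ring.mul_inverse_cancel _ (isUnit_symbolSub h hz ζ))

theorem symbolRes_symbolSub (h : ℝ) {z : ℂ} (hz : z.im ≠ 0) (ζ : Plane) (b : Cell) :
    symbolRes h z ζ (symbolSub h z ζ b) = b :=
  congrArg (fun S : Cell →L[ℂ] Cell => S b) (Ring.inverse_mul_cancel _ (isUnit_symbolSub h hz ζ))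

theorem norm_symbolRes_apply_le (h : ℝ) {z : ℂ} (hz : z.im ≠ 0) (ζ : Plane) (b : Cell) :
    |z.im| * ‖symbolRes h z ζ b‖ ≤ ‖b‖ := by
  have h1 := norm_le_symbolSub h z ζ (symbolRes h z ζ b)
  rwa [symbolSub_symbolRes h hz] at h1

theorem continuous_symbolRes (h : ℝ) {z : ℂ} (hz : z.im ≠ 0) : Continuous (symbolRes h z) := by
  have h1 : Continuous (symbolSub h z) := by
    unfold symbolSub
    have := continuous_symbol (2 * Real.pi * h)
    fun_prop
  refine continuous_iff_continuousAt.2 fun ζ => ?_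
  have hu : IsUnit (symbolSub h z ζ) := isUnit_symbolSub h hz ζ
  obtain ⟨x, hx⟩ := hu
  have h2 := NormedRing.inverse_continuousAt x
  rw [hx] at h2
  exact ContinuousAt.comp (f := symbolSub h z) h2 h1.continuousAt

/-- The modulus of `1 - e^{iη}` is `2 |sin (η / 2)|`, and Jordan's inequality bounds the sine below
on the half period that the torus allows. -/
theorem sq_le_norm_one_sub_exp {η : ℝ} (hη : |η| ≤ Real.pi) :
    4 * η ^ 2 ≤ Real.pi ^ 2 * ‖1 - Complex.exp (Complex.I * η)‖ ^ 2 := by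
  have h1 : ‖1 - Complex.exp (Complex.I * η)‖ = ‖2 * Real.sin (η / 2)‖ := by
    rw [norm_sub_rev]
    exact Complex.norm_exp_I_mul_ofReal_sub_one η
  have h2 := Real.mul_abs_le_abs_sin (x := η / 2) (by rw [abs_div, abs_two]; linarith)
  rw [h1, Real.norm_eq_abs, sq_abs, mul_pow]
  have h3 : (2 / Real.pi * |η / 2|) ^ 2 ≤ |Real.sin (η / 2)| ^ 2 := by gcongr
  rw [sq_abs, mul_pow, sq_abs] at h3
  have hp := Real.pi_pos
  have h4 : (2 / Real.pi) ^ 2 * (η / 2) ^ 2 = η ^ 2 / Real.pi ^ 2 := by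
    field_simp
  rw [h4, div_le_iff₀ (by positivity)] at h3
  linarith

/-- Two sites are joined by two bonds, with terms `x - y` and `x - γ y`. Their combinations give `(1
- γ) x` and `(1 - γ) y`. Thus `α` controls `a 0` and `a 2`, and `β` controls `a 1` and `a 2`; the
two missing products are reached by comparison with `a 2` along an ungauged bond (`key2`). -/
theorem energy_coercive (h : ℝ) (ξ : Plane) (a : Cell) :
    (‖1 - coordPhase h 0 ξ‖ ^ 2 + ‖1 - coordPhase h 1 ξ‖ ^ 2) * ‖a‖ ^ 2
      ≤ 64 * energy h ξ a := by
  have hα : ‖coordPhase h 0 ξ‖ = 1 := norm_exp_I_mul _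
  have hβ : ‖coordPhase h 1 ξ‖ = 1 := norm_exp_I_mul _
  rw [energy]
  generalize coordPhase h 0 ξ = α at *
  generalize coordPhase h 1 ξ = β at *
  have hsq : ∀ x y : ℂ, ‖x + y‖ ^ 2 ≤ 2 * (‖x‖ ^ 2 + ‖y‖ ^ 2) := fun x y =>
    (pow_le_pow_left₀ (norm_nonneg _) (norm_add_le x y) 2).trans add_sq_le
  have key : ∀ γ x y : ℂ, ‖γ‖ = 1 →
      ‖1 - γ‖ ^ 2 * ‖x‖ ^ 2 ≤ 2 * (‖x - y‖ ^ 2 + ‖x - γ * y‖ ^ 2) ∧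
      ‖1 - γ‖ ^ 2 * ‖y‖ ^ 2 ≤ 2 * (‖x - y‖ ^ 2 + ‖x - γ * y‖ ^ 2) := by
    intro γ x y hγ
    constructor
    · have := hsq (-(γ * (x - y))) (x - γ * y)
      rw [norm_neg, norm_mul, hγ, one_mul] at this
      rw [← mul_pow, ← norm_mul]
      convert! this using 3
      ring
    · have := hsq (-(x - y)) (x - γ * y)
      rw [norm_neg] at this
      rw [← mul_pow, ← norm_mul]
      convert! this using 3
      ring
  have key2 : ∀ γ x y : ℂ, ‖γ‖ = 1 →
      ‖1 - γ‖ ^ 2 * ‖x‖ ^ 2 ≤ 8 * ‖x - y‖ ^ 2 + 2 * (‖1 - γ‖ ^ 2 * ‖y‖ ^ 2) := by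
    intro γ x y hγ
    have h1 := hsq ((1 - γ) * (x - y)) ((1 - γ) * y)
    have h2 : ‖1 - γ‖ ≤ 2 := by
      have := norm_sub_le 1 γ
      rw [norm_one, hγ] at this
      linarith
    have h3 : ‖1 - γ‖ ^ 2 * ‖x - y‖ ^ 2 ≤ 2 ^ 2 * ‖x - y‖ ^ 2 := by gcongr
    rw [norm_mul, norm_mul, mul_pow, mul_pow] at h1
    have h4 : ‖1 - γ‖ ^ 2 * ‖x‖ ^ 2 = ‖(1 - γ) * (x - y) + (1 - γ) * y‖ ^ 2 := by
      rw [← mul_pow, ← norm_mul]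
      congr 2; ring
    rw [h4]
    linarith
  have e1 := key α (a 0) (a 2) hα
  have e2 := key β (a 1) (a 2) hβ
  have e3 := key2 α (a 1) (a 2) hα
  have e4 := key2 β (a 0) (a 2) hβ
  rw [EuclideanSpace.norm_sq_eq, Fin.sum_univ_three]
  have p1 := sq_nonneg ‖a 0 - a 1‖
  have p2 := sq_nonneg ‖a 0 - α * conj β * a 1‖
  have p3 := sq_nonneg ‖a 0 - α * a 2‖
  have p4 := sq_nonneg ‖a 1 - β * a 2‖
  -- The inequalities add up to at most `16` times the sum of the four bond terms ending at `a 2`;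
  -- the factor `1 / 4` in the energy turns this into `64`.
  linarith [e1.1, e1.2, e2.1, e2.2]

theorem norm_sq_le_energy {h : ℝ} (hh : 0 < h) {ζ : Plane} (hζ : ζ ∈ torus (2 * Real.pi * h))
    (a : Cell) : 1 / 4 * ‖ζ‖ ^ 2 * ‖a‖ ^ 2 ≤ (h ^ 2)⁻¹ * energy (2 * Real.pi * h) ζ a := by
  have hk := two_pi_mul_pos hh
  have h1 : ∀ j, 4 * (2 * Real.pi * h * ζ j) ^ 2
      ≤ Real.pi ^ 2 * ‖1 - coordPhase (2 * Real.pi * h) j ζ‖ ^ 2 := by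
    intro j
    refine sq_le_norm_one_sub_exp ?_
    rw [abs_mul, abs_of_pos hk, mul_comm, ← le_div_iff₀ hk]
    exact abs_le.2 (hζ j)
  have h2 := energy_coercive (2 * Real.pi * h) ζ a
  have h3 : ‖ζ‖ ^ 2 = ζ 0 ^ 2 + ζ 1 ^ 2 := by
    rw [EuclideanSpace.norm_sq_eq, Fin.sum_univ_two, Real.norm_eq_abs, Real.norm_eq_abs, sq_abs,
      sq_abs]
  -- From `4 (2πhζ_j)² / π² = 16 h² ζ_j²`. Divided by the `64` of `energy_coercive` this yields the
  -- constant `1 / 4`.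
  have h4 : 16 * h ^ 2 * ‖ζ‖ ^ 2
      ≤ ‖1 - coordPhase (2 * Real.pi * h) 0 ζ‖ ^ 2 + ‖1 - coordPhase (2 * Real.pi * h) 1 ζ‖ ^ 2 := by
    have hp : 0 < Real.pi ^ 2 := by positivity
    refine le_of_mul_le_mul_left ?_ hp
    rw [h3]
    nlinarith [h1 0, h1 1]
  have h5 := (mul_le_mul_of_nonneg_right h4 (sq_nonneg ‖a‖)).trans h2
  rw [inv_mul_eq_div, le_div_iff₀ (by positivity)]
  linarith

theorem norm_sq_mul_le_symbolSub {h : ℝ} (hh : 0 < h) {z : ℂ} (hz : z.im ≠ 0) {ζ : Plane}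
    (hζ : ζ ∈ torus (2 * Real.pi * h)) (a : Cell) :
    1 / 4 * ‖ζ‖ ^ 2 * ‖a‖ ≤ (1 + ‖z‖ / |z.im|) * ‖symbolSub h z ζ a‖ :=
  coercive_le_sub_smul (inner_scaled_symbol h ζ) hz (norm_sq_le_energy hh hζ a)

/-- The constant in the resolvent bound. -/
def resConst (z : ℂ) : ℝ := 1 / |z.im| + 4 * (1 + ‖z‖ / |z.im|)

theorem resConst_nonneg (z : ℂ) : 0 ≤ resConst z := by unfold resConst; positivity

theorem weight_mul_norm_symbolRes_le {h : ℝ} (hh : 0 < h) {z : ℂ} (hz : z.im ≠ 0) {ζ : Plane}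
    (hζ : ζ ∈ torus (2 * Real.pi * h)) (b : Cell) :
    weight 2 ζ * ‖symbolRes h z ζ b‖ ≤ resConst z * ‖b‖ := by
  have hz' := abs_pos.2 hz
  have h1 := norm_symbolRes_apply_le h hz ζ b
  have h2 := norm_sq_mul_le_symbolSub hh hz hζ (symbolRes h z ζ b)
  rw [symbolSub_symbolRes h hz] at h2
  rw [weight_two, resConst]
  have h3 : ‖symbolRes h z ζ b‖ ≤ 1 / |z.im| * ‖b‖ := by
    rw [one_div, inv_mul_eq_div, le_div_iff₀ hz']
    linarith
  linarith

end
end Kagome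

namespace Kagome
noncomputable section
open scoped FourierTransform ComplexConjugate

/-! ### The limit of the resolvents at a fixed frequency -/

/-- The symbol of the limit operator, in the normalization of Mathlib. -/
def limitSymbol (ζ : Plane) : ℝ :=
  Real.pi ^ 2 / 3 * (ζ 0 ^ 2 - ζ 0 * ζ 1 + ζ 1 ^ 2)

theorem limitSymbol_nonneg (ζ : Plane) : 0 ≤ limitSymbol ζ := by
  unfold limitSymbol
  have : 0 ≤ ζ 0 ^ 2 - ζ 0 * ζ 1 + ζ 1 ^ 2 := by
    nlinarith [sq_nonneg (ζ 0 - ζ 1), sq_nonneg (ζ 0), sq_nonneg (ζ 1)]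
  positivity

theorem norm_sq_le_limitSymbol (ζ : Plane) : ‖ζ‖ ^ 2 ≤ limitSymbol ζ := by
  rw [EuclideanSpace.norm_sq_eq, Fin.sum_univ_two, Real.norm_eq_abs, Real.norm_eq_abs, sq_abs,
    sq_abs, limitSymbol]
  have h1 : 3 ≤ Real.pi ^ 2 / 3 := by nlinarith [Real.pi_gt_three]
  have h2 : 0 ≤ ζ 0 ^ 2 - ζ 0 * ζ 1 + ζ 1 ^ 2 := by
    nlinarith [sq_nonneg (ζ 0 - ζ 1), sq_nonneg (ζ 0), sq_nonneg (ζ 1)]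
  nlinarith [mul_le_mul_of_nonneg_right h1 h2, sq_nonneg (ζ 0 - ζ 1)]

theorem continuous_limitSymbol : Continuous limitSymbol := by
  unfold limitSymbol; fun_prop

theorem limitSymbol_sub_ne_zero {z : ℂ} (hz : z.im ≠ 0) (ζ : Plane) :
    (limitSymbol ζ : ℂ) - z ≠ 0 := by
  intro h
  have := congrArg Complex.im h
  simp at this
  exact hz this

/-- `Π₀` as a continuous linear map. -/
def bottomCLM : Cell →L[ℂ] Cell :=
  LinearMap.toContinuousLinearMap
    { toFun := bottomProj
      map_add' := fun a b => by ext j; simp [bottomProj]; ring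
      map_smul' := fun c a => by ext j; simp [bottomProj]; ring }

theorem bottomCLM_apply (a : Cell) : bottomCLM a = bottomProj a := rfl

/-- The vector with the three gauged entries `e^{i h ξ₀ / 2} y₀`, `e^{i h ξ₁ / 2} y₁`, `y₂`. -/
def gauge (h : ℝ) (ξ : Plane) (y : Fin 3 → ℂ) : Cell :=
  !₂[Complex.exp (Complex.I * (h * ξ 0 / 2 : ℝ)) * y 0,
    Complex.exp (Complex.I * (h * ξ 1 / 2 : ℝ)) * y 1, y 2]

/-- The phases place each site at its true position, half a period from the cell origin. In this
gauge the two bonds between a pair of sites combine to a cosine, so the symbol is a real matrix even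
in `h`, and its expansion has no term of first order. -/
theorem symbol_gauge (h : ℝ) (ξ : Plane) (y : Fin 3 → ℂ) :
    symbol h ξ (gauge h ξ y) = gauge h ξ ![
      y 0 - 1 / 2 * (Real.cos (h * (ξ 0 - ξ 1) / 2) * y 1 + Real.cos (h * ξ 0 / 2) * y 2),
      y 1 - 1 / 2 * (Real.cos (h * (ξ 0 - ξ 1) / 2) * y 0 + Real.cos (h * ξ 1 / 2) * y 2),
      y 2 - 1 / 2 * (Real.cos (h * ξ 0 / 2) * y 0 + Real.cos (h * ξ 1 / 2) * y 1)] := by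
  set e0 := Complex.exp (Complex.I * (h * ξ 0 / 2 : ℝ)) with he0
  set e1 := Complex.exp (Complex.I * (h * ξ 1 / 2 : ℝ)) with he1
  have i0 : e0 * e0⁻¹ = 1 := mul_inv_cancel₀ (Complex.exp_ne_zero _)
  have i1 : e1 * e1⁻¹ = 1 := mul_inv_cancel₀ (Complex.exp_ne_zero _)
  have p0 : coordPhase h 0 ξ = e0 ^ 2 := by
    rw [coordPhase, he0, ← Complex.exp_nat_mul]; congr 1; push_cast; ring
  have p1 : coordPhase h 1 ξ = e1 ^ 2 := by
    rw [coordPhase, he1, ← Complex.exp_nat_mul]; congr 1; push_cast; ring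
  have c0 : conj (coordPhase h 0 ξ) = e0⁻¹ ^ 2 := by
    have := coordPhase_mul_conj h 0 ξ
    rw [p0] at this ⊢
    rw [inv_pow]
    exact eq_inv_of_mul_eq_one_right this
  have c1 : conj (coordPhase h 1 ξ) = e1⁻¹ ^ 2 := by
    have := coordPhase_mul_conj h 1 ξ
    rw [p1] at this ⊢
    rw [inv_pow]
    exact eq_inv_of_mul_eq_one_right this
  have q0 : (Real.cos (h * ξ 0 / 2) : ℂ) = (e0 + e0⁻¹) / 2 := by
    rw [Complex.ofReal_cos, Complex.cos, he0, ← Complex.exp_neg]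
    congr 3
    · rw [mul_comm]
    · rw [mul_comm, mul_neg]
  have q1 : (Real.cos (h * ξ 1 / 2) : ℂ) = (e1 + e1⁻¹) / 2 := by
    rw [Complex.ofReal_cos, Complex.cos, he1, ← Complex.exp_neg]
    congr 3
    · rw [mul_comm]
    · rw [mul_comm, mul_neg]
  have q2 : (Real.cos (h * (ξ 0 - ξ 1) / 2) : ℂ) = (e0 * e1⁻¹ + e0⁻¹ * e1) / 2 := by
    rw [Complex.ofReal_cos, Complex.cos, he0, he1, ← Complex.exp_neg, ← Complex.exp_neg,
      ← Complex.exp_add, ← Complex.exp_add]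
    congr 3 <;> · push_cast; ring
  rw [symbol_apply, c0, c1, p0, p1, q0, q1, q2]
  simp only [gauge, ← he0, ← he1]
  generalize e0⁻¹ = f0 at *
  generalize e1⁻¹ = f1 at *
  generalize e0 = g0 at *
  generalize e1 = g1 at *
  ext j
  fin_cases j
  · simp
    linear_combination (-(1 / 4) * (g0 * g0 * f1 * y 1)) * i1 + (1 / 4 * (g1 * y 1 + y 2)) * i0
  · simp
    linear_combination (1 / 4 * (g0 * y 0 + y 2)) * i1 - (1 / 4 * (f0 * g1 ^ 2 * y 0)) * i0
  · simp
    linear_combination (1 / 4 * (f0 * y 0)) * i0 + (1 / 4 * (f1 * y 1)) * i1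

theorem tendsto_one_sub_cos (x : ℝ) :
    Tendsto (fun h : ℝ => (h ^ 2)⁻¹ * (1 - Real.cos (h * x))) (𝓝[>] 0) (𝓝 (x ^ 2 / 2)) := by
  have h1 : HasDerivAt (fun h : ℝ => Real.sin (h * (x / 2))) (x / 2) 0 := by
    have := ((hasDerivAt_id (0 : ℝ)).mul_const (x / 2)).sin
    simpa using this
  have h2 := (hasDerivAt_iff_tendsto_slope_zero.1 h1).mono_left (nhdsGT_le_nhdsNE 0)
  have h3 := (h2.pow 2).const_mul 2
  have e : 2 * (x / 2) ^ 2 = x ^ 2 / 2 := by ring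
  rw [e] at h3
  refine h3.congr fun h => ?_
  have h4 : Real.cos (h * x) = 1 - 2 * Real.sin (h * (x / 2)) ^ 2 := by
    have := Real.cos_sq' (h * (x / 2))
    have h5 := Real.cos_two_mul (h * (x / 2))
    rw [show 2 * (h * (x / 2)) = h * x by ring] at h5
    linarith
  rw [h4]
  simp
  ring

/-- The pointwise limit of the resolvents of the symbol. -/
def limitRes (z : ℂ) (ζ : Plane) : Cell →L[ℂ] Cell := ((limitSymbol ζ : ℂ) - z)⁻¹ • bottomCLM

theorem smul_gauge_sub (h : ℝ) (ξ : Plane) (c d : ℂ) (y y' : Fin 3 → ℂ) :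
    c • gauge h ξ y - d • gauge h ξ y' = gauge h ξ fun j => c * y j - d * y' j := by
  ext j
  fin_cases j <;> simp [gauge] <;> ring

theorem tendsto_gauge (ξ : Plane) {y : ℝ → Fin 3 → ℂ} {a : Cell}
    (hy : ∀ j, Tendsto (fun h => y h j) (𝓝[>] 0) (𝓝 (a j))) :
    Tendsto (fun h => gauge (2 * Real.pi * h) ξ (y h)) (𝓝[>] 0) (𝓝 a) := by
  have he : ∀ x : ℝ, Tendsto (fun h : ℝ => Complex.exp (Complex.I * (2 * Real.pi * h * x / 2 : ℝ)))
      (𝓝[>] 0) (𝓝 1) := by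
    intro x
    have : Continuous fun h : ℝ => Complex.exp (Complex.I * (2 * Real.pi * h * x / 2 : ℝ)) := by
      fun_prop
    have h1 := this.tendsto 0
    simp only [mul_zero, zero_mul, zero_div, Complex.ofReal_zero, Complex.exp_zero] at h1
    exact h1.mono_left nhdsWithin_le_nhds
  have h1 : Tendsto (fun h : ℝ => ![Complex.exp (Complex.I * (2 * Real.pi * h * ξ 0 / 2 : ℝ)) * y h 0,
      Complex.exp (Complex.I * (2 * Real.pi * h * ξ 1 / 2 : ℝ)) * y h 1, y h 2]) (𝓝[>] 0)
      (𝓝 (fun j => a j)) := by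
    rw [tendsto_pi_nhds]
    intro j
    fin_cases j
    · simpa using (he (ξ 0)).mul (hy 0)
    · simpa using (he (ξ 1)).mul (hy 1)
    · simpa using hy 2
  exact ((PiLp.continuous_toLp 2 _).tendsto _).comp h1

/-- Approximate the solution by the ansatz `y_j = α + h² c_j` in the cosine gauge. The leading part
must lie in the kernel of the symbol at frequency `0`, and the corrector `c` absorbs the components
of `b` outside that kernel. The condition for `c` to exist is the equation `(P - z) α = (b₀ + b₁ +
b₂) / 3`. -/
theorem tendsto_symbolRes {z : ℂ} (hz : z.im ≠ 0) (ζ : Plane) (b : Cell) :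
    Tendsto (fun h => symbolRes h z ζ b) (𝓝[>] 0) (𝓝 (limitRes z ζ b)) := by
  set α : ℂ := ((limitSymbol ζ : ℂ) - z)⁻¹ * ((b 0 + b 1 + b 2) / 3) with hα
  have hα' : ((limitSymbol ζ : ℂ) - z) * α = (b 0 + b 1 + b 2) / 3 := by
    rw [hα, mul_inv_cancel_left₀ (limitSymbol_sub_ne_zero hz ζ)]
  -- The number `w j` is the limit of `h⁻²` times one minus the mean of the two cosines in row `j`.
  -- The three sum to `3 * limitSymbol ζ`.
  set w : Fin 3 → ℝ := ![Real.pi ^ 2 / 4 * ((ζ 0 - ζ 1) ^ 2 + ζ 0 ^ 2),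
    Real.pi ^ 2 / 4 * ((ζ 0 - ζ 1) ^ 2 + ζ 1 ^ 2), Real.pi ^ 2 / 4 * (ζ 0 ^ 2 + ζ 1 ^ 2)] with hw
  set c : Fin 3 → ℂ := fun j => 2 / 3 * (b j - α * w j + z * α) with hc
  -- With zero sum, `c j` minus half the two other entries is `3 / 2 * c j`, which explains the
  -- factor `2 / 3` in `c` and makes all three rows solvable at once.
  have hc0 : c 0 + c 1 + c 2 = 0 := by
    simp only [hc, hw, limitSymbol] at hα' ⊢
    simp
    push_cast at hα'
    linear_combination (-2) * hα'
  have key0 : α / 2 * (Real.pi ^ 2 * (ζ 0 - ζ 1 : ℝ) ^ 2 / 2 + Real.pi ^ 2 * (ζ 0 : ℝ) ^ 2 / 2)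
      + (c 0 - 1 / 2 * (1 * c 1 + 1 * c 2)) - z * α = b 0 := by
    have e0 : c 0 = 2 / 3 * (b 0 - α * w 0 + z * α) := rfl
    have e1 : (w 0 : ℂ) = Real.pi ^ 2 / 4 * ((ζ 0 - ζ 1) ^ 2 + ζ 0 ^ 2) := by simp [hw]
    rw [e1] at e0
    clear_value c α
    push_cast
    linear_combination 3 / 2 * e0 - 1 / 2 * hc0
  have key1 : α / 2 * (Real.pi ^ 2 * (ζ 0 - ζ 1 : ℝ) ^ 2 / 2 + Real.pi ^ 2 * (ζ 1 : ℝ) ^ 2 / 2)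
      + (c 1 - 1 / 2 * (1 * c 0 + 1 * c 2)) - z * α = b 1 := by
    have e0 : c 1 = 2 / 3 * (b 1 - α * w 1 + z * α) := rfl
    have e1 : (w 1 : ℂ) = Real.pi ^ 2 / 4 * ((ζ 0 - ζ 1) ^ 2 + ζ 1 ^ 2) := by simp [hw]
    rw [e1] at e0
    clear_value c α
    push_cast
    linear_combination 3 / 2 * e0 - 1 / 2 * hc0
  have key2 : α / 2 * (Real.pi ^ 2 * (ζ 0 : ℝ) ^ 2 / 2 + Real.pi ^ 2 * (ζ 1 : ℝ) ^ 2 / 2)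
      + (c 2 - 1 / 2 * (1 * c 0 + 1 * c 1)) - z * α = b 2 := by
    have e0 : c 2 = 2 / 3 * (b 2 - α * w 2 + z * α) := rfl
    have e1 : (w 2 : ℂ) = Real.pi ^ 2 / 4 * (ζ 0 ^ 2 + ζ 1 ^ 2) := by simp [hw]
    rw [e1] at e0
    clear_value c α
    push_cast
    linear_combination 3 / 2 * e0 - 1 / 2 * hc0
  set y : ℝ → Fin 3 → ℂ := fun h j => α + (h : ℂ) ^ 2 * c j with hy
  have hh0 : Tendsto (fun h : ℝ => (h : ℂ)) (𝓝[>] 0) (𝓝 0) :=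
    (Complex.continuous_ofReal.tendsto' 0 0 (by simp)).mono_left nhdsWithin_le_nhds
  have hylim : ∀ j, Tendsto (fun h => y h j) (𝓝[>] 0) (𝓝 α) := by
    intro j
    have := ((hh0.pow 2).mul_const (c j)).const_add α
    simpa [hy] using this
  have hlim : limitRes z ζ b = WithLp.toLp 2 fun _ => α := by
    ext j
    simp [limitRes, bottomCLM_apply, bottomProj, hα]
  have hx : Tendsto (fun h => gauge (2 * Real.pi * h) ζ (y h)) (𝓝[>] 0) (𝓝 (limitRes z ζ b)) := by
    rw [hlim]
    exact tendsto_gauge ζ hylim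
  have hcos : ∀ x : ℝ, Tendsto (fun h : ℝ => (Real.cos (2 * Real.pi * h * x / 2) : ℂ)) (𝓝[>] 0)
      (𝓝 1) := by
    intro x
    have : Continuous fun h : ℝ => (Real.cos (2 * Real.pi * h * x / 2) : ℂ) := by fun_prop
    exact (this.tendsto' 0 1 (by simp)).mono_left nhdsWithin_le_nhds
  have hcos2 : ∀ x : ℝ, Tendsto (fun h : ℝ => ((h : ℂ) ^ 2)⁻¹ *
      (1 - (Real.cos (2 * Real.pi * h * x / 2) : ℂ))) (𝓝[>] 0) (𝓝 (Real.pi ^ 2 * x ^ 2 / 2)) := by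
    intro x
    have h1 := (Complex.continuous_ofReal.tendsto _).comp (tendsto_one_sub_cos (Real.pi * x))
    have e : (((Real.pi * x) ^ 2 / 2 : ℝ) : ℂ) = Real.pi ^ 2 * x ^ 2 / 2 := by push_cast; ring
    rw [e] at h1
    refine h1.congr fun h => ?_
    simp only [Function.comp_apply]
    rw [show 2 * Real.pi * h * x / 2 = h * (Real.pi * x) by ring]
    push_cast; rfl
  have hrow : ∀ (x x' : ℝ) (j k l : Fin 3), Tendsto (fun h : ℝ => (((h ^ 2 : ℝ) : ℂ)⁻¹ *
      (y h j - 1 / 2 * ((Real.cos (2 * Real.pi * h * x / 2) : ℂ) * y h k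
        + (Real.cos (2 * Real.pi * h * x' / 2) : ℂ) * y h l)) - z * y h j)) (𝓝[>] 0)
      (𝓝 (α / 2 * (Real.pi ^ 2 * x ^ 2 / 2 + Real.pi ^ 2 * x' ^ 2 / 2) + (c j
        - 1 / 2 * (1 * c k + 1 * c l)) - z * α)) := by
    intro x x' j k l
    refine (((((hcos2 x).add (hcos2 x')).const_mul (α / 2)).add (((((hcos x).mul_const (c k)).add
      ((hcos x').mul_const (c l))).const_mul (1 / 2)).const_sub (c j))).sub
      ((hylim j).const_mul z)).congr' ?_
    filter_upwards [self_mem_nhdsWithin] with h hh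
    have hne : (h : ℂ) ≠ 0 := Complex.ofReal_ne_zero.2 (ne_of_gt hh)
    simp only [hy]
    push_cast
    field_simp
    ring
  have hA : Tendsto (fun h => symbolSub h z ζ (gauge (2 * Real.pi * h) ζ (y h))) (𝓝[>] 0)
      (𝓝 b) := by
    have hs : ∀ h, symbolSub h z ζ (gauge (2 * Real.pi * h) ζ (y h)) = gauge (2 * Real.pi * h) ζ
        ![((h ^ 2 : ℝ) : ℂ)⁻¹ * (y h 0 - 1 / 2 *
            (Real.cos (2 * Real.pi * h * (ζ 0 - ζ 1) / 2) * y h 1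
              + Real.cos (2 * Real.pi * h * ζ 0 / 2) * y h 2)) - z * y h 0,
          ((h ^ 2 : ℝ) : ℂ)⁻¹ * (y h 1 - 1 / 2 *
            (Real.cos (2 * Real.pi * h * (ζ 0 - ζ 1) / 2) * y h 0
              + Real.cos (2 * Real.pi * h * ζ 1 / 2) * y h 2)) - z * y h 1,
          ((h ^ 2 : ℝ) : ℂ)⁻¹ * (y h 2 - 1 / 2 *
            (Real.cos (2 * Real.pi * h * ζ 0 / 2) * y h 0
              + Real.cos (2 * Real.pi * h * ζ 1 / 2) * y h 1)) - z * y h 2] := by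
      intro h
      rw [symbolSub, _root_.sub_apply, _root_.smul_apply, _root_.smul_apply, symbol_gauge,
        ContinuousLinearMap.id_apply, smul_gauge_sub]
      congr 1
      ext j
      fin_cases j <;> rfl
    simp_rw [hs]
    refine tendsto_gauge ζ fun j => ?_
    fin_cases j
    · have := hrow (ζ 0 - ζ 1) (ζ 0) 0 1 2
      rw [key0] at this
      exact this
    · have := hrow (ζ 0 - ζ 1) (ζ 1) 1 0 2
      rw [key1] at this
      exact this
    · have := hrow (ζ 0) (ζ 1) 2 0 1
      rw [key2] at this
      exact this
  -- The error is the resolvent applied to the residual of the ansatz, and the resolvent is bounded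
  -- by `1 / |Im z|` for every `h`.
  have h1 : Tendsto (fun h => symbolRes h z ζ b - gauge (2 * Real.pi * h) ζ (y h)) (𝓝[>] 0)
      (𝓝 0) := by
    have h2 := (tendsto_const_nhds (x := b)).sub hA
    rw [sub_self] at h2
    have h3 := h2.norm.const_mul (|z.im|⁻¹)
    rw [norm_zero, mul_zero] at h3
    refine squeeze_zero_norm (fun h => ?_) h3
    have h4 := norm_symbolRes_apply_le h hz ζ
      (b - symbolSub h z ζ (gauge (2 * Real.pi * h) ζ (y h)))
    rw [map_sub, symbolRes_symbolSub h hz] at h4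
    rwa [inv_mul_eq_div, le_div_iff₀ (abs_pos.2 hz), mul_comm]
  simpa using h1.add hx

/-! ### Strong convergence of the resolvents -/

/-- The resolvent of the symbol, cut off to the torus and multiplied by `1 + |ζ|²`. -/
def resKernel (h : ℝ) (z : ℂ) : Plane → Cell →L[ℂ] Cell :=
  (torus (2 * Real.pi * h)).indicator fun ζ => (weight 2 ζ : ℂ) • symbolRes h z ζ

theorem norm_resKernel_le {h : ℝ} (hh : 0 < h) {z : ℂ} (hz : z.im ≠ 0) (ζ : Plane) :
    ‖resKernel h z ζ‖ ≤ resConst z := by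
  by_cases hζ : ζ ∈ torus (2 * Real.pi * h)
  · rw [resKernel, indicator_of_mem hζ]
    refine ContinuousLinearMap.opNorm_le_bound _ (resConst_nonneg z) fun b => ?_
    rw [_root_.smul_apply, norm_smul, Complex.norm_real, Real.norm_of_nonneg (weight_pos 2 ζ).le]
    exact weight_mul_norm_symbolRes_le hh hz hζ b
  · rw [resKernel, indicator_of_notMem hζ, norm_zero]
    exact resConst_nonneg z

theorem aestronglyMeasurable_resKernel (h : ℝ) {z : ℂ} (hz : z.im ≠ 0) :
    AEStronglyMeasurable (resKernel h z) (volume : Measure Plane) := by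
  refine AEStronglyMeasurable.indicator ?_ (measurableSet_torus _)
  exact ((Complex.continuous_ofReal.comp (continuous_weight 2)).smul
    (continuous_symbolRes h hz)).aestronglyMeasurable

theorem tendsto_resKernel {z : ℂ} (hz : z.im ≠ 0) (ζ : Plane) (b : Cell) :
    Tendsto (fun h => resKernel h z ζ b) (𝓝[>] 0) (𝓝 (((weight 2 ζ : ℂ) • limitRes z ζ) b)) := by
  refine ((tendsto_symbolRes hz ζ b).const_smul (weight 2 ζ : ℂ)).congr' ?_
  filter_upwards [eventually_closedBall_subset_torus ‖ζ‖] with h hh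
  have hζ : ζ ∈ torus (2 * Real.pi * h) := hh (by simp)
  rw [resKernel, indicator_of_mem hζ, _root_.smul_apply]

/-- The uniform bound on the lattice kernels passes to their pointwise limit. -/
theorem norm_weight_smul_limitRes_le {z : ℂ} (hz : z.im ≠ 0) (ζ : Plane) :
    ‖(weight 2 ζ : ℂ) • limitRes z ζ‖ ≤ resConst z := by
  refine ContinuousLinearMap.opNorm_le_bound _ (resConst_nonneg z) fun b => ?_
  refine le_of_tendsto (tendsto_resKernel hz ζ b).norm ?_
  filter_upwards [self_mem_nhdsWithin] with h hh
  exact (resKernel h z ζ).le_of_opNorm_le (norm_resKernel_le hh hz ζ) b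

theorem continuous_limitRes {z : ℂ} (hz : z.im ≠ 0) : Continuous (limitRes z) := by
  unfold limitRes
  refine Continuous.smul (Continuous.inv₀ ?_ (limitSymbol_sub_ne_zero hz)) continuous_const
  exact (Complex.continuous_ofReal.comp continuous_limitSymbol).sub continuous_const

theorem aestronglyMeasurable_weight_smul_limitRes {z : ℂ} (hz : z.im ≠ 0) :
    AEStronglyMeasurable (fun ζ => (weight 2 ζ : ℂ) • limitRes z ζ) (volume : Measure Plane) :=
  ((Complex.continuous_ofReal.comp (continuous_weight 2)).smul
    (continuous_limitRes hz)).aestronglyMeasurable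

/-- The multiplier `(1 + |ζ|²) (P - z)⁻¹ Π₀`. -/
def limitMult {z : ℂ} (hz : z.im ≠ 0) : L2Plane →L[ℂ] L2Plane :=
  multOp (aestronglyMeasurable_weight_smul_limitRes hz) (norm_weight_smul_limitRes_le hz)

/-- The multiplier `(1 + |ζ|²) (A_h - z)⁻¹`. -/
def resMult {h : ℝ} (hh : 0 < h) {z : ℂ} (hz : z.im ≠ 0) : L2Plane →L[ℂ] L2Plane :=
  multOp (aestronglyMeasurable_resKernel h hz) (norm_resKernel_le hh hz)

theorem norm_multOp_le {K : Plane → Cell →L[ℂ] Cell} (hK : AEStronglyMeasurable K volume) {C : ℝ}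
    (hC : ∀ ξ, ‖K ξ‖ ≤ C) (G : L2Plane) : ‖multOp hK hC G‖ ≤ C * ‖G‖ := by
  refine Lp.norm_le_mul_norm_of_ae_le_mul ?_
  filter_upwards [coeFn_multOp hK hC G] with ξ hξ
  rw [hξ]
  exact (K ξ).le_of_opNorm_le (hC ξ) _

theorem tendsto_lintegral_resKernel {z : ℂ} (hz : z.im ≠ 0) {F : Plane → Cell}
    (hF : MemLp F 2 (volume : Measure Plane)) :
    Tendsto (fun h => ∫⁻ ζ, ‖resKernel h z ζ (F ζ) - ((weight 2 ζ : ℂ) • limitRes z ζ) (F ζ)‖ₑ ^ 2)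
      (𝓝[>] 0) (𝓝 0) := by
  have h0 : Tendsto (fun h => ∫⁻ ζ, ‖resKernel h z ζ (F ζ)
      - ((weight 2 ζ : ℂ) • limitRes z ζ) (F ζ)‖ₑ ^ 2) (𝓝[>] 0)
      (𝓝 (∫⁻ _ζ : Plane, 0)) := by
    refine tendsto_lintegral_filter_of_dominated_convergence'
      (fun ζ => (ENNReal.ofReal (2 * resConst z) * ‖F ζ‖ₑ) ^ 2) ?_ ?_ ?_ ?_
    · refine Eventually.of_forall fun h => ?_
      have m1 : AEStronglyMeasurable (fun ζ => resKernel h z ζ (F ζ)) (volume : Measure Plane) :=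
        isBoundedBilinearMap_apply.continuous.comp_aestronglyMeasurable
          ((aestronglyMeasurable_resKernel h hz).prodMk hF.1)
      have m2 : AEStronglyMeasurable (fun ζ => ((weight 2 ζ : ℂ) • limitRes z ζ) (F ζ))
          (volume : Measure Plane) :=
        isBoundedBilinearMap_apply.continuous.comp_aestronglyMeasurable
          ((aestronglyMeasurable_weight_smul_limitRes hz).prodMk hF.1)
      exact ((m1.sub m2).enorm).pow_const 2
    · filter_upwards [self_mem_nhdsWithin] with h hh
      refine Eventually.of_forall fun ζ => ?_
      gcongr
      rw [← ofReal_norm, ← ofReal_norm, ← ENNReal.ofReal_mul (by have := resConst_nonneg z; positivity)]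
      refine ENNReal.ofReal_le_ofReal ?_
      have h1 := (resKernel h z ζ).le_of_opNorm_le (norm_resKernel_le hh hz ζ) (F ζ)
      have h2 := ContinuousLinearMap.le_of_opNorm_le _ (norm_weight_smul_limitRes_le hz ζ) (F ζ)
      refine (norm_sub_le _ _).trans ?_
      linarith
    · have h1 : ∫⁻ ζ, (ENNReal.ofReal (2 * resConst z) * ‖F ζ‖ₑ) ^ 2
          = ENNReal.ofReal (2 * resConst z) ^ 2 * ∫⁻ ζ, ‖F ζ‖ₑ ^ 2 := by
        simp_rw [mul_pow]
        exact lintegral_const_mul' _ _ (by finiteness)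
      rw [h1]
      have h2 := lintegral_rpow_enorm_lt_top_of_eLpNorm_lt_top (by norm_num) (by norm_num) hF.2
      simp only [ENNReal.toReal_ofNat, ENNReal.rpow_ofNat] at h2
      finiteness
    · refine Eventually.of_forall fun ζ => ?_
      have h1 := ((ENNReal.continuous_pow 2).tendsto _).comp ((tendsto_resKernel hz ζ (F ζ)).sub_const
        (((weight 2 ζ : ℂ) • limitRes z ζ) (F ζ))).enorm
      rw [sub_self, enorm_zero] at h1
      simpa [Function.comp_def] using h1
  simpa using h0

/-- Strong convergence together with the uniform bound allows the argument `F h` to move with `h`.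
The outputs `Y` are prescribed only almost everywhere and for small `h`, because `resMult` requires
a proof of `0 < h`. -/
theorem tendsto_resMult {z : ℂ} (hz : z.im ≠ 0) {F : ℝ → L2Plane} {F₀ : L2Plane}
    (hF : Tendsto F (𝓝[>] 0) (𝓝 F₀)) {Y : ℝ → L2Plane}
    (hY : ∀ᶠ h in 𝓝[>] 0, Y h =ᵐ[volume] fun ζ => resKernel h z ζ (F h ζ)) :
    Tendsto Y (𝓝[>] 0) (𝓝 (limitMult hz F₀)) := by
  have h1 : Tendsto (fun h => eLpNorm (fun ζ => resKernel h z ζ (F₀ ζ)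
      - ((weight 2 ζ : ℂ) • limitRes z ζ) (F₀ ζ)) 2 volume) (𝓝[>] 0) (𝓝 0) := by
    have h2 := (tendsto_lintegral_resKernel hz (Lp.memLp F₀)).ennrpow_const (1 / 2)
    rw [ENNReal.zero_rpow_of_pos (by norm_num)] at h2
    refine h2.congr fun h => ?_
    rw [eLpNorm_eq_lintegral_rpow_enorm_toReal (by norm_num) (by norm_num)]
    simp
  have h2 : Tendsto (fun h => (eLpNorm (fun ζ => resKernel h z ζ (F₀ ζ)
      - ((weight 2 ζ : ℂ) • limitRes z ζ) (F₀ ζ)) 2 volume).toReal + resConst z * ‖F h - F₀‖)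
      (𝓝[>] 0) (𝓝 0) := by
    have h3 := (ENNReal.tendsto_toReal ENNReal.zero_ne_top).comp h1
    have h4 := (tendsto_iff_norm_sub_tendsto_zero.1 hF).const_mul (resConst z)
    simpa using h3.add h4
  rw [tendsto_iff_norm_sub_tendsto_zero]
  refine squeeze_zero' (Eventually.of_forall fun h => norm_nonneg _) ?_ h2
  filter_upwards [hY, self_mem_nhdsWithin] with h hYh hh
  have e1 : Y h = resMult hh hz (F h) :=
    Lp.ext (hYh.trans (coeFn_multOp (aestronglyMeasurable_resKernel h hz) (norm_resKernel_le hh hz)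
      (F h)).symm)
  have e2 : Y h - limitMult hz F₀ = (resMult hh hz F₀ - limitMult hz F₀) + resMult hh hz (F h - F₀) := by
    rw [e1, map_sub]; abel
  rw [e2]
  refine (norm_add_le _ _).trans (add_le_add (le_of_eq ?_) (norm_multOp_le _ _ _))
  rw [Lp.norm_def]
  congr 1
  refine eLpNorm_congr_ae ?_
  filter_upwards [Lp.coeFn_sub (resMult hh hz F₀) (limitMult hz F₀),
    coeFn_multOp (aestronglyMeasurable_resKernel h hz) (norm_resKernel_le hh hz) F₀,
    coeFn_multOp (aestronglyMeasurable_weight_smul_limitRes hz) (norm_weight_smul_limitRes_le hz) F₀]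
    with ζ h3 h4 h5
  rw [h3, Pi.sub_apply]
  exact congrArg₂ (· - ·) h4 h5

end
end Kagome

namespace Kagome
noncomputable section
open scoped FourierTransform LineDeriv

/-! ### The limit operator on test functions -/

/-- `-(1/12) (∂₁² - ∂₁∂₂ + ∂₂²)` on Schwartz functions. -/
def schwartzLimitOp (φ : 𝓢(Plane, ℂ)) : 𝓢(Plane, ℂ) :=
  (-(1 / 12 : ℂ)) • (∂_{(EuclideanSpace.single 0 1 : Plane)} (∂_{(EuclideanSpace.single 0 1 : Plane)} φ)
    - ∂_{(EuclideanSpace.single 0 1 : Plane)} (∂_{(EuclideanSpace.single 1 1 : Plane)} φ)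
    + ∂_{(EuclideanSpace.single 1 1 : Plane)} (∂_{(EuclideanSpace.single 1 1 : Plane)} φ))

theorem schwartzLimitOp_apply (φ : 𝓢(Plane, ℂ)) (x : Plane) :
    schwartzLimitOp φ x = limitOp φ x := rfl

theorem fourierInv_lineDeriv_single (φ : 𝓢(Plane, ℂ)) (j : Fin 2) (ζ : Plane) :
    𝓕⁻ (∂_{(EuclideanSpace.single j 1 : Plane)} φ) ζ
      = -(2 * Real.pi * Complex.I) * (ζ j * (𝓕⁻ φ : 𝓢(Plane, ℂ)) ζ) := by
  have : (fun x : Plane => (inner ℝ x (EuclideanSpace.single j 1 : Plane) : ℝ)).HasTemperateGrowth := by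
    fun_prop
  rw [SchwartzMap.fourierInv_lineDerivOp_eq, _root_.smul_apply,
    SchwartzMap.smulLeftCLM_apply_apply this]
  simp [EuclideanSpace.inner_single_right]

theorem fourierInv_schwartzLimitOp (φ : 𝓢(Plane, ℂ)) (ζ : Plane) :
    (𝓕⁻ (schwartzLimitOp φ) : 𝓢(Plane, ℂ)) ζ = limitSymbol ζ * (𝓕⁻ φ : 𝓢(Plane, ℂ)) ζ := by
  rw [schwartzLimitOp, FourierTransform.fourierInv_smul, FourierTransform.fourierInv_add]
  simp only [sub_eq_add_neg, FourierTransform.fourierInv_add, FourierTransform.fourierInv_neg,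
    _root_.smul_apply, _root_.add_apply, _root_.neg_apply,
    fourierInv_lineDeriv_single, limitSymbol]
  push_cast
  linear_combination (-(1 / 12) * 4 * Real.pi ^ 2 * (ζ 0 ^ 2 - ζ 0 * ζ 1 + ζ 1 ^ 2) *
    (𝓕⁻ φ : 𝓢(Plane, ℂ)) ζ) * Complex.I_sq

theorem memLp_schwartz_smul (ψ : 𝓢(Plane, ℂ)) (D : L2Plane) :
    MemLp (fun ζ => ψ ζ • D ζ) 2 (volume : Measure Plane) := by
  obtain ⟨C, hC⟩ := ψ.decay 0 0
  refine memLp_bounded_smul ψ.continuous.aestronglyMeasurable (M := C) (fun x => ?_) (Lp.memLp D)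
  simpa using hC.2 x

theorem integrable_schwartz_smul (ψ : 𝓢(Plane, ℂ)) (D : L2Plane) :
    Integrable (fun ζ => ψ ζ • D ζ) (volume : Measure Plane) :=
  memLp_one_iff_integrable.1 (MemLp.smul (r := 1) (Lp.memLp D) (ψ.memLp 2 volume))

theorem integral_limitOp_smul (φ : 𝓢(Plane, ℂ)) (D K : L2Plane) :
    (∫ x, limitOp φ x • (𝓕⁻ D : L2Plane) x) - ∫ x, φ x • (𝓕⁻ K : L2Plane) x
      = ∫ ζ, (𝓕⁻ φ : 𝓢(Plane, ℂ)) ζ • ((limitSymbol ζ : ℂ) • D ζ - K ζ) := by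
  have h1 := integral_smul_fourierInv_L2 (schwartzLimitOp φ) D
  have h2 := integral_smul_fourierInv_L2 φ K
  simp only [schwartzLimitOp_apply] at h1
  rw [h1, h2, ← integral_sub (integrable_schwartz_smul _ D) (integrable_schwartz_smul _ K)]
  refine integral_congr_ae (Eventually.of_forall fun ζ => ?_)
  simp only [fourierInv_schwartzLimitOp, smul_sub, smul_smul, mul_comm]

/-! ### Separation by test functions -/

/-- On a support this small the phase `2π x · ζ` stays within `π / 2` of zero, so the cosine is
nonnegative, and it equals `1` at the origin. -/
theorem integral_cos_mul_bump_pos {R : ℝ} (f : ContDiffBump (0 : Plane)) (hf : f.rOut * R ≤ 1 / 4)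
    {ζ : Plane} (hζ : ‖ζ‖ ≤ R) : 0 < ∫ x : Plane, Real.cos (2 * Real.pi * inner ℝ x ζ) * f x := by
  have hc : Continuous fun x : Plane => Real.cos (2 * Real.pi * inner ℝ x ζ) := by fun_prop
  refine Continuous.integral_pos_of_hasCompactSupport_nonneg_nonzero (x := 0)
    (hc.mul f.continuous) f.hasCompactSupport.mul_left (fun x => ?_) ?_
  · by_cases hx : x ∈ Metric.ball (0 : Plane) f.rOut
    · refine mul_nonneg (Real.cos_nonneg_of_mem_Icc ?_) f.nonneg
      have h3 : |inner ℝ x ζ| ≤ 1 / 4 := by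
        refine (abs_real_inner_le_norm x ζ).trans (le_trans ?_ hf)
        have h4 : ‖x‖ ≤ f.rOut := (mem_ball_zero_iff.1 hx).le
        gcongr
        exact f.rOut_pos.le
      have h6 := abs_le.1 h3
      constructor <;> nlinarith [Real.pi_pos, h6.1, h6.2]
    · have : f x = 0 := by
        rw [← Function.notMem_support, f.support_eq]; exact hx
      simp [this]
  · have : f 0 = 1 := f.one_of_mem_closedBall (by simp [f.rIn_pos.le])
    simp [this]

theorem fourierInv_bump_re (f : ContDiffBump (0 : Plane)) (ζ : Plane) :
    (𝓕⁻ (fun x : Plane => (f x : ℂ)) ζ).re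
      = ∫ x : Plane, Real.cos (2 * Real.pi * inner ℝ x ζ) * f x := by
  have hfc : HasCompactSupport (fun x => (f x : ℂ)) := f.hasCompactSupport.comp_left Complex.ofReal_zero
  have hc : Continuous fun x : Plane =>
      Complex.exp (((2 * Real.pi * inner ℝ x ζ : ℝ) : ℂ) * Complex.I) := by fun_prop
  have hint : Integrable (fun x => Complex.exp (((2 * Real.pi * inner ℝ x ζ : ℝ) : ℂ) * Complex.I)
      • (f x : ℂ)) (volume : Measure Plane) :=
    (hc.smul (Complex.continuous_ofReal.comp f.continuous)).integrable_of_hasCompactSupport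
      (HasCompactSupport.smul_left (f := fun x : Plane =>
        Complex.exp (((2 * Real.pi * inner ℝ x ζ : ℝ) : ℂ) * Complex.I)) hfc)
  rw [Real.fourierInv_eq', ← Complex.reCLM_apply, ← ContinuousLinearMap.integral_comp_comm _ hint]
  refine integral_congr_ae (Eventually.of_forall fun x => ?_)
  simp only [smul_eq_mul, Complex.reCLM_apply, Complex.re_mul_ofReal, Complex.exp_ofReal_mul_I_re]

/-- A sufficiently narrow bump has a transform with positive real part on the prescribed ball.
Division by it localises an identity in frequency while the test function keeps compact support in
space. -/
theorem exists_bump_fourierInv_ne_zero (R : ℝ) : ∃ φ : 𝓢(Plane, ℂ), HasCompactSupport φ ∧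
    ∀ ζ ∈ Metric.closedBall (0 : Plane) R, (𝓕⁻ φ : 𝓢(Plane, ℂ)) ζ ≠ 0 := by
  have hr : (0 : ℝ) < 1 / (4 * (|R| + 1)) := by positivity
  obtain ⟨f, hf⟩ : ∃ f : ContDiffBump (0 : Plane), f.rOut = 1 / (4 * (|R| + 1)) :=
    ⟨⟨_, _, half_pos hr, half_lt_self hr⟩, rfl⟩
  have hf' : f.rOut * (|R| + 1) ≤ 1 / 4 := by
    rw [hf]
    refine le_of_eq ?_
    field_simp
  have hs : ContDiff ℝ (⊤ : ℕ∞) (fun x => (f x : ℂ)) := Complex.ofRealCLM.contDiff.comp f.contDiff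
  have hfc : HasCompactSupport (fun x => (f x : ℂ)) := f.hasCompactSupport.comp_left Complex.ofReal_zero
  refine ⟨hfc.toSchwartzMap hs, hfc, fun ζ hζ h0 => ?_⟩
  have h1 := integral_cos_mul_bump_pos f hf' (ζ := ζ) (by
    have := mem_closedBall_zero_iff.1 hζ
    linarith [le_abs_self R])
  rw [← fourierInv_bump_re] at h1
  rw [SchwartzMap.fourierInv_coe] at h0
  have h2 : (𝓕⁻ (fun x : Plane => (f x : ℂ)) ζ) = 0 := h0
  rw [h2, Complex.zero_re] at h1
  exact h1.false

theorem ae_eq_zero_of_fourierInv_eq_zero {N : Plane → Cell} (hN : Integrable N)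
    (hN2 : MemLp N 2 (volume : Measure Plane)) (h0 : ∀ x, 𝓕⁻ N x = 0) : N =ᵐ[volume] 0 := by
  obtain ⟨hg, hg'⟩ := fourier_toLp_fourierInv hN hN2
  have h1 : hg.toLp (𝓕⁻ N) = 0 := by
    rw [Lp.eq_zero_iff_ae_eq_zero]
    filter_upwards [hg.coeFn_toLp] with x hx
    rw [hx, h0]; rfl
  rw [h1] at hg'
  have h2 : hN2.toLp N = 0 := by
    rw [← hg']
    exact map_zero (Lp.fourierTransformₗᵢ Plane Cell)
  filter_upwards [hN2.coeFn_toLp, (Lp.eq_zero_iff_ae_eq_zero.1 h2)] with ζ h3 h4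
  rw [← h3, h4]

/-- The translate of a test function. -/
theorem exists_translate {φ : 𝓢(Plane, ℂ)} (hφ : HasCompactSupport φ) (a : Plane) :
    ∃ ψ : 𝓢(Plane, ℂ), HasCompactSupport ψ ∧ ∀ ζ, (𝓕⁻ ψ : 𝓢(Plane, ℂ)) ζ
      = Complex.exp (((2 * Real.pi * inner ℝ ζ a : ℝ) : ℂ) * Complex.I) * (𝓕⁻ φ : 𝓢(Plane, ℂ)) ζ := by
  have h1 : ContDiff ℝ (⊤ : ℕ∞) (fun x => φ (x - a)) :=
    (φ.smooth _).comp (contDiff_id.sub contDiff_const)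
  have h2 : HasCompactSupport (fun x => φ (x - a)) := hφ.comp_homeomorph (Homeomorph.subRight a)
  refine ⟨h2.toSchwartzMap h1, h2, fun ζ => ?_⟩
  rw [SchwartzMap.fourierInv_coe, SchwartzMap.fourierInv_coe, Real.fourierInv_eq',
    Real.fourierInv_eq', ← integral_const_mul]
  rw [← integral_add_right_eq_self _ a]
  refine integral_congr_ae (Eventually.of_forall fun x => ?_)
  simp only [HasCompactSupport.toSchwartzMap_toFun, add_sub_cancel_right, smul_eq_mul]
  rw [← mul_assoc, ← Complex.exp_add]
  congr 2
  rw [inner_add_left, real_inner_comm a ζ]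
  push_cast
  ring

/-- A distributional solution on test functions is a solution on the Fourier side. -/
theorem limitSymbol_smul_ae_eq {D K : L2Plane}
    (h : ∀ φ : 𝓢(Plane, ℂ), HasCompactSupport φ →
      ∫ x, limitOp φ x • (𝓕⁻ D : L2Plane) x = ∫ x, φ x • (𝓕⁻ K : L2Plane) x) :
    ∀ᵐ ζ ∂(volume : Measure Plane), (limitSymbol ζ : ℂ) • D ζ = K ζ := by
  have h1 : ∀ R : ℕ, ∀ᵐ ζ ∂(volume : Measure Plane), ζ ∈ Metric.closedBall (0 : Plane) R →
      (limitSymbol ζ : ℂ) • D ζ = K ζ := by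
    intro R
    obtain ⟨φ, hφ, hφ0⟩ := exists_bump_fourierInv_ne_zero R
    set N : Plane → Cell := fun ζ => (𝓕⁻ φ : 𝓢(Plane, ℂ)) ζ • ((limitSymbol ζ : ℂ) • D ζ - K ζ) with hN
    have hN' : N = fun ζ => (𝓕⁻ (schwartzLimitOp φ) : 𝓢(Plane, ℂ)) ζ • D ζ
        - (𝓕⁻ φ : 𝓢(Plane, ℂ)) ζ • K ζ := by
      funext ζ
      simp only [hN, fourierInv_schwartzLimitOp, smul_sub, smul_smul, mul_comm]
    have hN1 : Integrable N := by
      rw [hN']; exact (integrable_schwartz_smul _ D).sub (integrable_schwartz_smul _ K)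
    have hN2 : MemLp N 2 (volume : Measure Plane) := by
      rw [hN']; exact (memLp_schwartz_smul _ D).sub (memLp_schwartz_smul _ K)
    -- Translating the test function by `a` multiplies its transform by an exponential, so the weak
    -- equation for all translates says that the inverse transform of `N` vanishes everywhere.
    have h2 : ∀ a, 𝓕⁻ N a = 0 := by
      intro a
      obtain ⟨ψ, hψ, hψ'⟩ := exists_translate hφ a
      have h3 := integral_limitOp_smul ψ D K
      rw [h ψ hψ, sub_self] at h3
      rw [Real.fourierInv_eq', h3]
      refine integral_congr_ae (Eventually.of_forall fun ζ => ?_)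
      simp only [hψ', hN, smul_smul]
    filter_upwards [ae_eq_zero_of_fourierInv_eq_zero hN1 hN2 h2] with ζ h3 h4
    exact sub_eq_zero.1 ((smul_eq_zero.1 h3).resolve_left (hφ0 ζ h4))
  filter_upwards [ae_all_iff.2 h1] with ζ h2
  obtain ⟨R, hR⟩ := exists_nat_ge ‖ζ‖
  exact h2 R (by simpa using hR)

end
end Kagome

namespace Kagome
noncomputable section
open scoped FourierTransform

/-! ### Multiplication by real functions -/

theorem norm_mulKernel_le {w : Plane → ℝ} {C : ℝ} (hC : ∀ x, |w x| ≤ C) (x : Plane) :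
    ‖(w x : ℂ) • ContinuousLinearMap.id ℂ Cell‖ ≤ C := by
  rw [norm_smul, Complex.norm_real, Real.norm_eq_abs]
  exact (mul_le_of_le_one_right (abs_nonneg _) ContinuousLinearMap.norm_id_le).trans (hC _)

theorem aestronglyMeasurable_mulKernel {w : Plane → ℝ} (hw : Continuous w) :
    AEStronglyMeasurable (fun x => (w x : ℂ) • ContinuousLinearMap.id ℂ Cell)
      (volume : Measure Plane) :=
  ((Complex.continuous_ofReal.comp hw).smul continuous_const).aestronglyMeasurable

/-- Multiplication by a bounded continuous real function. -/
def mulOp {w : Plane → ℝ} (hw : Continuous w) {C : ℝ} (hC : ∀ x, |w x| ≤ C) :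
    L2Plane →L[ℂ] L2Plane :=
  multOp (aestronglyMeasurable_mulKernel hw) (norm_mulKernel_le hC)

theorem coeFn_mulOp {w : Plane → ℝ} (hw : Continuous w) {C : ℝ} (hC : ∀ x, |w x| ≤ C)
    (G : L2Plane) : mulOp hw hC G =ᵐ[volume] fun x => (w x : ℂ) • G x := by
  filter_upwards [coeFn_multOp (aestronglyMeasurable_mulKernel hw) (norm_mulKernel_le hC) G]
    with x hx
  rw [mulOp, hx]
  rfl

theorem norm_mulOp_le {w : Plane → ℝ} (hw : Continuous w) {C : ℝ} (hC : ∀ x, |w x| ≤ C)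
    (G : L2Plane) : ‖mulOp hw hC G‖ ≤ C * ‖G‖ :=
  norm_multOp_le _ _ _

theorem inner_mulOp_left {w : Plane → ℝ} (hw : Continuous w) {C : ℝ} (hC : ∀ x, |w x| ≤ C)
    (F G : L2Plane) : inner ℂ (mulOp hw hC F) G = inner ℂ F (mulOp hw hC G) := by
  rw [L2.inner_def, L2.inner_def]
  refine integral_congr_ae ?_
  filter_upwards [coeFn_mulOp hw hC F, coeFn_mulOp hw hC G] with x h1 h2
  rw [h1, h2, inner_smul_left, inner_smul_right, Complex.conj_ofReal]

/-- The multiplication by the potential on the Fourier side. -/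
def potOp {w : Plane → ℝ} (hw : Continuous w) {C : ℝ} (hC : ∀ x, |w x| ≤ C) :
    L2Plane →L[ℂ] L2Plane :=
  ((Lp.fourierTransformₗᵢ Plane Cell).toContinuousLinearEquiv : L2Plane →L[ℂ] L2Plane) ∘L
    mulOp hw hC ∘L
    ((Lp.fourierTransformₗᵢ Plane Cell).symm.toContinuousLinearEquiv : L2Plane →L[ℂ] L2Plane)

theorem potOp_apply {w : Plane → ℝ} (hw : Continuous w) {C : ℝ} (hC : ∀ x, |w x| ≤ C)
    (G : L2Plane) : potOp hw hC G = 𝓕 (mulOp hw hC (𝓕⁻ G)) := rfl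

theorem inner_potOp_left {w : Plane → ℝ} (hw : Continuous w) {C : ℝ} (hC : ∀ x, |w x| ≤ C)
    (F G : L2Plane) : inner ℂ (potOp hw hC F) G = inner ℂ F (potOp hw hC G) := by
  have h1 : ∀ A B : L2Plane, inner ℂ (𝓕 A : L2Plane) B = inner ℂ A (𝓕⁻ B : L2Plane) := fun A B =>
    (Lp.fourierTransformₗᵢ Plane Cell).inner_map_eq_flip A B
  have h2 : ∀ A B : L2Plane, inner ℂ (𝓕⁻ A : L2Plane) B = inner ℂ A (𝓕 B : L2Plane) := fun A B =>
    (Lp.fourierTransformₗᵢ Plane Cell).symm.inner_map_eq_flip A B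
  rw [potOp_apply, potOp_apply, h1, inner_mulOp_left, h2]

theorem norm_potOp_le {w : Plane → ℝ} (hw : Continuous w) {C : ℝ} (hC : ∀ x, |w x| ≤ C)
    (G : L2Plane) : ‖potOp hw hC G‖ ≤ C * ‖G‖ := by
  have h1 : ∀ A : L2Plane, ‖(𝓕 A : L2Plane)‖ = ‖A‖ := (Lp.fourierTransformₗᵢ Plane Cell).norm_map
  have h2 : ∀ A : L2Plane, ‖(𝓕⁻ A : L2Plane)‖ = ‖A‖ :=
    (Lp.fourierTransformₗᵢ Plane Cell).symm.norm_map
  rw [potOp_apply, h1, ← h2 G]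
  exact norm_mulOp_le hw hC _

/-! ### The limit equation on the Fourier side -/

/-- The multiplier `(1 + P)^(-1/2)`. -/
def sqrtRes (ζ : Plane) : ℝ := (Real.sqrt (1 + limitSymbol ζ))⁻¹

theorem continuous_sqrtRes : Continuous sqrtRes := by
  refine Continuous.inv₀ ((continuous_const.add continuous_limitSymbol).sqrt) fun ζ => ?_
  have := limitSymbol_nonneg ζ
  positivity

theorem abs_sqrtRes_le (ζ : Plane) : |sqrtRes ζ| ≤ 1 := by
  have := limitSymbol_nonneg ζ
  rw [sqrtRes, abs_inv, abs_of_nonneg (Real.sqrt_nonneg _)]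
  exact inv_le_one_of_one_le₀ (Real.one_le_sqrt.2 (by linarith))

theorem sqrtRes_sq (ζ : Plane) : (1 + limitSymbol ζ) * (sqrtRes ζ * sqrtRes ζ) = 1 := by
  have := limitSymbol_nonneg ζ
  rw [sqrtRes, ← mul_inv, Real.mul_self_sqrt (by linarith)]
  exact mul_inv_cancel₀ (by linarith)

/-- Multiplication by `(1 + P)^(-1/2)`. -/
def sqrtOp : L2Plane →L[ℂ] L2Plane := mulOp continuous_sqrtRes abs_sqrtRes_le

theorem coeFn_sqrtOp (G : L2Plane) : sqrtOp G =ᵐ[volume] fun ζ => (sqrtRes ζ : ℂ) • G ζ :=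
  coeFn_mulOp continuous_sqrtRes abs_sqrtRes_le G

theorem sqrtOp_sqrtOp_eq_iff (D H : L2Plane) : D = sqrtOp (sqrtOp H) ↔
    ∀ᵐ ζ ∂(volume : Measure Plane), (1 + limitSymbol ζ : ℂ) • D ζ = H ζ := by
  have h1 : sqrtOp (sqrtOp H) =ᵐ[volume] fun ζ => ((sqrtRes ζ * sqrtRes ζ : ℝ) : ℂ) • H ζ := by
    filter_upwards [coeFn_sqrtOp (sqrtOp H), coeFn_sqrtOp H] with ζ h2 h3
    rw [h2, h3, smul_smul, Complex.ofReal_mul]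
  have h4 : ∀ ζ, (1 + limitSymbol ζ : ℂ) * ((sqrtRes ζ * sqrtRes ζ : ℝ) : ℂ) = 1 := by
    intro ζ
    have := congrArg (fun x : ℝ => (x : ℂ)) (sqrtRes_sq ζ)
    push_cast at this ⊢
    exact this
  constructor
  · intro h
    filter_upwards [h1] with ζ h2
    rw [h, h2, smul_smul, h4, one_smul]
  · intro h
    refine Lp.ext ?_
    filter_upwards [h, h1] with ζ h2 h3
    rw [h3, ← h2, smul_smul, mul_comm, h4, one_smul]

section

variable {w : Plane → ℝ} (hw : Continuous w) {C : ℝ} (hC : ∀ x, |w x| ≤ C)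

/-- The form bounded version of `P + V - z`. -/
def formOp (z : ℂ) : L2Plane →L[ℂ] L2Plane :=
  ContinuousLinearMap.id ℂ L2Plane - (1 + z) • (sqrtOp ∘L sqrtOp) + sqrtOp ∘L potOp hw hC ∘L sqrtOp

theorem formOp_apply (z : ℂ) (y : L2Plane) :
    formOp hw hC z y = y - (1 + z) • sqrtOp (sqrtOp y) + sqrtOp (potOp hw hC (sqrtOp y)) := rfl

/-- Here `w` is the form of `formOp` at `y`, with `s = ‖y‖²`, `t = ‖(1 + P)^(-1/2) y‖²` and `r` the
potential term. The imaginary part of `w` controls `t`, and then the real part controls `s`. -/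
theorem coercive_aux {z w : ℂ} {s t r C : ℝ} (ht : 0 ≤ t) (hr : |r| ≤ C * t) (hC : 0 ≤ C)
    (hw : w = s - (1 + z) * t + r) : |z.im| * s ≤ (1 + ‖z‖ + C + |z.im|) * ‖w‖ := by
  have him : w.im = -(z.im * t) := by rw [hw]; simp
  have hre : w.re = s - (1 + z.re) * t + r := by rw [hw]; simp
  have h1 := Complex.abs_im_le_norm w
  rw [him, abs_neg, abs_mul, abs_of_nonneg ht] at h1
  have h2 := (le_abs_self _).trans (Complex.abs_re_le_norm w)
  have h3 := (le_abs_self _).trans (Complex.abs_re_le_norm z)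
  have h4 := (abs_le.1 hr).1
  have h5 : s ≤ ‖w‖ + (1 + ‖z‖ + C) * t := by
    rw [hre] at h2
    nlinarith [mul_le_mul_of_nonneg_right h3 ht]
  have hK : 0 ≤ 1 + ‖z‖ + C := by positivity
  nlinarith [mul_le_mul_of_nonneg_left h5 (abs_nonneg z.im), mul_le_mul_of_nonneg_left h1 hK]

theorem norm_sq_le_inner_formOp (z : ℂ) (y : L2Plane) :
    |z.im| * ‖y‖ ^ 2 ≤ (1 + ‖z‖ + C + |z.im|) * ‖inner ℂ y (formOp hw hC z y)‖ := by
  have hC0 : 0 ≤ C := (abs_nonneg _).trans (hC 0)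
  set p := inner ℂ (sqrtOp y) (potOp hw hC (sqrtOp y)) with hp
  have him : p.im = 0 := by
    rw [← Complex.conj_eq_iff_im, hp, inner_conj_symm, inner_potOp_left]
  have hre : (p.re : ℂ) = p := by
    apply Complex.ext <;> simp [him]
  refine coercive_aux (t := ‖sqrtOp y‖ ^ 2) (r := p.re) (sq_nonneg _) ?_ hC0 ?_
  · refine (Complex.abs_re_le_norm p).trans ((norm_inner_le_norm _ _).trans ?_)
    have := norm_potOp_le hw hC (sqrtOp y)
    nlinarith [norm_nonneg (sqrtOp y)]
  · have h1 : ∀ F G : L2Plane, inner ℂ F (sqrtOp G) = inner ℂ (sqrtOp F) G := fun F G =>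
      (inner_mulOp_left _ _ F G).symm
    rw [formOp_apply, inner_add_right, inner_sub_right, inner_smul_right, h1 y (sqrtOp y), h1 y (potOp hw hC (sqrtOp y)), ← hp, hre,
      inner_self_eq_norm_sq_to_K, inner_self_eq_norm_sq_to_K]
    push_cast
    rfl

theorem isUnit_formOp {z : ℂ} (hz : z.im ≠ 0) : IsUnit (formOp hw hC z) := by
  have hC0 : 0 ≤ C := (abs_nonneg _).trans (hC 0)
  have hz' := abs_pos.2 hz
  have hK : 0 < 1 + ‖z‖ + C + |z.im| := by positivity
  refine ContinuousLinearMap.isUnit_of_forall_le_norm_inner_map _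
    (c := ⟨|z.im| / (1 + ‖z‖ + C + |z.im|), by positivity⟩)
    (show (0 : ℝ) < |z.im| / (1 + ‖z‖ + C + |z.im|) by positivity) fun y => ?_
  have h1 := norm_sq_le_inner_formOp hw hC z y
  rw [norm_inner_symm]
  change ‖y‖ ^ 2 * (|z.im| / (1 + ‖z‖ + C + |z.im|)) ≤ _
  rw [mul_div_assoc', div_le_iff₀ hK]
  linarith

/-- `(P - z) D + V D = G` on the Fourier side. -/
def IsSpecSolution (z : ℂ) (G D : L2Plane) : Prop :=
  ∀ᵐ ζ ∂(volume : Measure Plane), (limitSymbol ζ : ℂ) • D ζ = (G + z • D - potOp hw hC D) ζ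

/-- Adding `D` to both sides replaces `P` by the invertible multiplier `1 + P`, so that the
unbounded equation becomes a fixed point equation with bounded operators. -/
theorem isSpecSolution_iff (z : ℂ) (G D : L2Plane) : IsSpecSolution hw hC z G D ↔
    D = sqrtOp (sqrtOp (D + (G + z • D - potOp hw hC D))) := by
  rw [sqrtOp_sqrtOp_eq_iff, IsSpecSolution]
  have h1 := Lp.coeFn_add D (G + z • D - potOp hw hC D)
  constructor
  · intro h
    filter_upwards [h, h1] with ζ h2 h3
    rw [h3, Pi.add_apply, ← h2, add_smul, one_smul]
  · intro h
    filter_upwards [h, h1] with ζ h2 h3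
    rw [h3, Pi.add_apply, add_smul, one_smul] at h2
    exact add_left_cancel h2

/-- With `S = (1 + P)^(-1/2)`, the solution is `S y` where `formOp` sends `y` to `S G`; applying `S`
once more gives the fixed point equation. -/
theorem exists_isSpecSolution {z : ℂ} (hz : z.im ≠ 0) (G : L2Plane) :
    ∃ D, IsSpecSolution hw hC z G D := by
  obtain ⟨y, hy⟩ := ((ContinuousLinearMap.isUnit_iff_bijective).1 (isUnit_formOp hw hC hz)).2
    (sqrtOp G)
  refine ⟨sqrtOp y, (isSpecSolution_iff hw hC z G _).2 ?_⟩
  rw [formOp_apply] at hy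
  congr 1
  simp only [map_add, map_sub, map_smul, ← hy]
  rw [add_smul, one_smul]
  abel

theorem isSpecSolution_unique {z : ℂ} (hz : z.im ≠ 0) {G D D' : L2Plane}
    (hD : IsSpecSolution hw hC z G D) (hD' : IsSpecSolution hw hC z G D') : D = D' := by
  rw [isSpecSolution_iff] at hD hD'
  set d := D - D' with hd
  -- The fixed point equation shows that the difference `d` lies in the range of `sqrtOp`, with this
  -- preimage, and the preimage is in the kernel of `formOp`.
  set y := sqrtOp ((1 + z) • d - potOp hw hC d) with hy
  have h1 : d = sqrtOp y := by
    have h2 : d = sqrtOp (sqrtOp (D + (G + z • D - potOp hw hC D)))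
        - sqrtOp (sqrtOp (D' + (G + z • D' - potOp hw hC D'))) := by rw [← hD, ← hD']
    rw [h2, hy, ← map_sub, ← map_sub, hd]
    congr 2
    rw [map_sub, add_smul, one_smul, smul_sub]
    abel
  have h3 : formOp hw hC z y = formOp hw hC z 0 := by
    rw [formOp_apply, ← h1, map_zero]
    nth_rewrite 1 [hy]
    rw [map_sub, map_smul]
    abel
  have h4 := ((ContinuousLinearMap.isUnit_iff_bijective).1 (isUnit_formOp hw hC hz)).1 h3
  rw [h4, map_zero] at h1
  exact sub_eq_zero.1 h1

/-- Elliptic regularity: `(1 + P) D` is in `L²`, and `|ζ|² ≤ P`. -/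
theorem IsSpecSolution.inX {z : ℂ} {G D : L2Plane} (hD : IsSpecSolution hw hC z G D) : InX 2 D := by
  refine MemLp.of_le (Lp.memLp (D + (G + z • D - potOp hw hC D))) ?_ ?_
  · exact ((Complex.continuous_ofReal.comp (continuous_weight 2)).aestronglyMeasurable).smul
      (Lp.aestronglyMeasurable D)
  · filter_upwards [hD, Lp.coeFn_add D (G + z • D - potOp hw hC D)] with ζ h1 h2
    have h0 := limitSymbol_nonneg ζ
    have h3 : (D + (G + z • D - potOp hw hC D)) ζ = ((1 + limitSymbol ζ : ℝ) : ℂ) • D ζ := by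
      rw [h2, Pi.add_apply, ← h1]
      push_cast
      rw [add_smul, one_smul]
    rw [h3, norm_smul, norm_smul, Complex.norm_real, Complex.norm_real,
      Real.norm_of_nonneg (weight_pos _ _).le, Real.norm_of_nonneg (by linarith), weight_two]
    gcongr
    exact norm_sq_le_limitSymbol ζ

end

end
end Kagome

namespace Kagome
noncomputable section
open scoped FourierTransform

/-! ### The limit equation in the sense of distributions -/

theorem coeFn_fourierInv_rhs {w : Plane → ℝ} (hw : Continuous w) {C : ℝ} (hC : ∀ x, |w x| ≤ C)
    (z : ℂ) {g : Plane → Cell} (hg : MemLp g 2 (volume : Measure Plane))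
    (D : L2Plane) :
    (𝓕⁻ ((𝓕 (hg.toLp g) : L2Plane) + z • D - potOp hw hC D) : L2Plane) =ᵐ[volume]
      fun x => g x + z • (𝓕⁻ D : L2Plane) x - (w x : ℂ) • (𝓕⁻ D : L2Plane) x := by
  have h1 : (𝓕⁻ ((𝓕 (hg.toLp g) : L2Plane) + z • D - potOp hw hC D) : L2Plane)
      = hg.toLp g + z • (𝓕⁻ D : L2Plane) - mulOp hw hC (𝓕⁻ D) := by
    have h2 : ∀ A : L2Plane, (𝓕⁻ A : L2Plane) = (Lp.fourierTransformₗᵢ Plane Cell).symm A :=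
      fun _ => rfl
    rw [h2, map_sub, map_add, map_smul, ← h2, ← h2, ← h2, potOp_apply,
      FourierTransform.fourierInv_fourier_eq, FourierTransform.fourierInv_fourier_eq]
  rw [h1]
  filter_upwards [Lp.coeFn_sub (hg.toLp g + z • (𝓕⁻ D : L2Plane)) (mulOp hw hC (𝓕⁻ D)),
    Lp.coeFn_add (hg.toLp g) (z • (𝓕⁻ D : L2Plane)), Lp.coeFn_smul z (𝓕⁻ D : L2Plane),
    hg.coeFn_toLp, coeFn_mulOp hw hC (𝓕⁻ D)] with x h2 h3 h4 h5 h6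
  rw [h2, Pi.sub_apply, h3, Pi.add_apply, h4, Pi.smul_apply, h5, h6]

/-- The bounded terms `(V - z) v` are moved to the right hand side, leaving the constant coefficient
operator to be treated by the Fourier transform. -/
theorem weak_form_iff {w : Plane → ℝ} (hw : Continuous w) {C : ℝ} (hC : ∀ x, |w x| ≤ C)
    (z : ℂ) {g v : Plane → Cell} (hg : MemLp g 2 (volume : Measure Plane))
    {D : L2Plane} (hv : v =ᵐ[volume] (𝓕⁻ D : L2Plane)) (φ : 𝓢(Plane, ℂ)) :
    (∫ x, (limitOp φ x + ((w x : ℂ) - z) * φ x) • v x = ∫ x, φ x • g x) ↔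
      ∫ x, limitOp φ x • (𝓕⁻ D : L2Plane) x = ∫ x, φ x •
        (𝓕⁻ ((𝓕 (hg.toLp g) : L2Plane) + z • D - potOp hw hC D) : L2Plane) x := by
  set K : L2Plane := 𝓕⁻ ((𝓕 (hg.toLp g) : L2Plane) + z • D - potOp hw hC D) with hK
  have i1 : Integrable (fun x => limitOp φ x • (𝓕⁻ D : L2Plane) x) (volume : Measure Plane) :=
    integrable_schwartz_smul (schwartzLimitOp φ) _
  have i2 := integrable_schwartz_smul φ K
  have i3 : Integrable (fun x => φ x • g x) (volume : Measure Plane) :=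
    (integrable_schwartz_smul φ (hg.toLp g)).congr (hg.coeFn_toLp.mono fun x hx => by simp only [hx])
  have h1 : ∫ x, (limitOp φ x + ((w x : ℂ) - z) * φ x) • v x
      = ∫ x, (limitOp φ x • (𝓕⁻ D : L2Plane) x + (φ x • g x - φ x • K x)) := by
    refine integral_congr_ae ?_
    filter_upwards [hv, coeFn_fourierInv_rhs hw hC z hg D] with x h2 h3
    rw [hK, h3, h2]
    module
  rw [h1, integral_add i1 (by exact i3.sub i2), integral_sub i3 i2]
  constructor
  · intro h
    rw [← sub_eq_zero, ← sub_eq_zero.2 h]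
    abel
  · intro h
    rw [h]
    abel

theorem isContinuumSolution_iff {w : Plane → ℝ} (hw : Continuous w) {C : ℝ} (hC : ∀ x, |w x| ≤ C)
    (z : ℂ) {g v : Plane → Cell}
    (hg : MemLp g 2 (volume : Measure Plane)) {D : L2Plane} (hv : v =ᵐ[volume] (𝓕⁻ D : L2Plane)) :
    IsContinuumSolution w z g v ↔ IsSpecSolution hw hC z (𝓕 (hg.toLp g) : L2Plane) D := by
  constructor
  · rintro ⟨-, h⟩
    refine limitSymbol_smul_ae_eq fun φ hφ => ?_
    exact (weak_form_iff hw hC z hg hv φ).1 (h φ (φ.smooth _) hφ)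
  · intro h
    refine ⟨(Lp.memLp (𝓕⁻ D : L2Plane)).ae_eq hv.symm, fun φ hφ hφc => ?_⟩
    have e : (hφc.toSchwartzMap hφ : Plane → ℂ) = φ := rfl
    have h1 := (weak_form_iff hw hC z hg hv (hφc.toSchwartzMap hφ)).2 ?_
    · rwa [e] at h1
    · rw [← sub_eq_zero, integral_limitOp_smul]
      refine integral_eq_zero_of_ae ?_
      filter_upwards [h] with ζ hζ
      rw [hζ, sub_self, smul_zero]; rfl

theorem IsContinuumSolution.ae_eq {w : Plane → ℝ} (hw : Continuous w) {C : ℝ} (hC : ∀ x, |w x| ≤ C)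
    {z : ℂ} (hz : z.im ≠ 0) {g v v' : Plane → Cell}
    (hg : MemLp g 2 (volume : Measure Plane)) (hv : IsContinuumSolution w z g v)
    (hv' : IsContinuumSolution w z g v') : v =ᵐ[volume] v' := by
  have h1 : ∀ {u : Plane → Cell} (hu : MemLp u 2 (volume : Measure Plane)),
      u =ᵐ[volume] (𝓕⁻ (𝓕 (hu.toLp u) : L2Plane) : L2Plane) := by
    intro u hu
    rw [FourierTransform.fourierInv_fourier_eq]
    exact hu.coeFn_toLp.symm
  have h2 := (isContinuumSolution_iff hw hC z hg (h1 hv.1)).1 hv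
  have h3 := (isContinuumSolution_iff hw hC z hg (h1 hv'.1)).1 hv'
  have h4 := isSpecSolution_unique hw hC hz h2 h3
  have h5 := h1 hv'.1
  rw [← h4] at h5
  exact (h1 hv.1).trans h5.symm

theorem bottomProj_bottomProj (a : Cell) : bottomProj (bottomProj a) = bottomProj a := by
  ext j
  simp [bottomProj]
  ring

/-- The equation acts as a scalar on the three components, so it commutes with `Π₀`. Since `Π₀ g =
g`, uniqueness then gives `Π₀ v = v`. -/
theorem IsContinuumSolution.bottomProj {w : Plane → ℝ} (hw : Continuous w) {C : ℝ} (hC : ∀ x, |w x| ≤ C)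
    {z : ℂ} {g v : Plane → Cell}
    (hg : MemLp g 2 (volume : Measure Plane)) (hv : IsContinuumSolution w z g v) :
    IsContinuumSolution w z (fun x => bottomProj (g x)) (fun x => bottomProj (v x)) := by
  refine ⟨bottomCLM.comp_memLp' hv.1, fun φ hφ hφc => ?_⟩
  have h1 := congrArg bottomCLM (hv.2 φ hφ hφc)
  set ψ := hφc.toSchwartzMap hφ with hψ
  have e : ∀ x, ψ x = φ x := fun x => rfl
  have i1 : Integrable (fun x => φ x • g x) (volume : Measure Plane) :=
    (integrable_schwartz_smul ψ (hg.toLp g)).congr (hg.coeFn_toLp.mono fun x hx => by simp only [hx, e])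
  have i2 : Integrable (fun x => (limitOp φ x + ((w x : ℂ) - z) * φ x) • v x)
      (volume : Measure Plane) := by
    have j1 := (integrable_schwartz_smul (schwartzLimitOp ψ) (hv.1.toLp v)).add
      ((integrable_schwartz_smul ψ (mulOp hw hC (hv.1.toLp v))).sub
        (integrable_schwartz_smul ψ (z • hv.1.toLp v)))
    refine j1.congr ?_
    filter_upwards [hv.1.coeFn_toLp, coeFn_mulOp hw hC (hv.1.toLp v),
      Lp.coeFn_smul z (hv.1.toLp v)] with x h2 h3 h4
    have e2 : schwartzLimitOp ψ x = limitOp φ x := rfl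
    simp only [Pi.add_apply, Pi.sub_apply, h3, h4, Pi.smul_apply, h2, e, e2]
    module
  rw [← ContinuousLinearMap.integral_comp_comm _ i1,
    ← ContinuousLinearMap.integral_comp_comm _ i2] at h1
  simpa only [map_smul, bottomCLM_apply] using h1

end
end Kagome

namespace Kagome
noncomputable section
open scoped FourierTransform

/-! ### Sobolev functions as inverse Fourier transforms -/

/-- Testing against smooth compactly supported functions identifies the distribution `⟨ζ⟩ ^ t û`
with an `L²` function. Because `t > 1`, `û` is integrable, and continuity of `u` turns the almost
everywhere inversion formula into an identity at every point, as sampling requires. -/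
theorem exists_fourierInv_of_memH {F : Type*} [NormedAddCommGroup F] [InnerProductSpace ℂ F]
    [CompleteSpace F] {t : ℝ} (ht : 1 < t) {u : Plane → F} (hu : Continuous u) (hH : MemH t u) :
    ∃ G : Plane → F, MemLp (fun ζ => (weight t ζ : ℂ) • G ζ) 2 (volume : Measure Plane) ∧
      Integrable G (volume : Measure Plane) ∧ u = 𝓕⁻ G := by
  obtain ⟨hu2, hS⟩ := hH
  obtain ⟨f', hf'⟩ := memSobolev_iff_exists_smulLeftCLM_fourier.1 hS
  set U : Lp F 2 (volume : Measure Plane) := hu2.toLp u with hU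
  set G : Lp F 2 (volume : Measure Plane) := 𝓕 U with hG
  rw [Lp.fourier_toTemperedDistribution_eq, ← hG] at hf'
  have hw : (fun x : Plane => (((1 + ‖x‖ ^ 2) ^ (t / 2) : ℝ) : ℂ)).HasTemperateGrowth :=
    hasTemperateGrowth_weight t
  have h1 : (fun ζ => (weight t ζ : ℂ) • G ζ) =ᵐ[volume] f' := by
    refine ae_eq_of_integral_contDiff_smul_eq ?_ ?_ ?_
    · exact ((Lp.memLp G).locallyIntegrable (by norm_num)).continuous_smul
        (Complex.continuous_ofReal.comp (continuous_weight t))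
    · exact (Lp.memLp _).locallyIntegrable (by norm_num)
    · intro g hg hgc
      have hg' : ContDiff ℝ (⊤ : ℕ∞) (fun x => (g x : ℂ)) := Complex.ofRealCLM.contDiff.comp hg
      have hgc' : HasCompactSupport (fun x => (g x : ℂ)) := hgc.comp_left Complex.ofReal_zero
      set φ : 𝓢(Plane, ℂ) := hgc'.toSchwartzMap hg' with hφ
      have e1 : ∀ x, φ x = (g x : ℂ) := fun x => rfl
      have h2 := congrArg (fun T : 𝓢'(Plane, F) => T φ) hf'
      simp only [TemperedDistribution.smulLeftCLM_apply_apply, Lp.toTemperedDistribution_apply] at h2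
      have h3 : ∫ x, g x • f' x = ∫ x, φ x • f' x :=
        integral_congr_ae (Eventually.of_forall fun x => by simp only [e1, Complex.coe_smul])
      rw [h3, ← h2]
      refine integral_congr_ae (Eventually.of_forall fun x => ?_)
      simp only [SchwartzMap.smulLeftCLM_apply_apply hw, e1, weight, smul_eq_mul]
      rw [mul_comm, ← smul_smul, Complex.coe_smul (g x)]
  have h3 : MemLp (fun ζ => (weight t ζ : ℂ) • G ζ) 2 (volume : Measure Plane) :=
    (Lp.memLp f').ae_eq h1.symm
  have h4 : Integrable G (volume : Measure Plane) := by
    have h5 : MemLp (fun x => (weight (-t) x : ℂ)) 2 (volume : Measure Plane) :=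
      (memLp_weight_neg ht).ofReal
    refine (memLp_one_iff_integrable.1 (MemLp.smul (r := 1) h3 h5)).congr
      (Eventually.of_forall fun ζ => ?_)
    simp only [Pi.smul_apply', smul_smul]
    rw [← Complex.ofReal_mul, weight_neg_mul, Complex.ofReal_one, one_smul]
  refine ⟨G, h3, h4, ?_⟩
  have h5 := fourierInv_L2_ae_eq G h4
  rw [hG, FourierTransform.fourierInv_fourier_eq, ← hG] at h5
  exact (hu.ae_eq_iff_eq volume (continuous_fourierInv h4)).1 (hu2.coeFn_toLp.symm.trans h5)

theorem tendsto_fourierInv_cocompact {F : Type*} [NormedAddCommGroup F] [InnerProductSpace ℂ F]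
    [CompleteSpace F] (G : Plane → F) : Tendsto (𝓕⁻ G) (cocompact Plane) (𝓝 0) := by
  have h1 := (tendsto_integral_exp_inner_smul_cocompact G).comp
    (Homeomorph.neg Plane).isClosedEmbedding.tendsto_cocompact
  refine h1.congr fun x => ?_
  simp only [Function.comp_apply, Homeomorph.coe_neg, Real.fourierInv_eq, inner_neg_right, neg_neg]

theorem tendsto_weight_neg_cocompact {s : ℝ} (hs : 0 < s) :
    Tendsto (weight (-s)) (cocompact Plane) (𝓝 0) := by
  have h1 := (tendsto_rpow_neg_atTop (half_pos hs)).comp (tendsto_atTop_add_const_left _ (1 : ℝ)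
    ((tendsto_pow_atTop two_ne_zero).comp (tendsto_norm_cocompact_atTop (E := Plane))))
  refine h1.congr fun x => ?_
  simp only [weight, Function.comp_apply, neg_div]

end
end Kagome

namespace Kagome
noncomputable section
open scoped FourierTransform

/-! ### The projection commutes with the Fourier transform -/

/-- `Π₀` acting on square integrable functions. -/
def projOp : L2Plane →L[ℂ] L2Plane :=
  multOp (K := fun _ => bottomCLM) aestronglyMeasurable_const (fun _ => le_rfl)

theorem coeFn_projOp (G : L2Plane) : projOp G =ᵐ[volume] fun x => bottomProj (G x) :=
  coeFn_multOp (K := fun _ => bottomCLM) aestronglyMeasurable_const (fun _ => le_rfl) G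

theorem fourierInv_projOp (G : L2Plane) : (𝓕⁻ (projOp G) : L2Plane) = projOp (𝓕⁻ G) := by
  refine Lp.ext (ae_eq_of_integral_contDiff_smul_eq
    ((Lp.memLp _).locallyIntegrable (by norm_num)) ((Lp.memLp _).locallyIntegrable (by norm_num)) ?_)
  intro g hg hgc
  have hg' : ContDiff ℝ (⊤ : ℕ∞) (fun x => (g x : ℂ)) := Complex.ofRealCLM.contDiff.comp hg
  have hgc' : HasCompactSupport (fun x => (g x : ℂ)) := hgc.comp_left Complex.ofReal_zero
  set φ : 𝓢(Plane, ℂ) := hgc'.toSchwartzMap hg' with hφ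
  have e1 : ∀ (x : Plane) (a : Cell), g x • a = φ x • a := fun x a => (Complex.coe_smul (g x) a).symm
  have e2 : ∀ (ψ : 𝓢(Plane, ℂ)) (H : L2Plane), ∫ x, ψ x • projOp H x = bottomCLM (∫ x, ψ x • H x) := by
    intro ψ H
    rw [← ContinuousLinearMap.integral_comp_comm _ (integrable_schwartz_smul ψ H)]
    refine integral_congr_ae ((coeFn_projOp H).mono fun x hx => ?_)
    simp only [hx, map_smul, bottomCLM_apply]
  simp only [e1]
  rw [integral_smul_fourierInv_L2, e2, e2, integral_smul_fourierInv_L2]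

theorem fourier_projOp (G : L2Plane) : (𝓕 (projOp G) : L2Plane) = projOp (𝓕 G) := by
  have h1 := fourierInv_projOp (𝓕 G)
  rw [FourierTransform.fourierInv_fourier_eq] at h1
  rw [← h1, FourierTransform.fourier_fourierInv_eq]

/-! ### Samples on arbitrary meshes -/

/-- A coarse mesh is a sublattice of the finer mesh `h / N ≤ 1 / 2`, so its samples form a subfamily
of a square summable family. -/
theorem memℓp_sample_of_pos {t : ℝ} (ht : 1 < t) {G : Plane → Cell} (hG : InX t G) {h : ℝ}
    (hh : 0 < h) : Memℓp (sample h (𝓕⁻ G)) 2 := by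
  obtain ⟨N, hN⟩ := exists_nat_gt (2 * h)
  have hN0 : (0 : ℝ) < N := by linarith
  have h1 := memℓp_two_iff.1 (memℓp_sample ht hG (div_pos hh hN0)
    (by rw [div_le_iff₀ hN0]; linarith))
  have hinj : Function.Injective fun n : Fin 2 → ℤ => N • n := by
    have : N ≠ 0 := by exact_mod_cast hN0.ne'
    exact nsmul_right_injective this
  refine memℓp_two_iff.2 ((h1.comp_injective hinj).congr fun n => ?_)
  have : meshPoint (h / N) (N • n) = meshPoint h n := by
    ext j
    simp only [meshPoint, Pi.smul_apply, nsmul_eq_mul, Int.cast_mul, Int.cast_natCast]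
    field_simp
  simp only [Function.comp_apply, sample, this]

/-! ### Convergence for the free equation -/

theorem weight_smul_spec_ae_eq {h : ℝ} (hh : 0 < h) {z : ℂ} (hz : z.im ≠ 0)
    {u k : (Fin 2 → ℤ) → Cell} (hu : Memℓp u 2)
    (huk : ∀ n, hamiltonian h u n - z • u n = k n) :
    (fun ζ => (weight 2 ζ : ℂ) • spec h u ζ) =ᵐ[volume] fun ζ => resKernel h z ζ (spec h k ζ) := by
  have h1 := spec_hamiltonian hh z hu
  rw [funext huk] at h1
  filter_upwards [h1, coeFn_spec_support hh hu] with ζ h2 h3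
  by_cases hζ : ζ ∈ torus (2 * Real.pi * h)
  · have h4 : spec h k ζ = symbolSub h z ζ (spec h u ζ) := h2
    rw [resKernel, indicator_of_mem hζ, h4, _root_.smul_apply, symbolRes_symbolSub h hz]
  · rw [resKernel, indicator_of_notMem hζ, h3 hζ, smul_zero]
    rfl

/-- The gain of two powers of frequency: convergence of the sources in plain `L²` yields convergence
of the free solutions in `⟨ζ⟩ ^ (-2) L²`. -/
theorem tendsto_normX_spec_sub {z : ℂ} (hz : z.im ≠ 0) {u k : ℝ → (Fin 2 → ℤ) → Cell}
    (hu : ∀ᶠ h in 𝓝[>] 0, Memℓp (u h) 2 ∧ ∀ n, hamiltonian h (u h) n - z • u h n = k h n)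
    {F D : L2Plane} (hk : Tendsto (fun h => spec h (k h)) (𝓝[>] 0) (𝓝 F))
    (hD : limitMult hz F =ᵐ[volume] fun ζ => (weight 2 ζ : ℂ) • D ζ) :
    (∀ᶠ h in 𝓝[>] 0, InX 2 (spec h (u h))) ∧
      Tendsto (fun h => normX 2 (fun ζ => spec h (u h) ζ - D ζ)) (𝓝[>] 0) (𝓝 0) := by
  have h1 : ∀ᶠ h : ℝ in 𝓝[>] 0, ∃ hh : 0 < h, (fun ζ => (weight 2 ζ : ℂ) • spec h (u h) ζ)
      =ᵐ[volume] resMult hh hz (spec h (k h)) := by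
    filter_upwards [hu, self_mem_nhdsWithin] with h hu' hh
    refine ⟨hh, (weight_smul_spec_ae_eq hh hz hu'.1 hu'.2).trans ?_⟩
    exact (coeFn_multOp (aestronglyMeasurable_resKernel h hz) (norm_resKernel_le hh hz) _).symm
  refine ⟨?_, ?_⟩
  · filter_upwards [h1] with h hh
    obtain ⟨hh, h2⟩ := hh
    exact (Lp.memLp _).ae_eq h2.symm
  · set Y : ℝ → L2Plane := fun h => if hh : 0 < h then resMult hh hz (spec h (k h)) else 0 with hY
    have h3 : Tendsto Y (𝓝[>] 0) (𝓝 (limitMult hz F)) := by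
      refine tendsto_resMult hz hk ?_
      filter_upwards [self_mem_nhdsWithin] with h hh
      simp only [hY]
      rw [dif_pos (show 0 < h from hh)]
      exact coeFn_multOp (aestronglyMeasurable_resKernel h hz) (norm_resKernel_le hh hz) _
    refine (tendsto_iff_norm_sub_tendsto_zero.1 h3).congr' ?_
    filter_upwards [h1] with h hh
    obtain ⟨hh, h2⟩ := hh
    rw [normX, weightedNorm, Lp.norm_def]
    congr 1
    refine eLpNorm_congr_ae ?_
    simp only [hY]
    rw [dif_pos hh]
    filter_upwards [h2, hD, Lp.coeFn_sub (resMult hh hz (spec h (k h))) (limitMult hz F)]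
      with ζ h4 h5 h6
    rw [h6, Pi.sub_apply, ← h4, h5, smul_sub]

/-! ### Norms controlled by the weighted norm -/

theorem integral_norm_le_normX {G : Plane → Cell} (hG : InX 2 G) :
    ∫ ζ, ‖G ζ‖ ≤ (eLpNorm (weight (-2)) 2 (volume : Measure Plane)).toReal * normX 2 G := by
  have hw := memLp_weight_neg one_lt_two
  have h1 : eLpNorm G 1 (volume : Measure Plane)
      ≤ eLpNorm (weight (-2)) 2 volume * weightedNorm 2 G := by
    have h2 := eLpNorm_smul_le_mul_eLpNorm (r := 1) (p := 2) (q := 2) hG.1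
      (hw.ofReal (K := ℂ)).1
    have h3 : eLpNorm (fun x => ((weight (-2) x : ℝ) : ℂ)) 2 (volume : Measure Plane)
        = eLpNorm (weight (-2)) 2 volume :=
      eLpNorm_congr_norm_ae (Eventually.of_forall fun x => Complex.norm_real _)
    refine le_trans (le_of_eq ?_) (h2.trans_eq (congrArg (· * weightedNorm 2 G) h3))
    refine congrArg (fun H => eLpNorm H 1 volume) (funext fun ζ => ?_)
    exact (weight_smul_cancel 2 G ζ).symm
  rw [integral_norm_eq_lintegral_enorm (hG.memLp zero_le_two).1, ← eLpNorm_one_eq_lintegral_enorm,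
    normX, ← ENNReal.toReal_mul]
  exact ENNReal.toReal_mono (ENNReal.mul_ne_top hw.2.ne hG.2.ne) h1

/-- The supremum of an inverse transform is at most the `L¹` norm, which Cauchy–Schwarz bounds
through `⟨ζ⟩ ^ (-2) ∈ L²`. -/
theorem norm_fourierInv_le_normX {G : Plane → Cell} (hG : InX 2 G) (x : Plane) :
    ‖𝓕⁻ G x‖ ≤ (eLpNorm (weight (-2)) 2 (volume : Measure Plane)).toReal * normX 2 G := by
  refine le_trans ?_ (integral_norm_le_normX hG)
  rw [Real.fourierInv_eq]
  refine (norm_integral_le_integral_norm _).trans_eq ?_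
  simp only [Circle.norm_smul]

theorem weightedNorm_fourierInv_le {σ : ℝ} (hσ : 0 ≤ σ) {G : Plane → Cell} (hG : InX 2 G) :
    weightedNorm (-σ) (𝓕⁻ G) ≤ ENNReal.ofReal (normX 2 G) := by
  obtain ⟨hg, hg'⟩ := fourier_toLp_fourierInv (hG.integrable one_lt_two) (hG.memLp zero_le_two)
  have h1 : ‖hg.toLp _‖ ≤ normX 2 G := by
    have h2 : ∀ A : L2Plane, ‖(𝓕 A : L2Plane)‖ = ‖A‖ := (Lp.fourierTransformₗᵢ Plane Cell).norm_map
    rw [← h2, hg']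
    exact norm_toLp_le_normX zero_le_two hG
  rw [Lp.norm_toLp] at h1
  calc weightedNorm (-σ) (𝓕⁻ G) ≤ eLpNorm (𝓕⁻ G) 2 volume := by
        refine eLpNorm_mono fun x => ?_
        rw [norm_smul, Complex.norm_real, Real.norm_of_nonneg (weight_pos _ x).le]
        exact mul_le_of_le_one_left (norm_nonneg _) (weight_le_one (by linarith) x)
    _ ≤ ENNReal.ofReal (normX 2 G) := by
        rw [← ENNReal.ofReal_toReal hg.2.ne]
        exact ENNReal.ofReal_le_ofReal h1

end
end Kagome

namespace Kagome
noncomputable section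
open scoped FourierTransform

/-! ### Convergence of the spectra of the lattice solutions -/

/-- The limit of the free resolvents recovers the solution of the limit equation. -/
theorem limitMult_eq {w : Plane → ℝ} (hw : Continuous w) {C : ℝ} (hC : ∀ x, |w x| ≤ C) {z : ℂ}
    (hz : z.im ≠ 0) {f : Plane → Cell} (hf : MemLp f 2 (volume : Measure Plane))
    (hg : MemLp (fun x => bottomProj (f x)) 2 (volume : Measure Plane)) {D : L2Plane}
    (hD : IsSpecSolution hw hC z (𝓕 (hg.toLp _) : L2Plane) D)
    (hproj : ∀ᵐ x ∂(volume : Measure Plane), bottomProj ((𝓕⁻ D : L2Plane) x) = (𝓕⁻ D : L2Plane) x) :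
    limitMult hz ((𝓕 (hf.toLp f) : L2Plane) - potOp hw hC D)
      =ᵐ[volume] fun ζ => (weight 2 ζ : ℂ) • D ζ := by
  set F : L2Plane := (𝓕 (hf.toLp f) : L2Plane) - potOp hw hC D with hF
  -- The projection acts only on `f`, because `V v` already takes values in the range of `Π₀`. Hence
  -- the free limit resolvent with source `f - V v` returns exactly `v`.
  have h1 : projOp (hf.toLp f - mulOp hw hC (𝓕⁻ D)) = hg.toLp _ - mulOp hw hC (𝓕⁻ D) := by
    refine Lp.ext ?_
    filter_upwards [coeFn_projOp (hf.toLp f - mulOp hw hC (𝓕⁻ D)),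
      Lp.coeFn_sub (hf.toLp f) (mulOp hw hC (𝓕⁻ D)),
      Lp.coeFn_sub (hg.toLp _) (mulOp hw hC (𝓕⁻ D)), hf.coeFn_toLp, hg.coeFn_toLp,
      coeFn_mulOp hw hC (𝓕⁻ D : L2Plane), hproj] with x h2 h3 h4 h5 h6 h7 h8
    rw [h2, h3, h4, Pi.sub_apply, Pi.sub_apply, h5, h6, h7, ← bottomCLM_apply, map_sub, map_smul,
      bottomCLM_apply, bottomCLM_apply, h8]
  have hsub : ∀ A B : L2Plane, (𝓕 (A - B) : L2Plane) = 𝓕 A - 𝓕 B :=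
    map_sub (Lp.fourierTransformₗᵢ Plane Cell)
  have h2 : projOp F = (𝓕 (hg.toLp _) : L2Plane) - potOp hw hC D := by
    rw [hF, potOp_apply, ← hsub, ← hsub, ← h1, fourier_projOp]
  have h3 : ((𝓕 (hg.toLp _) : L2Plane) + z • D - potOp hw hC D) = projOp F + z • D := by
    rw [h2]; abel
  rw [IsSpecSolution, h3] at hD
  filter_upwards [hD, Lp.coeFn_add (projOp F) (z • D), Lp.coeFn_smul z D, coeFn_projOp F,
    coeFn_multOp (aestronglyMeasurable_weight_smul_limitRes hz) (norm_weight_smul_limitRes_le hz) F]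
    with ζ h4 h5 h6 h7 h8
  rw [limitMult, h8, _root_.smul_apply, limitRes, _root_.smul_apply, bottomCLM_apply, ← h7]
  rw [h5, Pi.add_apply, h6, Pi.smul_apply] at h4
  have h9 : projOp F ζ = ((limitSymbol ζ : ℂ) - z) • D ζ := by
    rw [sub_smul, h4, add_sub_cancel_right]
  rw [h9, smul_smul _ _ (D ζ), inv_mul_cancel₀ (limitSymbol_sub_ne_zero hz ζ), one_smul]

theorem tendsto_spec_of_tendsto_normX {u : ℝ → (Fin 2 → ℤ) → Cell} {D : L2Plane} (hD : InX 2 D)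
    (h1 : ∀ᶠ h in 𝓝[>] 0, InX 2 (spec h (u h)))
    (h2 : Tendsto (fun h => normX 2 (fun ζ => spec h (u h) ζ - D ζ)) (𝓝[>] 0) (𝓝 0)) :
    Tendsto (fun h => spec h (u h)) (𝓝[>] 0) (𝓝 D) := by
  rw [tendsto_iff_norm_sub_tendsto_zero]
  refine squeeze_zero' (Eventually.of_forall fun h => norm_nonneg _) ?_ h2
  filter_upwards [h1] with h h3
  have h4 := norm_toLp_le_normX zero_le_two (h3.sub hD)
  rw [Lp.norm_toLp] at h4
  rwa [Lp.norm_def, eLpNorm_congr_ae (Lp.coeFn_sub _ _)]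

/-- The spectra of the lattice solutions converge in `⟨ζ⟩ ^ (-2) L²`. -/
theorem tendsto_normX_latticeSolution {V : Plane → ℝ} (hV : Continuous V) {C : ℝ}
    (hC : ∀ x, |V x| ≤ C) (hV0 : Tendsto (fun x => (V x : ℂ)) (cocompact Plane) (𝓝 0)) {z : ℂ}
    (hz : z.im ≠ 0) {t : ℝ} (ht : 1 < t) {G : Plane → Cell} (hG : InX t G) {W : Plane → ℂ}
    (hW : Continuous W) (hW0 : Tendsto W (cocompact Plane) (𝓝 0)) {f : Plane → Cell}
    (hfW : f = fun x => W x • 𝓕⁻ G x) (hf : MemLp f 2 (volume : Measure Plane))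
    {D : L2Plane} (hDX : InX 2 D)
    (hD : limitMult hz ((𝓕 (hf.toLp f) : L2Plane) - potOp hV hC D)
      =ᵐ[volume] fun ζ => (weight 2 ζ : ℂ) • D ζ)
    {u : ℝ → (Fin 2 → ℤ) → Cell} (hu : ∀ h : ℝ, 0 < h → IsLatticeSolution h V z f (u h)) :
    (∀ᶠ h in 𝓝[>] 0, InX 2 (spec h (u h))) ∧
      Tendsto (fun h => normX 2 (fun ζ => spec h (u h) ζ - D ζ)) (𝓝[>] 0) (𝓝 0) := by
  set v : Plane → Cell := 𝓕⁻ (D : Plane → Cell) with hv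
  have hDi := hDX.integrable one_lt_two
  have hvL : v =ᵐ[volume] (𝓕⁻ D : L2Plane) := (fourierInv_L2_ae_eq D hDi).symm
  have hC' : ∀ x, ‖(V x : ℂ)‖ ≤ C := fun x => by
    rw [Complex.norm_real]; exact hC x
  have hC0 : 0 ≤ C := (abs_nonneg _).trans (hC 0)
  have hVc : Continuous fun x => (V x : ℂ) := Complex.continuous_ofReal.comp hV
  obtain ⟨M, hM0, hM⟩ := exists_norm_le_of_tendsto_cocompact hW hW0
  -- samples
  have mf : ∀ h : ℝ, 0 < h → Memℓp (sample h f) 2 := fun h hh => by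
    rw [hfW]; exact memℓp_sample_smul hM (memℓp_sample_of_pos ht hG hh)
  have mv : ∀ h : ℝ, 0 < h → Memℓp (sample h v) 2 := fun h hh =>
    memℓp_sample_of_pos one_lt_two hDX hh
  have mVv : ∀ h : ℝ, 0 < h → Memℓp (sample h fun x => (V x : ℂ) • v x) 2 := fun h hh =>
    memℓp_sample_smul hC' (mv h hh)
  have tf : Tendsto (fun h => spec h (sample h f)) (𝓝[>] 0) (𝓝 (𝓕 (hf.toLp f) : L2Plane)) := by
    subst hfW
    exact tendsto_spec_sample_smul ht hG hW hW0 hf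
  have tv : Tendsto (fun h => spec h (sample h v)) (𝓝[>] 0) (𝓝 D) := by
    have := tendsto_spec_sample one_lt_two hDX
    rwa [Lp.toLp_coeFn] at this
  have tVv : Tendsto (fun h => spec h (sample h fun x => (V x : ℂ) • v x)) (𝓝[>] 0)
      (𝓝 (potOp hV hC D)) := by
    have hVv : MemLp (fun x => (V x : ℂ) • v x) 2 (volume : Measure Plane) :=
      memLp_bounded_smul hVc.aestronglyMeasurable hC' ((Lp.memLp _).ae_eq hvL.symm)
    have h1 := tendsto_spec_sample_smul one_lt_two hDX hVc hV0 hVv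
    have h2 : hVv.toLp _ = mulOp hV hC (𝓕⁻ D) := by
      refine Lp.ext ?_
      filter_upwards [hVv.coeFn_toLp, coeFn_mulOp hV hC (𝓕⁻ D : L2Plane), hvL] with x h3 h4 h5
      rw [h3, h4, h5]
    rwa [h2, ← potOp_apply] at h1
  -- the free equation with the limit source
  set k : ℝ → (Fin 2 → ℤ) → Cell := fun h => sample h f - sample h fun x => (V x : ℂ) • v x with hk
  have mk : ∀ h : ℝ, 0 < h → Memℓp (k h) 2 := fun h hh => (mf h hh).sub (mVv h hh)
  have tk : Tendsto (fun h => spec h (k h)) (𝓝[>] 0)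
      (𝓝 ((𝓕 (hf.toLp f) : L2Plane) - potOp hV hC D)) := by
    refine (tf.sub tVv).congr' ?_
    filter_upwards [self_mem_nhdsWithin] with h hh
    rw [hk, spec_sub hh (mf h hh) (mVv h hh)]
  -- The free equation is the lattice equation with potential zero; for `h ≤ 0` an arbitrary value
  -- is chosen.
  have hex : ∀ h : ℝ, ∃ w : (Fin 2 → ℤ) → Cell, 0 < h →
      Memℓp w 2 ∧ ∀ n, hamiltonian h w n - z • w n = k h n := by
    intro h
    by_cases hh : 0 < h
    · have h0 : ∀ x : Plane, |(fun _ => 0 : Plane → ℝ) x| ≤ (0 : ℝ) := fun x => by simp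
      have h1 := existsUnique_latticeSolution h h0 hz
        (f := fun x => f x - (V x : ℂ) • v x) (mk h hh)
      obtain ⟨w, ⟨hw1, hw2⟩, -⟩ := h1
      refine ⟨w, fun _ => ⟨hw1, fun n => ?_⟩⟩
      have := hw2 n
      simp only [Complex.ofReal_zero, zero_smul, add_zero] at this
      exact this
    · exact ⟨0, fun h' => absurd h' hh⟩
  choose w hw using hex
  have cw := tendsto_normX_spec_sub hz (u := w) (k := k)
    (by filter_upwards [self_mem_nhdsWithin] with h hh using hw h hh) tk hD
  have tw := tendsto_spec_of_tendsto_normX hDX cw.1 cw.2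
  -- comparison with the full equation
  have tuw : Tendsto (fun h => spec h (u h - w h)) (𝓝[>] 0) (𝓝 0) := by
    have h1 : Tendsto (fun h => |z.im|⁻¹ * (C * ‖spec h (sample h v) - spec h (w h)‖)) (𝓝[>] 0)
        (𝓝 0) := by
      have := ((tv.sub tw).norm.const_mul C).const_mul |z.im|⁻¹
      simpa using this
    refine squeeze_zero_norm' ?_ h1
    filter_upwards [self_mem_nhdsWithin] with h hh
    have hh : 0 < h := hh
    have m1 : Memℓp (sample h v - w h) 2 := (mv h hh).sub (hw h hh).1
    set e : (Fin 2 → ℤ) → Cell := fun n => (V (meshPoint h n) : ℂ) • (sample h v - w h) n with he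
    have b1 : ∀ n, ‖e n‖ ≤ C * ‖(sample h v - w h) n‖ := fun n => by
      rw [he, norm_smul]
      exact mul_le_mul_of_nonneg_right (hC' _) (norm_nonneg _)
    -- The full operator applied to `u - w` leaves `V (v - w)` at the mesh points. The spectra of
    -- the samples of `v` and of `w` have the common limit `D`, so the stability estimate finishes
    -- the comparison.
    have h2 : |z.im| * ‖spec h (u h - w h)‖ ≤ ‖spec h e‖ := by
      refine norm_spec_le_of_solution hh hC ((hu h hh).1.sub (hw h hh).1) fun n => ?_
      have e1 := (hu h hh).2 n
      have e2 := (hw h hh).2 n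
      have e3 : hamiltonian h (u h - w h) n = hamiltonian h (u h) n - hamiltonian h (w h) n := by
        have := hamOp_apply h (⟨u h, (hu h hh).1⟩ - ⟨w h, (hw h hh).1⟩) n
        rw [map_sub, lp.coeFn_sub, Pi.sub_apply, hamOp_apply, hamOp_apply] at this
        exact this.symm
      have e4 : k h n = f (meshPoint h n) - (V (meshPoint h n) : ℂ) • v (meshPoint h n) := rfl
      have e5 : sample h v n = v (meshPoint h n) := rfl
      rw [e4] at e2
      simp only [he, Pi.sub_apply, e3, e5]
      have e6 : hamiltonian h (u h) n = f (meshPoint h n) + z • u h n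
          - (V (meshPoint h n) : ℂ) • u h n := by rw [← e1]; abel
      have e7 : hamiltonian h (w h) n = f (meshPoint h n)
          - (V (meshPoint h n) : ℂ) • v (meshPoint h n) + z • w h n := by rw [← e2]; abel
      rw [e6, e7]
      module
    have h3 := norm_spec_le_of_le hh (memℓp_of_le m1 b1) m1 hC0 b1
    rw [spec_sub hh (mv h hh) (hw h hh).1] at h3
    rw [le_inv_mul_iff₀ (abs_pos.2 hz)]
    exact h2.trans h3
  have tu : Tendsto (fun h => spec h (u h)) (𝓝[>] 0) (𝓝 D) := by
    have h1 := tuw.add tw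
    rw [zero_add] at h1
    refine h1.congr' ?_
    filter_upwards [self_mem_nhdsWithin] with h hh
    rw [spec_sub hh (hu h hh).1 (hw h hh).1, sub_add_cancel]
  -- the full equation as a free equation
  set e : ℝ → (Fin 2 → ℤ) → Cell := fun h n =>
    (V (meshPoint h n) : ℂ) • (sample h v - u h) n with he
  have me : ∀ h : ℝ, 0 < h → Memℓp (e h) 2 ∧ ‖spec h (e h)‖ ≤ C * ‖spec h (sample h v - u h)‖ := by
    intro h hh
    have m1 : Memℓp (sample h v - u h) 2 := (mv h hh).sub (hu h hh).1
    have b1 : ∀ n, ‖e h n‖ ≤ C * ‖(sample h v - u h) n‖ := fun n => by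
      rw [he, norm_smul]
      exact mul_le_mul_of_nonneg_right (hC' _) (norm_nonneg _)
    exact ⟨memℓp_of_le m1 b1, norm_spec_le_of_le hh (memℓp_of_le m1 b1) m1 hC0 b1⟩
  have te : Tendsto (fun h => spec h (e h)) (𝓝[>] 0) (𝓝 0) := by
    have h1 : Tendsto (fun h => C * ‖spec h (sample h v) - spec h (u h)‖) (𝓝[>] 0) (𝓝 0) := by
      have := (tv.sub tu).norm.const_mul C
      simpa using this
    refine squeeze_zero_norm' ?_ h1
    filter_upwards [self_mem_nhdsWithin] with h hh
    rw [← spec_sub hh (mv h hh) (hu h hh).1]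
    exact (me h hh).2
  -- Now `u` solves the free equation with source `k + V (v - u)`, whose second term tends to zero
  -- by the `L²` convergence just proved; the free result supplies the stronger norm.
  refine tendsto_normX_spec_sub hz (u := u) (k := fun h => k h + e h) ?_ (F := _) (D := D) ?_ hD
  · filter_upwards [self_mem_nhdsWithin] with h hh
    refine ⟨(hu h hh).1, fun n => ?_⟩
    have e1 := (hu h hh).2 n
    have e4 : k h n = f (meshPoint h n) - (V (meshPoint h n) : ℂ) • v (meshPoint h n) := rfl
    have e5 : sample h v n = v (meshPoint h n) := rfl
    simp only [he, Pi.add_apply, Pi.sub_apply, e4, e5, ← e1]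
    module
  · have h1 := tk.add te
    rw [add_zero] at h1
    refine h1.congr' ?_
    filter_upwards [self_mem_nhdsWithin] with h hh
    rw [spec_add hh (mk h hh) (me h hh).1]

end
end Kagome

/-! ### The continuum limit -/

theorem mainTheorem10 (m s : ℝ) (hm : 2 < m) (hs : 3 < s)
    (f : Kagome.Plane → Kagome.Cell) (hfc : Continuous f) (hf : Kagome.MemHW m s f)
    (r : ℝ) (hr : 1 < r) (V : Kagome.Plane → ℝ) (hVc : Continuous V)
    (hV : Kagome.MemH r (fun x => (V x : ℂ)))
    (z : ℂ) (hz : z.im ≠ 0) :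
    (∀ h : ℝ, 0 < h → ∃! u : (Fin 2 → ℤ) → Kagome.Cell, Kagome.IsLatticeSolution h V z f u) ∧
    ∃ v : Kagome.Plane → Kagome.Cell,
      Continuous v ∧
      Kagome.IsContinuumSolution V z (fun x => Kagome.bottomProj (f x)) v ∧
      (∀ w : Kagome.Plane → Kagome.Cell,
        Kagome.IsContinuumSolution V z (fun x => Kagome.bottomProj (f x)) w →
          w =ᵐ[volume] v) ∧
      (∀ x, Kagome.bottomProj (v x) = v x) ∧
      ∀ u : ℝ → (Fin 2 → ℤ) → Kagome.Cell,
        (∀ h : ℝ, 0 < h → Kagome.IsLatticeSolution h V z f (u h)) →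
          (∀ σ : ℝ, 0 < σ → σ < 1 / 2 →
            Tendsto (fun h : ℝ => Kagome.weightedNorm (-σ)
              (fun x => Kagome.interpolation h (u h) x - v x)) (𝓝[>] 0) (𝓝 0)) ∧
          TendstoLocallyUniformly (fun (h : ℝ) (x : Kagome.Plane) => Kagome.interpolation h (u h) x)
            v (𝓝[>] 0) := by
  open Kagome FourierTransform in
  -- the data as inverse Fourier transforms
  obtain ⟨GV, -, -, hGV⟩ := exists_fourierInv_of_memH hr (Complex.continuous_ofReal.comp hVc) hV
  have hV0 : Tendsto (fun x => (V x : ℂ)) (cocompact Plane) (𝓝 0) := by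
    have h1 := tendsto_fourierInv_cocompact GV
    rwa [← hGV] at h1
  obtain ⟨C, -, hC'⟩ := exists_norm_le_of_tendsto_cocompact
    (Complex.continuous_ofReal.comp hVc) hV0
  have hC : ∀ x, |V x| ≤ C := fun x => by
    have := hC' x
    rwa [Function.comp_apply, Complex.norm_real] at this
  obtain ⟨G, hG, -, hGf⟩ := exists_fourierInv_of_memH (by linarith : 1 < m)
    ((Complex.continuous_ofReal.comp (continuous_weight s)).smul hfc) hf
  have hG' : InX m G := hG
  have hW : Continuous fun x => ((weight (-s) x : ℝ) : ℂ) :=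
    Complex.continuous_ofReal.comp (continuous_weight (-s))
  have hW0 : Tendsto (fun x => ((weight (-s) x : ℝ) : ℂ)) (cocompact Plane) (𝓝 0) := by
    have := (Complex.continuous_ofReal.tendsto 0).comp
      (tendsto_weight_neg_cocompact (by linarith : 0 < s))
    rwa [Complex.ofReal_zero] at this
  -- The datum is written as a weight vanishing at infinity times a Sobolev function, the form in
  -- which products are sampled consistently.
  have hfW : f = fun x => ((weight (-s) x : ℝ) : ℂ) • 𝓕⁻ G x := by
    funext x
    rw [← hGf]
    exact (weight_smul_cancel s f x).symm
  obtain ⟨M, -, hM⟩ := exists_norm_le_of_tendsto_cocompact hW hW0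
  have hf2 : MemLp f 2 (volume : Measure Plane) := by
    have h1 := memLp_bounded_smul hW.aestronglyMeasurable hM hf.choose
    refine h1.ae_eq (Eventually.of_forall fun x => ?_)
    exact weight_smul_cancel s f x
  have hg : MemLp (fun x => bottomProj (f x)) 2 (volume : Measure Plane) :=
    bottomCLM.comp_memLp' hf2
  -- the solution of the limit equation
  obtain ⟨D, hD⟩ := exists_isSpecSolution hVc hC hz (𝓕 (hg.toLp _) : L2Plane)
  have hDX : InX 2 D := hD.inX hVc hC
  have hDi := hDX.integrable one_lt_two
  set v : Plane → Cell := 𝓕⁻ (D : Plane → Cell) with hv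
  have hvc : Continuous v := continuous_fourierInv hDi
  have hvL : v =ᵐ[volume] (𝓕⁻ D : L2Plane) := (fourierInv_L2_ae_eq D hDi).symm
  have hvsol : IsContinuumSolution V z (fun x => bottomProj (f x)) v :=
    (isContinuumSolution_iff hVc hC z hg hvL).2 hD
  have hvproj : ∀ x, bottomProj (v x) = v x := by
    have h1 := hvsol.bottomProj hVc hC hg
    simp only [bottomProj_bottomProj] at h1
    have h2 := h1.ae_eq hVc hC hz hg hvsol
    -- Both `Π₀ v` and `v` solve the same equation, so they agree almost everywhere, and by
    -- continuity everywhere.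
    exact congrFun (((bottomCLM.continuous.comp hvc).ae_eq_iff_eq volume hvc).1 h2)
  have hlim := limitMult_eq hVc hC hz hf2 hg hD (hvL.mono fun x hx => by rw [← hx, hvproj])
  refine ⟨fun h hh => existsUnique_latticeSolution h hC hz ?_, v, hvc, hvsol,
    fun w hw => hw.ae_eq hVc hC hz hg hvsol, hvproj, fun u hu => ?_⟩
  · rw [hfW]
    exact memℓp_sample_smul hM (memℓp_sample_of_pos (by linarith) hG' hh)
  obtain ⟨c1, c2⟩ := tendsto_normX_latticeSolution hVc hC hV0 hz (by linarith : 1 < m) hG' hW hW0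
    hfW hf2 hDX hlim hu
  -- The error is the inverse transform of the difference of spectra, so both modes of convergence
  -- reduce to its norm in `⟨ζ⟩ ^ (-2) L²`.
  have hdiff : ∀ᶠ h in 𝓝[>] 0, (fun x => interpolation h (u h) x - v x)
      = 𝓕⁻ (fun ζ => spec h (u h) ζ - D ζ) ∧ InX 2 (fun ζ => spec h (u h) ζ - D ζ) := by
    filter_upwards [c1, self_mem_nhdsWithin] with h h1 hh
    refine ⟨?_, h1.sub hDX⟩
    rw [fourierInv_sub (h1.integrable one_lt_two) hDi]
    funext x
    rw [interpolation_eq_fourierInv hh (hu h hh).1]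
  constructor
  · intro σ hσ _
    have h1 := ENNReal.tendsto_ofReal c2
    rw [ENNReal.ofReal_zero] at h1
    refine tendsto_of_tendsto_of_tendsto_of_le_of_le' tendsto_const_nhds h1
      (Eventually.of_forall fun h => zero_le) ?_
    filter_upwards [hdiff] with h h2
    rw [h2.1]
    exact weightedNorm_fourierInv_le hσ.le h2.2
  · refine TendstoUniformly.tendstoLocallyUniformly ?_
    rw [Metric.tendstoUniformly_iff]
    intro ε hε
    have h1 := c2.const_mul (eLpNorm (weight (-2)) 2 (volume : Measure Plane)).toReal
    rw [mul_zero] at h1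
    filter_upwards [hdiff, h1.eventually_lt_const hε] with h h2 h3 x
    rw [dist_comm, dist_eq_norm, show interpolation h (u h) x - v x
      = 𝓕⁻ (fun ζ => spec h (u h) ζ - D ζ) x from congrFun h2.1 x]
    exact (norm_fourierInv_le_normX h2.2 x).trans_lt h3
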